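/- Let $k$ be a field, $R$ a discrete valuation ring containing $k$, $u$ a uniformizer of $R$, $K=\mathrm{Frac}(R)$, and let $d,r\ge 0$ be integers. Put $X=\mathbb{A}^d_R=\mathrm{Spec}\,R[x_1,\dots,x_d]$ and let $D=(u)\subset X$, so that $X\setminus D=\mathbb{A}^d_K$. Let $\square^n=\mathrm{Spec}\,\mathbb{Z}[z_1,\dots,z_n]\subset(\mathbb{P}^1)^n$; its faces are the intersections of finitely many (possibly no) hyperplanes $\{z_i=0\}$, $\{z_i=1\}$, and $F_\infty$ is the Cartier divisor $\sum_i\{z_i=\infty\}$ on $(\mathbb{P}^1)^n$. Let $\underline{z}^r(X|D,n)$ be the group of codimension $r$ algebraic cycles on $X\times\square^n$ each of whose components $V$ satisfies (1) (face condition) $\mathrm{codim}_V(V\cap (X\times F))\ge\mathrm{codim}_{\square^n}(F)$ for every face $F$ of $\square^n$; (2) (modulus condition) if $\overline V^N$ is the normalization of the closure of $V$ in $X\times(\mathbb{P}^1)^n$, then the pull-back of $D$ to $\overline V^N$ is $\le$ the pull-back of $F_\infty$, as Cartier divisors (for $n=0$: $V\cap D=\emptyset$). These groups form a chain complex with the differential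 $\sum_{i=1}^n(-1)^{i-1}(\partial_{i,1}^*-\partial_{i,0}^*)$, where $\partial_{i,\epsilon}:\square^{n-1}\hookrightarrow\square^n$ inserts $\epsilon$ as the $i$-th coordinate. The degenerate cycles $\underline{z}^r(X|D,n)_{\mathrm{degen}}=\sum_{i}s_i^*\,\underline{z}^r(X|D,n-1)$, where $s_i:\square^n\to\square^{n-1}$ forgets the $i$-th coordinate, form a subcomplex, and $z^r(X|D,\bullet)=\underline{z}^r(X|D,\bullet)/\underline{z}^r(X|D,\bullet)_{\mathrm{degen}}$. Let $\mathcal{W}$ be a finite set of irreducible constructible subsets of $\mathbb{A}^d_K$ and let $e:\mathcal{W}\to\mathbb{N}$ be a map. Let $\underline{z}^r(X|D,n)_{\mathcal{W},e}\subset\underline{z}^r(X|D,n)$ be the subgroup of the cycles $V$ such that $$\mathrm{codim}_{W\times F}\bigl(|V|\cap(W\times F)\bigr)\ge r-e(W)$$ for all $W\in\mathcal{W}$ and all faces $F$ of $\square^n$. These groups are preserved by the differential. Let $z^r(X|D,\bullet)_{\mathcal{W},e}\subset z^r(X|D,\bullet)$ be the subcomplex formed by their images. Then the inclusion of complexes of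 abelian groups $$z^r(\mathbb{A}^d_R|D,\bullet)_{\mathcal{W},e}\subset z^r(\mathbb{A}^d_R|D,\bullet)$$ is a quasi-isomorphism. -/

import Mathlib

open CategoryTheory

universe v

noncomputable section

namespace ModulusCycles

/-! ### Codimension -/

/-- The codimension of a subset `Z` (closed, in all uses below) of a topological space `T`: the
infimum, over the irreducible closed subsets `C` of `T` contained in `Z`, of the supremum of the
lengths of chains of irreducible closed subsets of `T` starting at `C`.
The empty set has codimension `⊤`. -/
def codim (T : Type*) [TopologicalSpace T] (Z : Set T) : ℕ∞ :=
  ⨅ (C : TopologicalSpace.IrreducibleCloseds T) (_ : (C : Set T) ⊆ Z), Order.coheight C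

/-- For subsets `Y` and `V` of a topological space, the codimension of `V ∩ Y` in the
subspace `Y`. -/
def codimIn {T : Type*} [TopologicalSpace T] (Y V : Set T) : ℕ∞ :=
  codim Y {y : Y | (y : T) ∈ V}

/-! ### The cube over an affine scheme, and its faces -/

/-- The coordinate ring `S[z₁, …, zₙ]` of `Spec S × □ⁿ`. -/
abbrev CubeRing (S : Type v) [CommRing S] (n : ℕ) : Type v := MvPolynomial (Fin n) S

variable {S : Type v} [CommRing S]

/-- A face of `□ⁿ` is given by a partial assignment: `F i = some ε` imposes `zᵢ = ε`, and
`F i = none` imposes nothing on `zᵢ`. (The remaining intersections of the hyperplanes `zᵢ = 0`,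
`zᵢ = 1` are empty.) -/
abbrev Face (n : ℕ) : Type := Fin n → Option (Fin 2)

/-- The codimension of a face in `□ⁿ`: the number of imposed equations. -/
def Face.codim {n : ℕ} (F : Face n) : ℕ := (Finset.univ.filter fun i => (F i).isSome).card

/-- The closed subset `Spec S × F` of `Spec S × □ⁿ`. -/
def faceLocus (S : Type v) [CommRing S] {n : ℕ} (F : Face n) :
    Set (PrimeSpectrum (CubeRing S n)) :=
  PrimeSpectrum.zeroLocus
    {f | ∃ (i : Fin n) (ε : Fin 2), F i = some ε ∧
      f = MvPolynomial.X i - MvPolynomial.C ((ε : ℕ) : S)}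

/-- The subset `W × F` of `Spec S × □ⁿ`, for a subset `W` of `Spec S`: the inverse image of `W`
in `Spec S × F`. -/
def prodFace (W : Set (PrimeSpectrum S)) {n : ℕ} (F : Face n) :
    Set (PrimeSpectrum (CubeRing S n)) :=
  PrimeSpectrum.comap (MvPolynomial.C : S →+* CubeRing S n) ⁻¹' W ∩ faceLocus S F

/-- The closed subset of `Spec S × □ⁿ` with generic point `p`. -/
def primeSupport {n : ℕ} (p : PrimeSpectrum (CubeRing S n)) :
    Set (PrimeSpectrum (CubeRing S n)) :=
  PrimeSpectrum.zeroLocus (p.asIdeal : Set (CubeRing S n))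

/-! ### Face condition and modulus condition for prime cycles -/

/-- The prime cycle `V` with generic point `p` meets every face of `□ⁿ` properly:
`codim_V (V ∩ F) ≥ codim F`. -/
def FaceCondition {n : ℕ} (p : PrimeSpectrum (CubeRing S n)) : Prop :=
  ∀ F : Face n, (F.codim : ℕ∞) ≤ codimIn (primeSupport p) (faceLocus S F)

/-- The residue field of the point `p`, i.e. the function field of the prime cycle with generic
point `p`. -/
abbrev functionField {n : ℕ} (p : PrimeSpectrum (CubeRing S n)) : Type v :=
  p.asIdeal.ResidueField

/-- The coordinate function `zᵢ` as an element of the function field of a prime cycle. -/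
def coordFun {n : ℕ} (p : PrimeSpectrum (CubeRing S n)) (i : Fin n) : functionField p :=
  algebraMap (CubeRing S n) (functionField p) (MvPolynomial.X i)

/-- Let `V` be the prime cycle with generic point `p` and let `V̄` be its closure in
`Spec S × (ℙ¹)ⁿ`. The space `(ℙ¹)ⁿ` is covered by the affine open sets `U_J`, one for each subset
`J` of `{1, …, n}`, with coordinates `zᵢ` (`i ∉ J`) and `ζⱼ = 1 / zⱼ` (`j ∈ J`). If no `zⱼ`
with `j ∈ J` vanishes identically on `V`, then `V̄ ∩ (Spec S × U_J)` is the spectrum of the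
following subring of the function field of `V`. (Otherwise `V̄` does not meet `Spec S × U_J`.) -/
def closureChart {n : ℕ} (p : PrimeSpectrum (CubeRing S n)) (J : Finset (Fin n)) :
    Subalgebra S (functionField p) :=
  Algebra.adjoin S
    ({x | ∃ i, i ∉ J ∧ x = coordFun p i} ∪ {x | ∃ j, j ∈ J ∧ x = (coordFun p j)⁻¹})

/-- The modulus condition for the prime cycle `V` with generic point `p`, with respect to the
divisor `D = (u)` on `Spec S`: on the normalization `V̄ᴺ` of the closure `V̄` of `V` in
`Spec S × (ℙ¹)ⁿ`, the inequality of Cartier divisors `D|_{V̄ᴺ} ≤ F_∞|_{V̄ᴺ}` holds.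
Over the chart `U_J`, the normalization is the spectrum of the integral closure of `closureChart p J`
in the function field, `D` is given by `u`, and `F_∞` by the function `∏_{j ∈ J} ζⱼ`; the inequality
says that the latter is the former times a regular function.
The chart `J = ∅` says that `u` is invertible on `V`; for `n = 0` this is the whole condition. -/
def ModulusCondition (u : S) {n : ℕ} (p : PrimeSpectrum (CubeRing S n)) : Prop :=
  ∀ J : Finset (Fin n), (∀ j ∈ J, coordFun p j ≠ 0) →
    ∃ c ∈ integralClosure (closureChart p J) (functionField p),
      algebraMap S (functionField p) u * c = ∏ j ∈ J, (coordFun p j)⁻¹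

/-! ### Cycles -/

/-- Finite integral combinations of integral closed subschemes of `Spec A`. -/
abbrev Cycle (A : Type v) [CommRing A] : Type v := PrimeSpectrum A →₀ ℤ

/-- The group `z̲ʳ(Spec S | (u), n)`: cycles all of whose components have codimension `r` in
`Spec S × □ⁿ` and satisfy the face condition and the modulus condition. -/
def cyclesWithModulus (u : S) (r n : ℕ) : AddSubgroup (Cycle (CubeRing S n)) :=
  (Finsupp.supported ℤ ℤ {p : PrimeSpectrum (CubeRing S n) |
    p.asIdeal.height = r ∧ FaceCondition p ∧ ModulusCondition u p}).toAddSubgroup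

/-- The group `z̲ʳ(Spec S | (u), n)_{𝒲, e}`: the cycles `V` in `z̲ʳ(Spec S | (u), n)` such that
`codim_{W × F} (|V| ∩ (W × F)) ≥ r - e(W)` for all `W ∈ 𝒲` and all faces `F` of `□ⁿ`. -/
def cyclesInGoodPosition (u : S) (r : ℕ) (𝒲 : Set (Set (PrimeSpectrum S))) (e : 𝒲 → ℕ) (n : ℕ) :
    AddSubgroup (Cycle (CubeRing S n)) :=
  cyclesWithModulus u r n ⊓
  (Finsupp.supported ℤ ℤ {p : PrimeSpectrum (CubeRing S n) |
    ∀ (W : 𝒲) (F : Face n),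
      (r : ℕ∞) ≤ codimIn (prodFace (W : Set (PrimeSpectrum S)) F) (primeSupport p) + (e W : ℕ∞)}
    ).toAddSubgroup

/-! ### Pull-back of cycles, boundary and degeneracies -/

/-- The pull-back of the prime cycle `p` along `Spec B → Spec A`: the sum of the irreducible
components `q` of the inverse image, each with multiplicity the length of the local ring of
`Spec (B / p B)` at `q`. This is the pull-back of cycles if the morphism is flat, and also if it is
the inclusion of a principal Cartier divisor that does not contain the prime cycle (the equation of
the divisor is then a nonzerodivisor on `A / p`, so the higher Tor terms in Serre's formula
vanish). It is only relevant in these two cases. -/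
def pullbackPrime {A B : Type v} [CommRing A] [CommRing B] [IsNoetherianRing B] (φ : A →+* B)
    (p : PrimeSpectrum A) : Cycle B :=
  ∑ q ∈ (Ideal.finite_minimalPrimes_of_isNoetherianRing B (p.asIdeal.map φ)).toFinset.attach,
    haveI hq : q.1.IsPrime := Ideal.IsMinimalPrime.isPrime
      ((Ideal.finite_minimalPrimes_of_isNoetherianRing B (p.asIdeal.map φ)).mem_toFinset.1 q.2)
    Finsupp.single (⟨q.1, hq⟩ : PrimeSpectrum B)
      ((Module.length (Localization.AtPrime q.1) (Localization.AtPrime q.1 ⧸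
        p.asIdeal.map ((algebraMap B (Localization.AtPrime q.1)).comp φ))).toNat : ℤ)

/-- The pull-back of cycles, extended linearly from prime cycles. -/
def pullback {A B : Type v} [CommRing A] [CommRing B] [IsNoetherianRing B] (φ : A →+* B) :
    Cycle A →+ Cycle B :=
  Finsupp.liftAddHom fun p => (zmultiplesHom (Cycle B)) (pullbackPrime φ p)

variable [IsNoetherianRing S]

/-- The ring map of the face inclusion `∂_{i,ε} : □ⁿ → □ⁿ⁺¹` that inserts `ε` as the coordinate with
index `i`. -/
def faceMap (S : Type v) [CommRing S] {n : ℕ} (i : Fin (n + 1)) (ε : Fin 2) :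
    CubeRing S (n + 1) →+* CubeRing S n :=
  (MvPolynomial.aeval (R := S)
    (i.insertNth (α := fun _ => CubeRing S n) (MvPolynomial.C ((ε : ℕ) : S))
      MvPolynomial.X)).toRingHom

/-- The ring map of the projection `sᵢ : □ⁿ⁺¹ → □ⁿ` that forgets the coordinate with index `i`. -/
def degeneracyMap (S : Type v) [CommRing S] {n : ℕ} (i : Fin (n + 1)) :
    CubeRing S n →+* CubeRing S (n + 1) :=
  (MvPolynomial.rename (R := S) i.succAbove).toRingHom

/-- The differential `∑ᵢ (-1)ⁱ⁻¹ (∂_{i,1}^* - ∂_{i,0}^*)`; here the indices `i` start with `0`. -/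
def boundary (S : Type v) [CommRing S] [IsNoetherianRing S] (n : ℕ) :
    Cycle (CubeRing S (n + 1)) →+ Cycle (CubeRing S n) :=
  ∑ i : Fin (n + 1), ((-1 : ℤ) ^ (i : ℕ)) •
    (pullback (faceMap S i 1) - pullback (faceMap S i 0))

/-- The group `z̲ʳ(Spec S | (u), n)_degen` of degenerate cycles. -/
def degenerateCycles (u : S) (r : ℕ) : (n : ℕ) → AddSubgroup (Cycle (CubeRing S n))
  | 0 => ⊥
  | n + 1 => ⨆ i : Fin (n + 1), (cyclesWithModulus u r n).map (pullback (degeneracyMap S i))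

/-! ### The cycle complexes -/

/-- The facts that make `z̲ʳ(Spec S | (u), •)` and its degenerate part chain complexes. -/
structure FormsComplex (S : Type v) [CommRing S] [IsNoetherianRing S] (u : S) (r : ℕ) :
    Prop where
  boundary_mem : ∀ n, ∀ V ∈ cyclesWithModulus u r (n + 1), boundary S n V ∈ cyclesWithModulus u r n
  boundary_boundary : ∀ n, ∀ V ∈ cyclesWithModulus u r (n + 2),
    boundary S n (boundary S (n + 1) V) = 0
  degenerate_le : ∀ n, degenerateCycles u r n ≤ cyclesWithModulus u r n
  boundary_degenerate_mem : ∀ n, ∀ V ∈ degenerateCycles u r (n + 1),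
    boundary S n V ∈ degenerateCycles u r n

/-- The boundary preserves the groups `z̲ʳ(Spec S | (u), •)_{𝒲, e}`. -/
def FormsSubcomplex (u : S) (r : ℕ) (𝒲 : Set (Set (PrimeSpectrum S))) (e : 𝒲 → ℕ) : Prop :=
  ∀ n, ∀ V ∈ cyclesInGoodPosition u r 𝒲 e (n + 1),
    boundary S n V ∈ cyclesInGoodPosition u r 𝒲 e n

/-- The homomorphism `A / (A ∩ N) → A' / (A' ∩ N')` induced by a homomorphism `f` with `f A ⊆ A'`
and `f N ⊆ N'`. -/
def subquotientMap {G G' : Type v} [AddCommGroup G] [AddCommGroup G'] (f : G →+ G')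
    {A N : AddSubgroup G} {A' N' : AddSubgroup G'} (hA : ∀ x ∈ A, f x ∈ A')
    (hN : ∀ x ∈ N, f x ∈ N') : A ⧸ N.addSubgroupOf A →+ A' ⧸ N'.addSubgroupOf A' :=
  QuotientAddGroup.map (N.addSubgroupOf A) (N'.addSubgroupOf A')
    ((f.comp A.subtype).codRestrict A' fun x => hA x x.2)
    (fun x hx => hN x hx)

/-- The cycle complex `zʳ(Spec S | (u), •)`: cycles with modulus modulo degenerate cycles. -/
def cycleComplex {u : S} {r : ℕ} (h : FormsComplex S u r) :
    ChainComplex AddCommGrpCat.{v} ℕ :=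
  ChainComplex.of
    (fun n => AddCommGrpCat.of
      (cyclesWithModulus u r n ⧸ (degenerateCycles u r n).addSubgroupOf (cyclesWithModulus u r n)))
    (fun n => AddCommGrpCat.ofHom
      (subquotientMap (boundary S n) (h.boundary_mem n) (h.boundary_degenerate_mem n)))
    (fun n => by
      ext x
      refine (QuotientAddGroup.eq_zero_iff _).2 ?_
      change boundary S n (boundary S (n + 1) x) ∈ degenerateCycles u r n
      rw [h.boundary_boundary n x x.2]
      exact zero_mem _)

/-- The complex `zʳ(Spec S | (u), •)_{𝒲, e}`: cycles with modulus in good position, modulo the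
degenerate ones among them. -/
def goodPositionComplex {u : S} {r : ℕ} (h : FormsComplex S u r)
    {𝒲 : Set (Set (PrimeSpectrum S))} {e : 𝒲 → ℕ} (h' : FormsSubcomplex u r 𝒲 e) :
    ChainComplex AddCommGrpCat.{v} ℕ :=
  ChainComplex.of
    (fun n => AddCommGrpCat.of
      (cyclesInGoodPosition u r 𝒲 e n ⧸
        (degenerateCycles u r n).addSubgroupOf (cyclesInGoodPosition u r 𝒲 e n)))
    (fun n => AddCommGrpCat.ofHom
      (subquotientMap (boundary S n) (h' n) (h.boundary_degenerate_mem n)))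
    (fun n => by
      ext x
      refine (QuotientAddGroup.eq_zero_iff _).2 ?_
      change boundary S n (boundary S (n + 1) x) ∈ degenerateCycles u r n
      rw [h.boundary_boundary n x x.2.1]
      exact zero_mem _)

/-- The inclusion `zʳ(Spec S | (u), •)_{𝒲, e} ⊂ zʳ(Spec S | (u), •)`. -/
def goodPositionInclusion {u : S} {r : ℕ} (h : FormsComplex S u r)
    {𝒲 : Set (Set (PrimeSpectrum S))} {e : 𝒲 → ℕ} (h' : FormsSubcomplex u r 𝒲 e) :
    goodPositionComplex h h' ⟶ cycleComplex h :=
  ChainComplex.ofHom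
    (fun n => AddCommGrpCat.ofHom
      (subquotientMap (AddMonoidHom.id (Cycle (CubeRing S n)))
        (fun _ hx => hx.1) (fun _ hx => hx)))
    (fun n => by
      simp only [goodPositionComplex, cycleComplex, ChainComplex.of_d]
      ext x
      rfl)

end ModulusCycles

end

/-! A cycle with modulus does not meet D. Since every nonzero element of R is associated to a power
of u, all its points lie over the generic point of Spec R. For such points, dimension is the
transcendence degree over R of the residue domain (`pdim`), the dimension formula `height_add_pdim`
holds, and the conditions on faces and on W × F become inequalities between dimensions.

Cycles are moved by translations. For v in R^d, pull-back along H_v : (x, z₀, z) ↦ (x + z₀v, z) is a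
chain homotopy between the identity (at z₀ = 0) and the translation by v (at z₀ = 1). For arbitrary
v the modulus condition would be lost, as x + z₀v has poles where z₀ is infinite. It survives when u
divides v (`ModulusCondition.of_shearMap`): at a valuation where x + z₀v stays finite, the modulus
condition of the original cycle applies; at any other valuation z₀u has a pole, so the divisor z₀ =
∞ alone dominates D.

A discrete valuation ring is infinite, so the coordinates of v can be chosen in the infinite set uR
subject to finitely many genericity conditions. In a product of the parameter spaces of V, of W and
of z₀, the inverse image of V under H_v is cut out by the d equations z₀v_j = y_j - x_j, where y
lies on V and x in W. Where z₀ ≠ 0, each of them lowers the dimension for all but finitely many v_j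
(`exists_avoiding`, `exists_generic_translation`). Since v may depend on the finitely many cycles in
play, no extension of the base by a generic translation vector, and hence no descent, is needed.

Suppose that ∂V is g plus a degenerate cycle, with g in good position. The homotopy formula shows
that V equals τ_v V - H_v g - ∂(H_v V) modulo degenerate cycles, where τ_v V is the translate. For
generic v the translate is in good position. So is H_v g: away from z₀ = 0 by genericity, and on z₀
= 0 because there it restricts to g (`exists_moving_vector`, `exists_sub_boundary_mem`). This is
what the criterion `quasiIso_of_injective` asks for.

That the groups form complexes at all rests on the commutation, with multiplicities, of successive
restrictions to two faces (`pullback_pullbackPrime_comm`). It is proved by dévissage and the snake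
lemma for Euler characteristics of multiplication maps. Pull-back along H_v involves no
multiplicities, since H_v is an automorphism followed by a projection with fibre a line. -/

noncomputable section

set_option linter.unusedSectionVars false

namespace ModulusCycles

open Cardinal Algebra

/-! ### Transcendence degrees of finitely generated domains -/

/-- The transcendence degree as a natural number. -/
def tdeg (R D : Type v) [CommRing R] [CommRing D] [Algebra R D] : ℕ :=
  Cardinal.toNat (Algebra.trdeg R D)

section tdeg

variable {R D E : Type v} [CommRing R] [IsDomain R] [CommRing D] [Algebra R D] [CommRing E]
  [Algebra R E]

/-- `Cardinal.toNat` sends infinite cardinals to `0` and is monotone only below `ℵ₀`; this is why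
finite type is assumed here and in similar places. -/
lemma tdeg_le_of_injective [Algebra.FiniteType R E] (f : D →ₐ[R] E) (hf : Function.Injective f) :
    tdeg R D ≤ tdeg R E :=
  Cardinal.toNat_le_toNat (trdeg_le_of_injective f hf)
    trdeg_lt_aleph0_of_finiteType

lemma tdeg_congr (e : D ≃ₐ[R] E) : tdeg R D = tdeg R E := by
  rw [tdeg, tdeg, e.trdeg_eq]

lemma tdeg_le_card [IsDomain D] (s : Set D) (hs : s.Finite)
    [Algebra.IsAlgebraic (Algebra.adjoin R s) D] : tdeg R D ≤ s.ncard := by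
  have h := Algebra.IsAlgebraic.trdeg_le_cardinalMk R s
  have h2 := Cardinal.toNat_le_toNat h (by rw [Cardinal.lt_aleph0_iff_set_finite]; exact hs)
  rwa [Set.cast_ncard hs |>.symm, Cardinal.toNat_natCast] at h2

lemma tdeg_tower [IsDomain E] [Algebra D E] [IsScalarTower R D E] [FaithfulSMul R D]
    [FaithfulSMul D E] (h : Algebra.trdeg R E < ℵ₀) : tdeg R D + tdeg D E = tdeg R E := by
  have h1 := trdeg_add_eq R D (A := E)
  have h2 : Algebra.trdeg R D < ℵ₀ := lt_of_le_of_lt (by rw [← h1]; exact self_le_add_right _ _) h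
  have h3 : Algebra.trdeg D E < ℵ₀ := lt_of_le_of_lt (by rw [← h1]; exact self_le_add_left _ _) h
  rw [tdeg, tdeg, tdeg, ← h1, Cardinal.toNat_add h2 h3]

lemma tdeg_mvPolynomial [Algebra.FiniteType R D] [IsDomain D] [FaithfulSMul R D] (σ : Type)
    [Fintype σ] : tdeg R (MvPolynomial σ D) = tdeg R D + Fintype.card σ := by
  have hf : Algebra.FiniteType R (MvPolynomial σ D) := .trans (S := D) inferInstance inferInstance
  rw [← tdeg_tower (R := R) (D := D) (E := MvPolynomial σ D) trdeg_lt_aleph0_of_finiteType]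
  congr 1
  simp [tdeg]

lemma tdeg_polynomial [Algebra.FiniteType R D] [IsDomain D] [FaithfulSMul R D] :
    tdeg R (Polynomial D) = tdeg R D + 1 := by
  have hf : Algebra.FiniteType R (Polynomial D) := .trans (S := D) inferInstance inferInstance
  rw [← tdeg_tower (R := R) (D := D) (E := Polynomial D) trdeg_lt_aleph0_of_finiteType]
  congr 1
  simp [tdeg]

lemma tdeg_eq_of_isAlgebraic [IsDomain E] [Algebra D E] [IsScalarTower R D E] [FaithfulSMul R D]
    [FaithfulSMul D E] [Algebra.IsAlgebraic D E] : tdeg R D = tdeg R E := by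
  have h1 := trdeg_add_eq R D (A := E)
  have := (FaithfulSMul.algebraMap_injective D E).isDomain
  rw [trdeg_eq_zero (R := D), add_zero] at h1
  rw [tdeg, tdeg, h1]

/-- A transcendence basis of `D ⧸ q` lifts to an independent family in `D`. If the degrees agreed,
`D` would be algebraic over the polynomial ring on the lifts, and a nonzero element of `q` would
force `q` to meet that ring nontrivially; but a polynomial in the lifts that lies in `q` is a
relation in `D ⧸ q`, hence zero. -/
lemma tdeg_quotient_lt [IsDomain D] [Algebra.FiniteType R D] (q : Ideal D) [q.IsPrime]
    (hq : Function.Injective (algebraMap R (D ⧸ q))) (hq0 : q ≠ ⊥) :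
    tdeg R (D ⧸ q) < tdeg R D := by
  have hD : Function.Injective (algebraMap R D) := by
    have : (algebraMap R (D ⧸ q)) = (Ideal.Quotient.mk q).comp (algebraMap R D) := rfl
    rw [this] at hq
    exact Function.Injective.of_comp hq
  have : FaithfulSMul R (D ⧸ q) := (faithfulSMul_iff_algebraMap_injective _ _).2 hq
  have : FaithfulSMul R D := (faithfulSMul_iff_algebraMap_injective _ _).2 hD
  obtain ⟨s, hs⟩ := exists_isTranscendenceBasis R (D ⧸ q)
  choose l hl using fun x : s => Ideal.Quotient.mk_surjective (I := q) x.1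
  have hind : AlgebraicIndependent R l := by
    have : AlgebraicIndependent R (Ideal.Quotient.mkₐ R q ∘ l) := by
      convert hs.1 using 1
      ext x
      exact hl x
    exact AlgebraicIndependent.of_comp _ this
  by_contra hlt
  have hle : Algebra.trdeg R D ≤ #s := by
    rw [hs.cardinalMk_eq_trdeg]
    rwa [tdeg, tdeg, Cardinal.toNat_lt_iff_lt_of_lt_aleph0 trdeg_lt_aleph0_of_finiteType
      trdeg_lt_aleph0_of_finiteType, not_lt] at hlt
  have hb := hind.isTranscendenceBasis_of_trdeg_le trdeg_lt_aleph0_of_finiteType hle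
  have halg := hb.isAlgebraic
  obtain ⟨b, hbq, hb0⟩ := Submodule.exists_mem_ne_zero_of_ne_bot hq0
  apply Ideal.comap_ne_bot_of_algebraic_mem hb0 hbq (halg.isAlgebraic b)
  rw [eq_bot_iff]
  rintro ⟨x, hx⟩ hxq
  rw [Algebra.adjoin_range_eq_range_aeval] at hx
  obtain ⟨P, rfl⟩ := hx
  have : MvPolynomial.aeval (fun x : s => (x : D ⧸ q)) P = 0 := by
    have h1 : (Ideal.Quotient.mkₐ R q) (MvPolynomial.aeval l P) = 0 :=
      Ideal.Quotient.eq_zero_iff_mem.2 hxq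
    rw [MvPolynomial.comp_aeval_apply] at h1
    rw [← h1]
    congr 2
    ext x
    exact (hl x).symm
  have hP : P = 0 := hs.1 (by simpa using this)
  subst hP
  exact Subtype.ext (map_zero _)

end tdeg

/-! ### The dimension formula -/

section dimension

variable {R : Type v} [CommRing R] [IsDomain R]

/-- The dimension of a prime `P` of an `R`-algebra `A`: the transcendence degree of `A ⧸ P`. -/
def pdim (R : Type v) {A : Type v} [CommRing R] [CommRing A] [Algebra R A] (P : Ideal A) : ℕ :=
  tdeg R (A ⧸ P)

/-- The condition on the right recurs below: it says that the point lies over the generic point of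
Spec R, where transcendence degree over R is the correct notion of dimension. -/
lemma injective_algebraMap_quotient_iff {A : Type v} [CommRing A] [Algebra R A] (P : Ideal A) :
    Function.Injective (algebraMap R (A ⧸ P)) ↔ P.comap (algebraMap R A) = ⊥ := by
  rw [show (algebraMap R (A ⧸ P)) = (Ideal.Quotient.mk P).comp (algebraMap R A) from rfl,
    RingHom.injective_iff_ker_eq_bot, ← RingHom.comap_ker, Ideal.mk_ker]

lemma comap_eq_bot_of_le {A : Type v} [CommRing A] [Algebra R A] {P Q : Ideal A} (h : P ≤ Q)
    (hQ : Q.comap (algebraMap R A) = ⊥) : P.comap (algebraMap R A) = ⊥ :=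
  eq_bot_iff.2 (hQ ▸ Ideal.comap_mono h)

lemma pdim_map_mk {A : Type v} [CommRing A] [Algebra R A] {P Q : Ideal A} (h : P ≤ Q) :
    pdim R (Q.map (Ideal.Quotient.mk P)) = pdim R Q :=
  tdeg_congr (DoubleQuot.quotQuotEquivQuotOfLEₐ R h)

lemma pdim_lt {A : Type v} [CommRing A] [Algebra R A] [Algebra.FiniteType R A] {P Q : Ideal A}
    [P.IsPrime] [Q.IsPrime] (h : P < Q) (hQ : Q.comap (algebraMap R A) = ⊥) :
    pdim R Q < pdim R P := by
  rw [← pdim_map_mk h.le]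
  have : (Q.map (Ideal.Quotient.mk P)).IsPrime :=
    Ideal.map_isPrime_of_surjective Ideal.Quotient.mk_surjective (by simpa using h.le)
  apply tdeg_quotient_lt
  · rw [injective_algebraMap_quotient_iff,
      show (algebraMap R (A ⧸ P)) = (Ideal.Quotient.mk P).comp (algebraMap R A) from rfl,
      ← Ideal.comap_comap, Ideal.comap_map_mk h.le, hQ]
  · rw [ne_eq, Ideal.map_eq_bot_iff_le_ker, Ideal.mk_ker]
    exact fun h' => h.not_ge h'

/-- Along a chain of primes that ends in `Q` the dimension drops at every step, and it starts at no
more than that of `A`. -/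
lemma height_add_pdim_le {A : Type v} [CommRing A] [Algebra R A] [Algebra.FiniteType R A]
    [IsDomain A] (Q : Ideal A) [Q.IsPrime] (hQ : Q.comap (algebraMap R A) = ⊥) :
    Q.height + pdim R Q ≤ tdeg R A := by
  have key : ∀ (l : LTSeries (PrimeSpectrum A)), l.last = ⟨Q, inferInstance⟩ →
      l.length + pdim R Q ≤ tdeg R A := by
    intro l hl
    have hc : ∀ i, (l i).asIdeal.comap (algebraMap R A) = ⊥ := fun i =>
      comap_eq_bot_of_le (Q := Q) (by
        have := l.monotone (Fin.le_last i)
        change l i ≤ l.last at this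
        rw [hl] at this
        exact this) hQ
    have : ∀ i : ℕ, ∀ hi : i < l.length + 1, i + pdim R (l ⟨i, hi⟩).asIdeal ≤ tdeg R A := by
      intro i
      induction i with
      | zero =>
        intro hi
        rw [zero_add]
        exact Cardinal.toNat_le_toNat (trdeg_le_of_surjective (Ideal.Quotient.mkₐ R _)
          Ideal.Quotient.mk_surjective) trdeg_lt_aleph0_of_finiteType
      | succ i ih =>
        intro hi
        have h1 := ih (by omega)
        have h2 := pdim_lt (R := R) (P := (l ⟨i, by omega⟩).asIdeal) (Q := (l ⟨i + 1, hi⟩).asIdeal)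
          (l.strictMono (Fin.mk_lt_mk.2 (Nat.lt_succ_self i))) (hc _)
        omega
    have h3 := this l.length (by omega)
    change _ + pdim R l.last.asIdeal ≤ _ at h3
    rwa [hl] at h3
  -- The one-element chain gives `pdim R Q ≤ tdeg R A`, so the truncated subtraction below is exact.
  have h0 := key (RelSeries.singleton _ ⟨Q, inferInstance⟩) rfl
  have : Q.height ≤ ((tdeg R A - pdim R Q : ℕ) : ℕ∞) := by
    rw [show Q = (⟨Q, inferInstance⟩ : PrimeSpectrum A).asIdeal from rfl,
      PrimeSpectrum.height_eq_orderHeight]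
    apply Order.height_le
    intro l hl
    have := key l hl
    exact_mod_cast (by omega : l.length ≤ tdeg R A - pdim R Q)
  calc Q.height + pdim R Q ≤ ((tdeg R A - pdim R Q : ℕ) : ℕ∞) + pdim R Q := by gcongr
    _ = _ := by
      norm_cast
      have : pdim R Q ≤ tdeg R A := by omega
      omega

/-- By going-down for the flat map B → B[X], the height of `Q` is that of its contraction `q` plus
the height of `Q` modulo `qB[X]`. Either `Q = qB[X]` and the dimension rises by one, or the second
height is at least one and the dimension does not drop. -/
lemma height_add_pdim_polynomial {B : Type v} [CommRing B] [Algebra R B] [Algebra.FiniteType R B]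
    [IsNoetherianRing B] (Q : Ideal (Polynomial B)) [Q.IsPrime]
    (hQ : Q.comap (algebraMap R (Polynomial B)) = ⊥) :
    (Q.comap (algebraMap B (Polynomial B))).height +
      ((pdim R (Q.comap (algebraMap B (Polynomial B))) + 1 : ℕ) : ℕ∞) ≤ Q.height + pdim R Q := by
  have hf : Algebra.FiniteType R (Polynomial B) := .trans (S := B) inferInstance inferInstance
  set q := Q.comap (algebraMap B (Polynomial B)) with hq
  have hql : Q.LiesOver q := ⟨rfl⟩
  have hqc : q.comap (algebraMap R B) = ⊥ := by
    rw [hq, Ideal.comap_comap, ← IsScalarTower.algebraMap_eq, hQ]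
  have hh := Ideal.height_eq_height_add_of_liesOver_of_hasGoingDown q Q
  have hle : q.map (algebraMap B (Polynomial B)) ≤ Q := Ideal.map_comap_le
  have hinj : FaithfulSMul R (B ⧸ q) := (faithfulSMul_iff_algebraMap_injective _ _).2
    ((injective_algebraMap_quotient_iff _).2 hqc)
  have hprime : (q.map (algebraMap B (Polynomial B))).IsPrime :=
    Ideal.isPrime_map_C_of_isPrime
  rw [hh]
  by_cases hQq : q.map (algebraMap B (Polynomial B)) = Q
  · have : pdim R Q = pdim R q + 1 := by
      unfold pdim
      rw [← tdeg_polynomial]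
      symm
      rw [← hQq]
      let e := Ideal.polynomialQuotientEquivQuotientPolynomial q
      exact tdeg_congr (AlgEquiv.ofRingEquiv (f := e) (fun r => by
        have := Ideal.polynomialQuotientEquivQuotientPolynomial_map_mk q
          (Polynomial.C (algebraMap R B r))
        rw [Polynomial.map_C] at this
        exact this))
    rw [this]
    gcongr
    exact le_self_add
  · have h1 : 1 ≤ (Q.map (Ideal.Quotient.mk (q.map (algebraMap B (Polynomial B))))).height := by
      have : (Q.map (Ideal.Quotient.mk (q.map (algebraMap B (Polynomial B))))).IsPrime :=
        Ideal.map_isPrime_of_surjective Ideal.Quotient.mk_surjective (by simpa using hle)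
      rw [Order.one_le_iff_ne_zero, ne_eq, Ideal.height_eq_zero_iff_eq_bot,
        Ideal.map_eq_bot_iff_le_ker, Ideal.mk_ker]
      exact fun h => hQq (le_antisymm hle h)
    have h2 : pdim R q ≤ pdim R Q := by
      refine tdeg_le_of_injective (Ideal.quotientMapₐ Q (IsScalarTower.toAlgHom R B _) le_rfl) ?_
      exact Ideal.quotientMap_injective
    calc q.height + ((pdim R q + 1 : ℕ) : ℕ∞) = q.height + 1 + pdim R q := by push_cast; ring
      _ ≤ _ := by gcongr

lemma le_height_add_pdim_mvPolynomial [IsNoetherianRing R] (s : ℕ) :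
    ∀ (Q : Ideal (MvPolynomial (Fin s) R)) [Q.IsPrime],
      Q.comap (algebraMap R (MvPolynomial (Fin s) R)) = ⊥ → (s : ℕ∞) ≤ Q.height + pdim R Q := by
  induction s with
  | zero => intro Q _ _; simp
  | succ s ih =>
    intro Q _ hQ
    let e := (MvPolynomial.finSuccEquiv R s).symm
    let Q' : Ideal (Polynomial (MvPolynomial (Fin s) R)) := Q.comap e.toRingEquiv
    have hQ'p : Q'.IsPrime := Ideal.comap_isPrime _ _
    have hc : Q'.comap (algebraMap R (Polynomial (MvPolynomial (Fin s) R))) = ⊥ := by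
      rw [← hQ]
      ext x
      change e (algebraMap R _ x) ∈ Q ↔ algebraMap R _ x ∈ Q
      rw [e.commutes]
    have h1 := height_add_pdim_polynomial (R := R) Q' hc
    have h2 := ih (Q'.comap (algebraMap _ _)) (by
      rw [Ideal.comap_comap, ← IsScalarTower.algebraMap_eq, hc])
    have h3 : Q'.height = Q.height := RingEquiv.height_comap _ _
    have h4 : pdim R Q' = pdim R Q := by
      refine tdeg_congr (Ideal.quotientEquivAlg Q' Q e ?_)
      exact (Ideal.map_comap_of_surjective _ e.surjective Q).symm
    rw [h3, h4] at h1
    refine le_trans ?_ h1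
    push_cast
    rw [← add_assoc]
    gcongr

end dimension

/-! ### The dimension formula for fields and in general; chains of primes. -/

section dimension

variable {R : Type v} [CommRing R] [IsDomain R]

/-- Noether normalization: `B` is integral over a polynomial ring, which is normal, so going-down
holds and heights can only grow from the polynomial ring to `B`, where the inequality is already
known. -/
lemma tdeg_le_height_add_pdim_of_field {K : Type v} [Field K] {B : Type v} [CommRing B]
    [IsDomain B] [Algebra K B] [Algebra.FiniteType K B] (q : Ideal B) [q.IsPrime] :
    (tdeg K B : ℕ∞) ≤ q.height + pdim K q := by
  obtain ⟨s, g, hg, hint⟩ := exists_integral_inj_algHom_of_fg K B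
  algebraize [g.toRingHom]
  have hfaith : FaithfulSMul (MvPolynomial (Fin s) K) B :=
    (faithfulSMul_iff_algebraMap_injective _ _).2 hg
  have hI : Algebra.IsIntegral (MvPolynomial (Fin s) K) B := ⟨hint⟩
  have hN : IsNoetherianRing B := Algebra.FiniteType.isNoetherianRing K B
  have h1 : tdeg K (MvPolynomial (Fin s) K) = tdeg K B := tdeg_eq_of_isAlgebraic
  have h0 : tdeg K (MvPolynomial (Fin s) K) = s := by simp [tdeg]
  let q0 := q.comap (algebraMap (MvPolynomial (Fin s) K) B)
  have hl : q.LiesOver q0 := ⟨rfl⟩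
  have h2 := Ideal.height_eq_height_add_of_liesOver_of_hasGoingDown q0 q
  have h3 := le_height_add_pdim_mvPolynomial s q0 (by
    rw [eq_bot_iff]
    intro x hx
    by_contra hx0
    have : IsUnit (algebraMap K (MvPolynomial (Fin s) K) x) :=
      (IsUnit.mk0 x hx0).map _
    exact (inferInstance : q0.IsPrime).ne_top (Ideal.eq_top_of_isUnit_mem _ hx this))
  have h4 : pdim K q0 ≤ pdim K q :=
    tdeg_le_of_injective (Ideal.quotientMapₐ q (IsScalarTower.toAlgHom K _ B) le_rfl)
      Ideal.quotientMap_injective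
  rw [← h1, h0, h2]
  calc (s : ℕ∞) ≤ _ := h3
    _ ≤ _ := by gcongr; exact le_self_add

/-- The dimension formula for finitely generated domains. -/
lemma height_add_pdim {A : Type v} [CommRing A] [Algebra R A] [Algebra.FiniteType R A]
    [IsDomain A] (Q : Ideal A) [Q.IsPrime] (hQ : Q.comap (algebraMap R A) = ⊥) :
    Q.height + pdim R Q = tdeg R A := by
  refine le_antisymm (height_add_pdim_le Q hQ) ?_
  -- The lower bound is taken from the generic fibre `B = K ⊗ A`. No nonzero element of R lies in
  -- `Q`, so passing to `B` changes neither the height nor the transcendence degrees.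
  let K := FractionRing R
  let M := Algebra.algebraMapSubmonoid A (nonZeroDivisors R)
  have hinjA : Function.Injective (algebraMap R A) := by
    rw [RingHom.injective_iff_ker_eq_bot, eq_bot_iff]
    intro x hx
    rw [← hQ, Ideal.mem_comap, (RingHom.mem_ker).1 hx]
    exact zero_mem _
  have hfA : FaithfulSMul R A := (faithfulSMul_iff_algebraMap_injective _ _).2 hinjA
  have hfQ : FaithfulSMul R (A ⧸ Q) := (faithfulSMul_iff_algebraMap_injective _ _).2
    ((injective_algebraMap_quotient_iff _).2 hQ)
  have hdisj : Disjoint (M : Set A) Q := by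
    rw [Set.disjoint_left]
    rintro _ ⟨x, hx, rfl⟩ hxQ
    have : x ∈ Q.comap (algebraMap R A) := hxQ
    rw [hQ, Ideal.mem_bot] at this
    exact nonZeroDivisors.ne_zero hx this
  have hM : M ≤ nonZeroDivisors A := by
    rintro _ ⟨x, hx, rfl⟩
    exact mem_nonZeroDivisors_of_ne_zero ((map_ne_zero_iff _ hinjA).2 (nonZeroDivisors.ne_zero hx))
  let B := Localization M
  have hB : IsDomain B := IsLocalization.isDomain_localization hM
  have hpush : Algebra.IsPushout R K A B :=
    (Algebra.isPushout_of_isLocalization (nonZeroDivisors R) K A B).symm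
  have hft : Algebra.FiniteType K B :=
    Algebra.FiniteType.equiv inferInstance (Algebra.IsPushout.equiv R K A B)
  have hAB : FaithfulSMul A B :=
    (faithfulSMul_iff_algebraMap_injective _ _).2 (IsLocalization.injective B hM)
  have hKB : FaithfulSMul K B :=
    (faithfulSMul_iff_algebraMap_injective _ _).2 (algebraMap K B).injective
  let q := Q.map (algebraMap A B)
  have hq : q.IsPrime := IsLocalization.isPrime_of_isPrime_disjoint M B Q inferInstance hdisj
  have hqc : q.comap (algebraMap A B) = Q :=
    IsLocalization.under_map_of_isPrime_disjoint M B inferInstance hdisj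
  have hqh : q.height = Q.height := IsLocalization.height_map_of_disjoint M Q hdisj
  have hfield := tdeg_le_height_add_pdim_of_field (K := K) q
  have halgK : Algebra.IsAlgebraic R K := IsLocalization.isAlgebraic K (nonZeroDivisors R)
  have halgB : Algebra.IsAlgebraic A B := IsLocalization.isAlgebraic B M
  have e1 : Algebra.trdeg R A = Algebra.trdeg K B := by
    have h1 := trdeg_add_eq R A (A := B)
    have h2 := trdeg_add_eq R K (A := B)
    rw [trdeg_eq_zero (R := A), add_zero] at h1
    rw [trdeg_eq_zero (R := R), zero_add] at h2
    rw [h1, h2]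
  have e2 : pdim R Q = pdim K q := by
    have hKq : FaithfulSMul K (B ⧸ q) :=
      (faithfulSMul_iff_algebraMap_injective _ _).2 (algebraMap K (B ⧸ q)).injective
    let _ : Algebra (A ⧸ Q) (B ⧸ q) := (Ideal.quotientMap q (algebraMap A B) hqc.ge).toAlgebra
    have hinj : FaithfulSMul (A ⧸ Q) (B ⧸ q) := (faithfulSMul_iff_algebraMap_injective _ _).2
      (Ideal.quotientMap_injective' hqc.le)
    have hst : IsScalarTower R (A ⧸ Q) (B ⧸ q) := .of_algebraMap_eq' rfl
    have halg : Algebra.IsAlgebraic (A ⧸ Q) (B ⧸ q) := ⟨fun x => by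
      obtain ⟨b, rfl⟩ := Ideal.Quotient.mk_surjective x
      obtain ⟨⟨a, m⟩, rfl⟩ := IsLocalization.mk'_surjective M b
      have hm : Ideal.Quotient.mk Q (m : A) ≠ 0 := fun h =>
        Set.disjoint_left.1 hdisj m.2 (Ideal.Quotient.eq_zero_iff_mem.1 h)
      refine ⟨Polynomial.C (Ideal.Quotient.mk Q (m : A)) * Polynomial.X -
        Polynomial.C (Ideal.Quotient.mk Q a), fun h => hm ?_, ?_⟩
      · have := congrArg (fun p => Polynomial.coeff p 1) h
        simpa [Polynomial.coeff_C] using this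
      · simp only [map_sub, map_mul, Polynomial.aeval_C, Polynomial.aeval_X]
        change Ideal.Quotient.mk q (algebraMap A B m) * _ - Ideal.Quotient.mk q (algebraMap A B a) = 0
        rw [← map_mul, IsLocalization.mk'_spec', sub_self]⟩
    have h1 := trdeg_add_eq R (A ⧸ Q) (A := B ⧸ q)
    have h2 := trdeg_add_eq R K (A := B ⧸ q)
    rw [trdeg_eq_zero (R := A ⧸ Q), add_zero] at h1
    rw [trdeg_eq_zero (R := R), zero_add] at h2
    rw [pdim, pdim, tdeg, tdeg, h1, h2]
  rw [← hqh, e2]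
  refine le_trans (le_of_eq ?_) hfield
  exact congrArg (fun c => ((Cardinal.toNat c : ℕ) : ℕ∞)) e1

lemma height_map_mk_add_pdim {A : Type v} [CommRing A] [Algebra R A] [Algebra.FiniteType R A]
    {P Q : Ideal A} [P.IsPrime] [Q.IsPrime] (h : P ≤ Q) (hQ : Q.comap (algebraMap R A) = ⊥) :
    (Q.map (Ideal.Quotient.mk P)).height + pdim R Q = pdim R P := by
  have : (Q.map (Ideal.Quotient.mk P)).IsPrime :=
    Ideal.map_isPrime_of_surjective Ideal.Quotient.mk_surjective (by simpa using h)
  rw [← pdim_map_mk h, height_add_pdim, pdim]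
  rw [show (algebraMap R (A ⧸ P)) = (Ideal.Quotient.mk P).comp (algebraMap R A) from rfl,
      ← Ideal.comap_comap, Ideal.comap_map_mk h, hQ]

lemma pdim_le_of_le {A : Type v} [CommRing A] [Algebra R A] [Algebra.FiniteType R A]
    {P Q : Ideal A} (h : P ≤ Q) : pdim R Q ≤ pdim R P :=
  Cardinal.toNat_le_toNat (trdeg_le_of_surjective (Ideal.Quotient.factorₐ R h)
    (Ideal.Quotient.factor_surjective h)) trdeg_lt_aleph0_of_finiteType

lemma eq_of_le_of_pdim_le {A : Type v} [CommRing A] [Algebra R A] [Algebra.FiniteType R A]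
    {P Q : Ideal A} [P.IsPrime] [Q.IsPrime] (h : P ≤ Q) (hQ : Q.comap (algebraMap R A) = ⊥)
    (hd : pdim R P ≤ pdim R Q) : P = Q := by
  by_contra hne
  exact (pdim_lt (R := R) (lt_of_le_of_ne h hne) hQ).not_ge hd

/-- A principal divisor on an integral scheme of finite type has pure codimension one. -/
lemma pdim_add_one_of_mem_minimalPrimes {A : Type v} [CommRing A] [IsNoetherianRing A]
    [Algebra R A] [Algebra.FiniteType R A] {P Q : Ideal A} [P.IsPrime] {x : A} (hx : x ∉ P)
    (hQ : Q ∈ (P ⊔ Ideal.span {x}).minimalPrimes) (hQ0 : Q.comap (algebraMap R A) = ⊥) :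
    pdim R Q + 1 = pdim R P := by
  have hQp : Q.IsPrime := Ideal.IsMinimalPrime.isPrime hQ
  have hPQ : P ≤ Q := le_sup_left.trans hQ.1.2
  have hlt : P < Q := lt_of_le_of_ne hPQ fun h => hx (by
    rw [h]; exact hQ.1.2 (Ideal.mem_sup_right (Ideal.mem_span_singleton_self x)))
  have h1 := Ideal.map_height_le_one_of_mem_minimalPrimes hQ
  have h2 := height_map_mk_add_pdim (R := R) hPQ hQ0
  have h3 := pdim_lt (R := R) hlt hQ0
  have h4 : (pdim R P : ℕ∞) ≤ 1 + pdim R Q := by rw [← h2]; gcongr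
  have : pdim R P ≤ 1 + pdim R Q := by exact_mod_cast h4
  omega

/-- Between two primes there is a chain of primes of maximal length all of whose members but the
last avoid a given function that does not vanish at the first one. -/
lemma exists_chain_avoiding {A : Type v} [CommRing A] [IsNoetherianRing A]
    [Algebra R A] [Algebra.FiniteType R A] (g : A) (m : ℕ) :
    ∀ (P Q : PrimeSpectrum A), P ≤ Q → Q.asIdeal.comap (algebraMap R A) = ⊥ → g ∉ P.asIdeal →
      pdim R P.asIdeal = pdim R Q.asIdeal + m →
      ∃ f : ℕ → PrimeSpectrum A, f 0 = P ∧ f m = Q ∧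
        ∀ i < m, f i < f (i + 1) ∧ g ∉ (f i).asIdeal := by
  induction m with
  | zero =>
    intro P Q hPQ hQ hg hd
    have : P = Q := PrimeSpectrum.ext (eq_of_le_of_pdim_le (R := R) hPQ hQ (by omega))
    exact ⟨fun _ => P, rfl, this, by simp⟩
  | succ m ih =>
    intro P Q hPQ hQ hg hd
    have hlt : P < Q := lt_of_le_of_ne hPQ fun h => by subst h; omega
    -- In relative dimension one the chain is just `P < Q`, and the last member is allowed to
    -- contain `g`.
    obtain rfl | hm := Nat.eq_zero_or_pos m
    · refine ⟨fun i => if i = 0 then P else Q, rfl, rfl, fun i hi => ?_⟩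
      obtain rfl : i = 0 := by omega
      exact ⟨hlt, hg⟩
    -- Prime avoidance: `Q` has codimension at least two in V(P), whereas the components of V(P, g)
    -- have codimension one, so `Q` is contained neither in `P` nor in any of those components'
    -- primes.
    obtain ⟨x, hxQ, hx⟩ : ∃ x ∈ Q.asIdeal, x ∉ P.asIdeal ∧
        ∀ P₀ ∈ (P.asIdeal ⊔ Ideal.span {g}).minimalPrimes, P₀ ≤ Q.asIdeal → x ∉ P₀ := by
      have hfin := Ideal.finite_minimalPrimes_of_isNoetherianRing A (P.asIdeal ⊔ Ideal.span {g})
      let s : Set (Ideal A) := insert P.asIdeal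
        {P₀ ∈ (P.asIdeal ⊔ Ideal.span {g}).minimalPrimes | P₀ ≤ Q.asIdeal}
      have hs : s.Finite := (hfin.subset (Set.sep_subset _ _)).insert _
      by_contra! hcon
      have hsub : (Q.asIdeal : Set A) ⊆ ⋃ I ∈ s, (I : Set A) := by
        intro x hx
        by_cases hxP : x ∈ P.asIdeal
        · exact Set.mem_biUnion (Set.mem_insert _ _) hxP
        · obtain ⟨P₀, h1, h2, h3⟩ := hcon x hx hxP
          exact Set.mem_biUnion (Set.mem_insert_of_mem _ ⟨h1, h2⟩) h3
      rw [Ideal.subset_union_prime_finite hs ⊥ ⊥ (by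
        rintro I (rfl | hI) - -
        · exact P.2
        · exact Ideal.IsMinimalPrime.isPrime hI.1)] at hsub
      obtain ⟨I, hI, hQI⟩ := hsub
      rcases hI with rfl | hI
      · exact hlt.not_ge hQI
      · obtain rfl : I = Q.asIdeal := le_antisymm hI.2 hQI
        have := pdim_add_one_of_mem_minimalPrimes (R := R) hg hI.1 hQ
        omega
    obtain ⟨P', hP', hP'Q⟩ := Ideal.exists_minimalPrimes_le (I := P.asIdeal ⊔ Ideal.span {x})
      (J := Q.asIdeal) (sup_le hPQ ((Ideal.span_singleton_le_iff_mem _).2 hxQ))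
    have hP'p : P'.IsPrime := Ideal.IsMinimalPrime.isPrime hP'
    have hP'0 := comap_eq_bot_of_le hP'Q hQ
    have hd' := pdim_add_one_of_mem_minimalPrimes (R := R) hx.1 hP' hP'0
    have hPP' : P.asIdeal ≤ P' := le_sup_left.trans hP'.1.2
    have hxP' : x ∈ P' := hP'.1.2 (Ideal.mem_sup_right (Ideal.mem_span_singleton_self x))
    -- Otherwise `P'` would contain a prime `P₀` of the same dimension minimal over `(P, g)`, hence
    -- equal it; but `x` lies in `P'` and not in `P₀`.
    have hgP' : g ∉ P' := by
      intro hgP'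
      obtain ⟨P₀, hP₀, hP₀P'⟩ := Ideal.exists_minimalPrimes_le (I := P.asIdeal ⊔ Ideal.span {g})
        (J := P') (sup_le hPP' ((Ideal.span_singleton_le_iff_mem _).2 hgP'))
      have hP₀p : P₀.IsPrime := Ideal.IsMinimalPrime.isPrime hP₀
      have := pdim_add_one_of_mem_minimalPrimes (R := R) hg hP₀ (comap_eq_bot_of_le hP₀P' hP'0)
      have := eq_of_le_of_pdim_le (R := R) hP₀P' hP'0 (by omega)
      exact hx.2 P₀ hP₀ (hP₀P'.trans hP'Q) (this ▸ hxP')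
    obtain ⟨f, hf0, hfm, hf⟩ := ih ⟨P', hP'p⟩ Q hP'Q hQ hgP' (by
      change pdim R P' = _
      omega)
    refine ⟨fun i => Nat.casesOn i P f, rfl, hfm, fun i hi => ?_⟩
    cases i with
    | zero =>
      refine ⟨?_, hg⟩
      change P < f 0
      rw [hf0]
      exact lt_of_le_of_ne hPP' fun h => hx.1 (by rw [h]; exact hxP')
    | succ i => exact hf i (by omega)

end dimension

open TensorProduct

/-! ### Lengths at a prime -/

section locLength

variable {A : Type v} [CommRing A]

/-- The length of the localization of the module `N` at the prime `P`. -/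
def locLength (P : PrimeSpectrum A) (N : Type v) [AddCommGroup N] [Module A N] : ℕ∞ :=
  Module.length (Localization.AtPrime P.asIdeal) (Localization.AtPrime P.asIdeal ⊗[A] N)

variable {N N₁ N₂ N₃ : Type v} [AddCommGroup N] [Module A N] [AddCommGroup N₁] [Module A N₁]
  [AddCommGroup N₂] [Module A N₂] [AddCommGroup N₃] [Module A N₃]

lemma locLength_congr (P : PrimeSpectrum A) (e : N₁ ≃ₗ[A] N₂) :
    locLength P N₁ = locLength P N₂ :=
  (e.baseChange A (Localization.AtPrime P.asIdeal) N₁ N₂).length_eq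

lemma locLength_exact (P : PrimeSpectrum A) (f : N₁ →ₗ[A] N₂) (g : N₂ →ₗ[A] N₃)
    (hf : Function.Injective f) (hg : Function.Surjective g) (h : Function.Exact f g) :
    locLength P N₂ = locLength P N₁ + locLength P N₃ := by
  refine Module.length_eq_add_of_exact
    (AlgebraTensorModule.lTensor (Localization.AtPrime P.asIdeal) (Localization.AtPrime P.asIdeal) f)
    (AlgebraTensorModule.lTensor (Localization.AtPrime P.asIdeal) (Localization.AtPrime P.asIdeal) g)
    ?_ ?_ ?_
  · exact Module.Flat.lTensor_preserves_injective_linearMap f hf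
  · exact LinearMap.lTensor_surjective _ hg
  · exact lTensor_exact _ h hg

lemma locLength_eq_zero_of_subsingleton (P : PrimeSpectrum A) [Subsingleton N] :
    locLength P N = 0 := by
  rw [locLength, Module.length_eq_zero_iff]
  infer_instance

lemma locLength_quotient (P : PrimeSpectrum A) (I : Ideal A) :
    locLength P (A ⧸ I) = Module.length (Localization.AtPrime P.asIdeal)
      (Localization.AtPrime P.asIdeal ⧸ I.map (algebraMap A (Localization.AtPrime P.asIdeal))) :=
  (I.qoutMapEquivTensorQout (Localization.AtPrime P.asIdeal)).length_eq.symm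

lemma locLength_quotient_self (P : PrimeSpectrum A) : locLength P (A ⧸ P.asIdeal) = 1 := by
  rw [locLength_quotient, Localization.AtPrime.map_eq_maximalIdeal, Module.length_eq_one_iff,
    isSimpleModule_iff_isCoatom]
  exact (IsLocalRing.maximalIdeal.isMaximal _).out

lemma locLength_quotient_eq_zero (P : PrimeSpectrum A) {I : Ideal A} (h : ¬ I ≤ P.asIdeal) :
    locLength P (A ⧸ I) = 0 := by
  obtain ⟨x, hx, hxP⟩ := SetLike.not_le_iff_exists.1 h
  rw [locLength_quotient, Module.length_eq_zero_iff, Ideal.Quotient.subsingleton_iff]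
  exact Ideal.eq_top_of_isUnit_mem _ (Ideal.mem_map_of_mem _ hx)
    (IsLocalization.map_units _ (⟨x, hxP⟩ : P.asIdeal.primeCompl))

open Classical in
lemma locLength_quotient_prime (P Q : PrimeSpectrum A) (h : P = Q ∨ ¬ Q ≤ P) :
    locLength P (A ⧸ Q.asIdeal) = if P = Q then 1 else 0 := by
  split_ifs with hPQ
  · rw [hPQ, locLength_quotient_self]
  · exact locLength_quotient_eq_zero P (h.resolve_left hPQ)

open Classical in
-- Dévissage to modules `A ⧸ Q` with `I ≤ Q`. As `P` is minimal over `I`, such a quotient has length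
-- one at `P` if `Q = P` and length zero otherwise.
lemma locLength_ne_top [IsNoetherianRing A] (P : PrimeSpectrum A) {I : Ideal A}
    (hP : P.asIdeal ∈ I.minimalPrimes) (N : Type v) [AddCommGroup N] [Module A N]
    [hN : Module.Finite A N] (hI : I ≤ Module.annihilator A N) : locLength P N ≠ ⊤ := by
  induction hN using IsNoetherianRing.induction_on_isQuotientEquivQuotientPrime A with
  | subsingleton N => simp [locLength_eq_zero_of_subsingleton]
  | quotient N Q e =>
    rw [e.annihilator_eq, Ideal.annihilator_quotient] at hI
    rw [locLength_congr P e, locLength_quotient_prime]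
    · split_ifs <;> simp
    · by_cases h : Q ≤ P
      · exact Or.inl (PrimeSpectrum.ext (le_antisymm (hP.2 ⟨Q.2, hI⟩ h) h))
      · exact Or.inr h
  | exact N₁ N₂ N₃ f g hf hg h h₁ h₃ =>
    rw [locLength_exact P f g hf hg h]
    simp only [ne_eq, ENat.add_eq_top, not_or]
    exact ⟨h₁ (hI.trans (f.annihilator_le_of_injective hf)),
      h₃ (hI.trans (g.annihilator_le_of_surjective hg))⟩

lemma locLength_eq_ker_add_range (P : PrimeSpectrum A) (f : N₁ →ₗ[A] N₂) :
    locLength P N₁ = locLength P (LinearMap.ker f) + locLength P (LinearMap.range f) :=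
  locLength_exact P (LinearMap.ker f).subtype f.rangeRestrict (Submodule.injective_subtype _)
    f.surjective_rangeRestrict (by
      rw [LinearMap.exact_iff, LinearMap.ker_rangeRestrict, Submodule.range_subtype])

lemma locLength_eq_range_add_range (P : PrimeSpectrum A) (f : N₁ →ₗ[A] N₂) (g : N₂ →ₗ[A] N₃)
    (h : Function.Exact f g) :
    locLength P N₂ = locLength P (LinearMap.range f) + locLength P (LinearMap.range g) := by
  rw [locLength_eq_ker_add_range P g, LinearMap.exact_iff.1 h]

end locLength

/-! ### Euler characteristics of multiplication maps -/

section mulChar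

variable {A : Type v} [CommRing A]

/-- The difference of the lengths at `Q` of the cokernel and of the kernel of the multiplication
by `b` on `N`. -/
def mulChar (Q : PrimeSpectrum A) (b : A) (N : Type v) [AddCommGroup N] [Module A N] : ℤ :=
  (locLength Q (N ⧸ LinearMap.range (LinearMap.lsmul A N b))).toNat -
    (locLength Q (LinearMap.ker (LinearMap.lsmul A N b))).toNat

variable [IsNoetherianRing A] {N₁ N₂ N₃ : Type v} [AddCommGroup N₁] [Module A N₁]
  [AddCommGroup N₂] [Module A N₂] [AddCommGroup N₃] [Module A N₃]

/-- The kernel is killed by `I` and by `b`, and `Q` is minimal over the ideal they generate. The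
same reason applies to the cokernel. -/
lemma locLength_ker_ne_top {Q : PrimeSpectrum A} {I : Ideal A} {b : A}
    (hQ : Q.asIdeal ∈ (I ⊔ Ideal.span {b}).minimalPrimes) (N : Type v) [AddCommGroup N] [Module A N]
    [Module.Finite A N] (hI : I ≤ Module.annihilator A N) :
    locLength Q (LinearMap.ker (LinearMap.lsmul A N b)) ≠ ⊤ := by
  refine locLength_ne_top Q hQ _ (sup_le (hI.trans
    (LinearMap.annihilator_le_of_injective _ (Submodule.injective_subtype _))) ?_)
  rw [Ideal.span_singleton_le_iff_mem, Module.mem_annihilator]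
  rintro ⟨x, hx⟩
  exact Subtype.ext hx

lemma locLength_coker_ne_top {Q : PrimeSpectrum A} {I : Ideal A} {b : A}
    (hQ : Q.asIdeal ∈ (I ⊔ Ideal.span {b}).minimalPrimes) (N : Type v) [AddCommGroup N] [Module A N]
    [Module.Finite A N] (hI : I ≤ Module.annihilator A N) :
    locLength Q (N ⧸ LinearMap.range (LinearMap.lsmul A N b)) ≠ ⊤ := by
  refine locLength_ne_top Q hQ _ (sup_le (hI.trans
    (LinearMap.annihilator_le_of_surjective _ (Submodule.mkQ_surjective _))) ?_)
  rw [Ideal.span_singleton_le_iff_mem, Module.mem_annihilator]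
  intro x
  obtain ⟨x, rfl⟩ := Submodule.mkQ_surjective _ x
  rw [← map_smul, Submodule.mkQ_apply, Submodule.Quotient.mk_eq_zero]
  exact ⟨x, rfl⟩

/-- The snake lemma gives a six-term exact sequence of kernels and cokernels of multiplication by
`b`; all its lengths at `Q` are finite, so their alternating sum vanishes. -/
lemma mulChar_exact {Q : PrimeSpectrum A} {I : Ideal A} {b : A}
    (hQ : Q.asIdeal ∈ (I ⊔ Ideal.span {b}).minimalPrimes) [Module.Finite A N₁] [Module.Finite A N₂]
    [Module.Finite A N₃] (hI : I ≤ Module.annihilator A N₂) (f : N₁ →ₗ[A] N₂) (g : N₂ →ₗ[A] N₃)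
    (hf : Function.Injective f) (hg : Function.Surjective g) (h : Function.Exact f g) :
    mulChar Q b N₂ = mulChar Q b N₁ + mulChar Q b N₃ := by
  have hI₁ := hI.trans (f.annihilator_le_of_injective hf)
  have hI₃ := hI.trans (g.annihilator_le_of_surjective hg)
  let i₁ := LinearMap.lsmul A N₁ b
  let i₂ := LinearMap.lsmul A N₂ b
  let i₃ := LinearMap.lsmul A N₃ b
  have c₁ : f.comp i₁ = i₂.comp f := by ext x; simp [i₁, i₂]
  have c₂ : g.comp i₂ = i₃.comp g := by ext x; simp [i₂, i₃]
  let F₁ : LinearMap.ker i₁ →ₗ[A] LinearMap.ker i₂ := f.restrict fun x hx => by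
    rw [LinearMap.mem_ker, ← LinearMap.comp_apply, ← c₁, LinearMap.comp_apply,
      LinearMap.mem_ker.1 hx, map_zero]
  let F₂ : LinearMap.ker i₂ →ₗ[A] LinearMap.ker i₃ := g.restrict fun x hx => by
    rw [LinearMap.mem_ker, ← LinearMap.comp_apply, ← c₂, LinearMap.comp_apply,
      LinearMap.mem_ker.1 hx, map_zero]
  let G₁ : (N₁ ⧸ LinearMap.range i₁) →ₗ[A] (N₂ ⧸ LinearMap.range i₂) :=
    Submodule.mapQ _ _ f (by
      rintro _ ⟨x, rfl⟩
      exact ⟨f x, (LinearMap.congr_fun c₁ x).symm⟩)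
  let G₂ : (N₂ ⧸ LinearMap.range i₂) →ₗ[A] (N₃ ⧸ LinearMap.range i₃) :=
    Submodule.mapQ _ _ g (by
      rintro _ ⟨x, rfl⟩
      exact ⟨g x, (LinearMap.congr_fun c₂ x).symm⟩)
  let δ := SnakeLemma.δ' i₁ i₂ i₃ f g h f g h c₁ c₂ (LinearMap.ker i₃).subtype
    (LinearMap.exact_subtype_ker_map i₃) (LinearMap.range i₁).mkQ (LinearMap.exact_map_mkQ_range i₁)
      hg hf
  have hF₁ : Function.Injective F₁ := fun x y hxy => Subtype.ext (hf (congrArg Subtype.val hxy))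
  have hG₂ : Function.Surjective G₂ := fun y => by
    obtain ⟨y, rfl⟩ := Submodule.mkQ_surjective _ y
    obtain ⟨x, rfl⟩ := hg y
    exact ⟨Submodule.mkQ _ x, rfl⟩
  have e₁ : Function.Exact F₁ F₂ := by
    rintro ⟨x, hx⟩
    constructor
    · intro hx0
      obtain ⟨y, rfl⟩ := (h x).1 (congrArg Subtype.val hx0)
      refine ⟨⟨y, hf ?_⟩, rfl⟩
      rw [map_zero, ← LinearMap.comp_apply, c₁]
      exact hx
    · rintro ⟨y, hy⟩
      rw [← hy]
      exact Subtype.ext ((h _).2 ⟨_, rfl⟩)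
  have e₂ : Function.Exact F₂ δ := SnakeLemma.exact_δ'_right i₁ i₂ i₃ f g h f g h c₁ c₂
    (LinearMap.ker i₂).subtype (LinearMap.exact_subtype_ker_map i₂)
    _ _ _ _ hg hf F₂ rfl (Submodule.injective_subtype _)
  have e₃ : Function.Exact δ G₁ := SnakeLemma.exact_δ'_left i₁ i₂ i₃ f g h f g h c₁ c₂
    _ _ _ _ (LinearMap.range i₂).mkQ (LinearMap.exact_map_mkQ_range i₂) hg hf G₁ rfl
      (Submodule.mkQ_surjective _)
  have e₄ : Function.Exact G₁ G₂ := by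
    intro x
    obtain ⟨x, rfl⟩ := Submodule.mkQ_surjective _ x
    constructor
    · intro hx0
      obtain ⟨z, hz⟩ := (Submodule.Quotient.mk_eq_zero _).1 hx0
      obtain ⟨z, rfl⟩ := hg z
      have : g (x - i₂ z) = 0 := by
        rw [map_sub, ← LinearMap.comp_apply, c₂, LinearMap.comp_apply, hz, sub_self]
      obtain ⟨y, hy⟩ := (h _).1 this
      refine ⟨Submodule.mkQ _ y, ?_⟩
      change Submodule.mkQ _ (f y) = _
      rw [hy, map_sub, sub_eq_self]
      exact (Submodule.Quotient.mk_eq_zero _).2 ⟨z, rfl⟩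
    · rintro ⟨y, hy⟩
      obtain ⟨y, rfl⟩ := Submodule.mkQ_surjective _ y
      rw [← hy]
      change Submodule.mkQ _ (g (f y)) = 0
      rw [(h _).2 ⟨_, rfl⟩, map_zero]
  have k₁ := locLength_ker_ne_top hQ N₁ hI₁
  have k₂ := locLength_ker_ne_top hQ N₂ hI
  have k₃ := locLength_ker_ne_top hQ N₃ hI₃
  have q₁ := locLength_coker_ne_top hQ N₁ hI₁
  have q₂ := locLength_coker_ne_top hQ N₂ hI
  have q₃ := locLength_coker_ne_top hQ N₃ hI₃
  -- The six lengths are expressed through the lengths of the images of the successive maps of the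
  -- snake sequence, after which the identity telescopes.
  have l₁ := locLength_eq_ker_add_range Q F₁
  have l₂ := locLength_eq_range_add_range Q F₁ F₂ e₁
  have l₃ := locLength_eq_range_add_range Q F₂ δ e₂
  have l₄ := locLength_eq_range_add_range Q δ G₁ e₃
  have l₅ := locLength_eq_range_add_range Q G₁ G₂ e₄
  have l₆ : locLength Q (LinearMap.range G₂) = locLength Q (N₃ ⧸ LinearMap.range i₃) :=
    locLength_congr Q (LinearEquiv.ofTop _ (LinearMap.range_eq_top.2 hG₂))
  have hs : Subsingleton (LinearMap.ker F₁) := by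
    rw [LinearMap.ker_eq_bot.2 hF₁]; infer_instance
  rw [locLength_eq_zero_of_subsingleton (N := LinearMap.ker F₁), zero_add] at l₁
  unfold mulChar
  change ((locLength Q (N₂ ⧸ LinearMap.range i₂)).toNat : ℤ) -
    (locLength Q (LinearMap.ker i₂)).toNat = ((locLength Q (N₁ ⧸ LinearMap.range i₁)).toNat -
    (locLength Q (LinearMap.ker i₁)).toNat) + ((locLength Q (N₃ ⧸ LinearMap.range i₃)).toNat -
    (locLength Q (LinearMap.ker i₃)).toNat)
  rw [← l₁] at l₂
  rw [l₆] at l₅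
  generalize locLength Q (LinearMap.range F₂) = r₂ at *
  generalize locLength Q (LinearMap.range δ) = r₃ at *
  generalize locLength Q (LinearMap.range G₁) = r₄ at *
  change locLength Q (LinearMap.ker i₁) ≠ ⊤ at k₁
  change locLength Q (LinearMap.ker i₂) ≠ ⊤ at k₂
  change locLength Q (LinearMap.ker i₃) ≠ ⊤ at k₃
  change locLength Q (N₁ ⧸ LinearMap.range i₁) ≠ ⊤ at q₁
  change locLength Q (N₂ ⧸ LinearMap.range i₂) ≠ ⊤ at q₂
  change locLength Q (N₃ ⧸ LinearMap.range i₃) ≠ ⊤ at q₃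
  rw [l₂] at k₂ ⊢
  rw [l₃] at k₃ ⊢
  rw [l₄] at q₁ ⊢
  rw [l₅] at q₂ ⊢
  simp only [ne_eq, ENat.add_eq_top, not_or] at k₂ k₃ q₁ q₂
  rw [ENat.toNat_add k₂.1 k₂.2, ENat.toNat_add k₃.1 k₃.2, ENat.toNat_add q₁.1 q₁.2,
    ENat.toNat_add q₂.1 q₂.2]
  push_cast
  ring

/-- The finite set of minimal primes over an ideal of a Noetherian ring. -/
def minPrimes (I : Ideal A) : Finset (PrimeSpectrum A) :=
  Set.Finite.toFinset (s := {P : PrimeSpectrum A | P.asIdeal ∈ I.minimalPrimes})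
    (Set.Finite.preimage (fun _ _ _ _ h => PrimeSpectrum.ext h)
      (Ideal.finite_minimalPrimes_of_isNoetherianRing A I))

lemma mem_minPrimes {I : Ideal A} {P : PrimeSpectrum A} :
    P ∈ minPrimes I ↔ P.asIdeal ∈ I.minimalPrimes := by simp [minPrimes]

lemma exists_mem_minPrimes_le {I : Ideal A} {P : PrimeSpectrum A} (h : I ≤ P.asIdeal) :
    ∃ P₀ ∈ minPrimes I, P₀ ≤ P := by
  obtain ⟨P₀, h1, h2⟩ := Ideal.exists_minimalPrimes_le h
  exact ⟨⟨P₀, Ideal.IsMinimalPrime.isPrime h1⟩, mem_minPrimes.2 h1, h2⟩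

lemma mulChar_congr {Q : PrimeSpectrum A} {b : A} (e : N₁ ≃ₗ[A] N₂) :
    mulChar Q b N₁ = mulChar Q b N₂ := by
  unfold mulChar
  congr 3
  · refine locLength_congr Q (Submodule.Quotient.equiv _ _ e ?_)
    ext x
    simp only [Submodule.mem_map, LinearMap.mem_range, LinearMap.lsmul_apply]
    constructor
    · rintro ⟨_, ⟨y, rfl⟩, rfl⟩
      exact ⟨e y, by simp⟩
    · rintro ⟨y, rfl⟩
      exact ⟨b • e.symm y, ⟨_, rfl⟩, by simp⟩
  · refine locLength_congr Q (e.submoduleMap (LinearMap.ker (LinearMap.lsmul A N₁ b)) ≪≫ₗ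
      LinearEquiv.ofEq _ (LinearMap.ker (LinearMap.lsmul A N₂ b)) ?_)
    ext x
    simp only [Submodule.mem_map, LinearMap.mem_ker, LinearMap.lsmul_apply]
    constructor
    · rintro ⟨y, hy, rfl⟩
      change b • e y = 0
      rw [← map_smul, hy, map_zero]
    · intro hx
      exact ⟨e.symm x, by rw [← map_smul, hx, map_zero], by simp⟩

lemma range_lsmul_quotient (I : Ideal A) (b : A) :
    LinearMap.range (LinearMap.lsmul A (A ⧸ I) b) =
      Submodule.map (Submodule.mkQ I) (I ⊔ Ideal.span {b}) := by
  ext x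
  obtain ⟨x, rfl⟩ := Submodule.mkQ_surjective I x
  rw [Submodule.map_sup, Submodule.mkQ_map_self, bot_sup_eq, Submodule.mem_map]
  constructor
  · rintro ⟨y, hy⟩
    obtain ⟨y, rfl⟩ := Submodule.mkQ_surjective I y
    exact ⟨b * y, Ideal.mul_mem_right _ _ (Ideal.mem_span_singleton_self b), by
      rw [← hy]; rfl⟩
  · rintro ⟨y, hy, h⟩
    obtain ⟨c, rfl⟩ := Ideal.mem_span_singleton'.1 hy
    exact ⟨Submodule.mkQ I c, by rw [← h, mul_comm]; rfl⟩

lemma locLength_coker_quotient (Q : PrimeSpectrum A) (I : Ideal A) (b : A) :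
    locLength Q ((A ⧸ I) ⧸ LinearMap.range (LinearMap.lsmul A (A ⧸ I) b)) =
      locLength Q (A ⧸ (I ⊔ Ideal.span {b})) := by
  rw [range_lsmul_quotient]
  exact locLength_congr Q (Submodule.quotientQuotientEquivQuotient I _ le_sup_left)

lemma mulChar_quotient_of_notMem (Q P : PrimeSpectrum A) {b : A} (hb : b ∉ P.asIdeal) :
    mulChar Q b (A ⧸ P.asIdeal) = (locLength Q (A ⧸ (P.asIdeal ⊔ Ideal.span {b}))).toNat := by
  unfold mulChar
  rw [locLength_coker_quotient]
  have hinj : Function.Injective (LinearMap.lsmul A (A ⧸ P.asIdeal) b) := by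
    rw [← LinearMap.ker_eq_bot, eq_bot_iff]
    intro x hx
    obtain ⟨x, rfl⟩ := Ideal.Quotient.mk_surjective x
    have : Ideal.Quotient.mk P.asIdeal (b * x) = 0 := hx
    rw [Ideal.Quotient.eq_zero_iff_mem] at this
    exact Ideal.Quotient.eq_zero_iff_mem.2 ((P.2.mem_or_mem this).resolve_left hb)
  have : Subsingleton (LinearMap.ker (LinearMap.lsmul A (A ⧸ P.asIdeal) b)) :=
    (Submodule.subsingleton_iff_eq_bot).2 (LinearMap.ker_eq_bot.2 hinj)
  rw [locLength_eq_zero_of_subsingleton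
    (N := LinearMap.ker (LinearMap.lsmul A (A ⧸ P.asIdeal) b))]
  simp

/-- Multiplication by `b` is zero on `A ⧸ Q`, so its kernel and cokernel are the same module. -/
lemma mulChar_quotient_self (Q : PrimeSpectrum A) {b : A} (hb : b ∈ Q.asIdeal) :
    mulChar Q b (A ⧸ Q.asIdeal) = 0 := by
  unfold mulChar
  have h0 : LinearMap.lsmul A (A ⧸ Q.asIdeal) b = 0 := by
    ext
    exact Ideal.Quotient.eq_zero_iff_mem.2 (Ideal.mul_mem_right _ _ hb)
  rw [locLength_coker_quotient, h0, LinearMap.ker_zero,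
    sup_eq_left.2 ((Ideal.span_singleton_le_iff_mem _).2 hb),
    locLength_congr Q (Submodule.topEquiv (R := A) (M := A ⧸ Q.asIdeal)), sub_self]

lemma mulChar_eq_zero_of_subsingleton (Q : PrimeSpectrum A) (b : A) [Subsingleton N₁] :
    mulChar Q b N₁ = 0 := by
  unfold mulChar
  rw [locLength_eq_zero_of_subsingleton, locLength_eq_zero_of_subsingleton, sub_self]

open Classical in
-- Both sides are additive in `N`, which reduces to `N = A ⧸ P'` with `I ≤ P'`. Both vanish when `Q`
-- does not contain `P'` or equals it. In the remaining case `P'` is minimal over `I`, and a single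
-- term of the sum survives.
lemma mulChar_eq_sum {Q : PrimeSpectrum A} {I : Ideal A} {b : A}
    (hQ : Q.asIdeal ∈ (I ⊔ Ideal.span {b}).minimalPrimes) (hb : ∀ P ∈ minPrimes I, b ∉ P.asIdeal)
    (N : Type v) [AddCommGroup N] [Module A N] [hN : Module.Finite A N]
    (hI : I ≤ Module.annihilator A N) :
    mulChar Q b N = ∑ P ∈ minPrimes I,
      ((locLength P N).toNat : ℤ) * (locLength Q (A ⧸ (P.asIdeal ⊔ Ideal.span {b}))).toNat := by
  have hbQ : b ∈ Q.asIdeal := hQ.1.2 (Ideal.mem_sup_right (Ideal.mem_span_singleton_self b))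
  induction hN using IsNoetherianRing.induction_on_isQuotientEquivQuotientPrime A with
  | subsingleton N =>
    simp [mulChar_eq_zero_of_subsingleton, locLength_eq_zero_of_subsingleton]
  | quotient N P' e =>
    rw [e.annihilator_eq, Ideal.annihilator_quotient] at hI
    rw [mulChar_congr e]
    simp_rw [locLength_congr _ e]
    by_cases hP'Q : P' ≤ Q
    swap
    · have h1 : mulChar Q b (A ⧸ P'.asIdeal) = 0 := by
        have h0 := locLength_quotient_eq_zero Q (I := P'.asIdeal) hP'Q
        have h2 := locLength_eq_ker_add_range Q (LinearMap.lsmul A (A ⧸ P'.asIdeal) b)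
        rw [h0] at h2
        unfold mulChar
        rw [locLength_coker_quotient, locLength_quotient_eq_zero Q
          (fun h => hP'Q (le_sup_left.trans h)), (add_eq_zero.1 h2.symm).1, sub_self]
      rw [h1]
      symm
      refine Finset.sum_eq_zero fun P hP => ?_
      by_cases hPQ : P.asIdeal ⊔ Ideal.span {b} ≤ Q.asIdeal
      · rw [locLength_quotient_eq_zero P (I := P'.asIdeal)
          (fun h => hP'Q (h.trans (le_sup_left.trans hPQ)))]
        simp
      · rw [locLength_quotient_eq_zero Q hPQ]
        simp
    obtain ⟨P₀, hP₀, hP₀P'⟩ := exists_mem_minPrimes_le hI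
    by_cases hPQ : P' = Q
    · subst hPQ
      rw [mulChar_quotient_self _ hbQ]
      symm
      refine Finset.sum_eq_zero fun P hP => ?_
      have hne : P ≠ P' := fun h => hb P hP (h ▸ hbQ)
      rw [locLength_quotient_prime, if_neg hne]
      · simp
      · refine Or.inr fun h => hne (PrimeSpectrum.ext ?_)
        exact le_antisymm ((mem_minPrimes.1 hP).2 ⟨P'.2, hI⟩ h) h
    have hP₀Q : Q.asIdeal ∈ (P₀.asIdeal ⊔ Ideal.span {b}).minimalPrimes := by
      refine ⟨⟨Q.2, sup_le (hP₀P'.trans hP'Q) ((Ideal.span_singleton_le_iff_mem _).2 hbQ)⟩, ?_⟩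
      rintro J ⟨hJ1, hJ2⟩ hJQ
      exact hQ.2 ⟨hJ1, le_trans (sup_le_sup_right (mem_minPrimes.1 hP₀).1.2 _) hJ2⟩ hJQ
    -- `Q` is minimal over `(P₀, b)`, so by Krull's principal ideal theorem no prime lies strictly
    -- between `P₀` and `Q`.
    have hP' : P₀ = P' := by
      have h1 := Ideal.map_height_le_one_of_mem_minimalPrimes hP₀Q
      by_contra hne
      have hlt1 : P₀.asIdeal < P'.asIdeal := lt_of_le_of_ne hP₀P' fun h => hne (PrimeSpectrum.ext h)
      have hlt2 : P'.asIdeal < Q.asIdeal := lt_of_le_of_ne hP'Q fun h => hPQ (PrimeSpectrum.ext h)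
      have p1 : (P'.asIdeal.map (Ideal.Quotient.mk P₀.asIdeal)).IsPrime :=
        Ideal.map_isPrime_of_surjective Ideal.Quotient.mk_surjective (by simpa using hlt1.le)
      have p2 : (Q.asIdeal.map (Ideal.Quotient.mk P₀.asIdeal)).IsPrime :=
        Ideal.map_isPrime_of_surjective Ideal.Quotient.mk_surjective
          (by simpa using (hlt1.trans hlt2).le)
      have hlt3 : P'.asIdeal.map (Ideal.Quotient.mk P₀.asIdeal) <
          Q.asIdeal.map (Ideal.Quotient.mk P₀.asIdeal) := by
        refine lt_of_le_of_ne (Ideal.map_mono hlt2.le) fun h => hlt2.ne ?_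
        have := congrArg (Ideal.comap (Ideal.Quotient.mk P₀.asIdeal)) h
        rwa [Ideal.comap_map_mk hlt1.le, Ideal.comap_map_mk (hlt1.trans hlt2).le] at this
      have hlt4 := Ideal.height_add_one_le_of_lt_of_isPrime hlt3
      have hlt5 : (P'.asIdeal.map (Ideal.Quotient.mk P₀.asIdeal)).height ≠ 0 := by
        rw [ne_eq, Ideal.height_eq_zero_iff_eq_bot, Ideal.map_eq_bot_iff_le_ker, Ideal.mk_ker]
        exact hlt1.not_ge
      have h6 : 1 ≤ (P'.asIdeal.map (Ideal.Quotient.mk P₀.asIdeal)).height :=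
        Order.one_le_iff_ne_zero.2 hlt5
      have h7 : (1 : ℕ∞) + 1 ≤ 1 := (add_le_add_left h6 1).trans (hlt4.trans h1)
      exact absurd h7 (by norm_num)
    subst hP'
    rw [mulChar_quotient_of_notMem Q P₀ (hb _ hP₀), Finset.sum_eq_single_of_mem P₀ hP₀]
    · rw [locLength_quotient_self]
      simp
    · intro P hP hne
      rw [locLength_quotient_prime P P₀, if_neg hne]
      · simp
      · exact Or.inr fun h => hne (PrimeSpectrum.ext
          (le_antisymm ((mem_minPrimes.1 hP).2 (mem_minPrimes.1 hP₀).1 h) h))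
  | exact N₁ N₂ N₃ f g hf hg h h₁ h₃ =>
    have hI₁ := hI.trans (f.annihilator_le_of_injective hf)
    have hI₃ := hI.trans (g.annihilator_le_of_surjective hg)
    rw [mulChar_exact hQ hI f g hf hg h, h₁ hI₁, h₃ hI₃, ← Finset.sum_add_distrib]
    refine Finset.sum_congr rfl fun P hP => ?_
    rw [locLength_exact P f g hf hg h, ENat.toNat_add
      (locLength_ne_top P (mem_minPrimes.1 hP) N₁ hI₁)
      (locLength_ne_top P (mem_minPrimes.1 hP) N₃ hI₃)]
    push_cast
    ring

/-- The syzygies of a pair of elements modulo an ideal. -/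
def syzygies (P : Ideal A) (a b : A) : Submodule A (A × A) :=
  LinearMap.ker ((Submodule.mkQ P).comp
    ((LinearMap.lsmul A A b).comp (LinearMap.fst A A A) -
      (LinearMap.lsmul A A a).comp (LinearMap.snd A A A)))

lemma mem_syzygies {P : Ideal A} {a b : A} {x : A × A} :
    x ∈ syzygies P a b ↔ b * x.1 - a * x.2 ∈ P := by
  exact Submodule.Quotient.mk_eq_zero _

/-- Both kernels are images of the module of pairs `(x, y)` with `b x - a y ∈ P`, under the two
coordinate projections. Since `a` and `b` are nonzerodivisors modulo `P`, one has `x ∈ (P, a)`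
exactly when `y ∈ (P, b)`, so the projections have the same kernel and isomorphic images. -/
lemma locLength_ker_symm (Q : PrimeSpectrum A) (P : PrimeSpectrum A) {a b : A}
    (ha : a ∉ P.asIdeal) (hb : b ∉ P.asIdeal) :
    locLength Q (LinearMap.ker (LinearMap.lsmul A (A ⧸ (P.asIdeal ⊔ Ideal.span {a})) b)) =
      locLength Q (LinearMap.ker (LinearMap.lsmul A (A ⧸ (P.asIdeal ⊔ Ideal.span {b})) a)) := by
  let K := syzygies P.asIdeal a b
  let f₁ : K →ₗ[A] A ⧸ (P.asIdeal ⊔ Ideal.span {a}) :=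
    (Submodule.mkQ _).comp ((LinearMap.fst A A A).comp K.subtype)
  let f₂ : K →ₗ[A] A ⧸ (P.asIdeal ⊔ Ideal.span {b}) :=
    (Submodule.mkQ _).comp ((LinearMap.snd A A A).comp K.subtype)
  have r₁ : LinearMap.range f₁ =
      LinearMap.ker (LinearMap.lsmul A (A ⧸ (P.asIdeal ⊔ Ideal.span {a})) b) := by
    ext x
    constructor
    · rintro ⟨⟨⟨x, y⟩, h⟩, rfl⟩
      rw [mem_syzygies] at h
      refine (Submodule.Quotient.mk_eq_zero _).2 (?_ : b * x ∈ _)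
      rw [← sub_add_cancel (b * x) (a * y)]
      exact Ideal.add_mem _ (Ideal.mem_sup_left h)
        (Ideal.mem_sup_right (Ideal.mul_mem_right _ _ (Ideal.mem_span_singleton_self a)))
    · intro hx
      obtain ⟨x, rfl⟩ := Submodule.mkQ_surjective _ x
      have : b * x ∈ P.asIdeal ⊔ Ideal.span {a} := (Submodule.Quotient.mk_eq_zero _).1 hx
      obtain ⟨z, hz, w, hw, h⟩ := Submodule.mem_sup.1 this
      obtain ⟨y, rfl⟩ := Ideal.mem_span_singleton'.1 hw
      exact ⟨⟨(x, y), mem_syzygies.2 (by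
        have : b * x - a * y = z := by rw [← h]; ring
        exact this ▸ hz)⟩, rfl⟩
  have r₂ : LinearMap.range f₂ =
      LinearMap.ker (LinearMap.lsmul A (A ⧸ (P.asIdeal ⊔ Ideal.span {b})) a) := by
    ext y
    constructor
    · rintro ⟨⟨⟨x, y⟩, h⟩, rfl⟩
      rw [mem_syzygies] at h
      refine (Submodule.Quotient.mk_eq_zero _).2 (?_ : a * y ∈ _)
      rw [← sub_sub_cancel (b * x) (a * y)]
      exact Ideal.sub_mem _ (Ideal.mem_sup_right (Ideal.mul_mem_right _ _
        (Ideal.mem_span_singleton_self b))) (Ideal.mem_sup_left h)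
    · intro hy
      obtain ⟨y, rfl⟩ := Submodule.mkQ_surjective _ y
      have : a * y ∈ P.asIdeal ⊔ Ideal.span {b} := (Submodule.Quotient.mk_eq_zero _).1 hy
      obtain ⟨z, hz, w, hw, h⟩ := Submodule.mem_sup.1 this
      obtain ⟨x, rfl⟩ := Ideal.mem_span_singleton'.1 hw
      exact ⟨⟨(x, y), mem_syzygies.2 (by
        have : b * x - a * y = -z := by rw [← h]; ring
        exact this ▸ neg_mem hz)⟩, rfl⟩
  have hker : LinearMap.ker f₁ = LinearMap.ker f₂ := by
    ext ⟨⟨x, y⟩, h⟩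
    rw [mem_syzygies] at h
    simp only at h
    have e₁ : (⟨(x, y), mem_syzygies.2 h⟩ : K) ∈ LinearMap.ker f₁ ↔
      x ∈ P.asIdeal ⊔ Ideal.span {a} := Submodule.Quotient.mk_eq_zero _
    have e₂ : (⟨(x, y), mem_syzygies.2 h⟩ : K) ∈ LinearMap.ker f₂ ↔
      y ∈ P.asIdeal ⊔ Ideal.span {b} := Submodule.Quotient.mk_eq_zero _
    rw [e₁, e₂]
    constructor
    · intro hx
      obtain ⟨z, hz, w, hw, rfl⟩ := Submodule.mem_sup.1 hx
      obtain ⟨c, rfl⟩ := Ideal.mem_span_singleton'.1 hw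
      have : a * (b * c - y) ∈ P.asIdeal := by
        have : a * (b * c - y) = (b * (z + c * a) - a * y) - b * z := by ring
        rw [this]
        exact sub_mem h (Ideal.mul_mem_left _ _ hz)
      have := (P.2.mem_or_mem this).resolve_left ha
      rw [show y = b * c - (b * c - y) by ring]
      exact sub_mem (Ideal.mem_sup_right (Ideal.mul_mem_right _ _
        (Ideal.mem_span_singleton_self b))) (Ideal.mem_sup_left this)
    · intro hy
      obtain ⟨z, hz, w, hw, rfl⟩ := Submodule.mem_sup.1 hy
      obtain ⟨c, rfl⟩ := Ideal.mem_span_singleton'.1 hw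
      have : b * (x - a * c) ∈ P.asIdeal := by
        have : b * (x - a * c) = (b * x - a * (z + c * b)) + a * z := by ring
        rw [this]
        exact add_mem h (Ideal.mul_mem_left _ _ hz)
      have := (P.2.mem_or_mem this).resolve_left hb
      rw [show x = (x - a * c) + a * c by ring]
      exact add_mem (Ideal.mem_sup_left this) (Ideal.mem_sup_right (Ideal.mul_mem_right _ _
        (Ideal.mem_span_singleton_self a)))
  rw [← r₁, ← r₂]
  exact locLength_congr Q (f₁.quotKerEquivRange.symm ≪≫ₗ Submodule.quotEquivOfEq _ _ hker ≪≫ₗ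
    f₂.quotKerEquivRange)

/-- Symmetry of the intersection of a prime cycle with two divisors. -/
lemma sum_locLength_symm {P Q : PrimeSpectrum A} {a b : A}
    (hQ : Q.asIdeal ∈ (P.asIdeal ⊔ Ideal.span {a} ⊔ Ideal.span {b}).minimalPrimes)
    (ha : a ∉ P.asIdeal) (hb : b ∉ P.asIdeal)
    (hab : ∀ P' ∈ minPrimes (P.asIdeal ⊔ Ideal.span {a}), b ∉ P'.asIdeal)
    (hba : ∀ P' ∈ minPrimes (P.asIdeal ⊔ Ideal.span {b}), a ∉ P'.asIdeal) :
    ∑ P' ∈ minPrimes (P.asIdeal ⊔ Ideal.span {a}),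
      ((locLength P' (A ⧸ (P.asIdeal ⊔ Ideal.span {a}))).toNat : ℤ) *
        (locLength Q (A ⧸ (P'.asIdeal ⊔ Ideal.span {b}))).toNat =
    ∑ P' ∈ minPrimes (P.asIdeal ⊔ Ideal.span {b}),
      ((locLength P' (A ⧸ (P.asIdeal ⊔ Ideal.span {b}))).toNat : ℤ) *
        (locLength Q (A ⧸ (P'.asIdeal ⊔ Ideal.span {a}))).toNat := by
  have hQ' : Q.asIdeal ∈ (P.asIdeal ⊔ Ideal.span {b} ⊔ Ideal.span {a}).minimalPrimes := by
    rwa [sup_right_comm]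
  -- Each sum is an Euler characteristic: the length of `A ⧸ (P, a, b)`, symmetric in `a` and `b`,
  -- minus the length of a kernel, symmetric by `locLength_ker_symm`.
  rw [← mulChar_eq_sum hQ hab _ (Ideal.annihilator_quotient).ge,
    ← mulChar_eq_sum hQ' hba _ (Ideal.annihilator_quotient).ge]
  unfold mulChar
  rw [locLength_coker_quotient, locLength_coker_quotient, sup_right_comm,
    locLength_ker_symm Q P ha hb]

end mulChar

/-! ### Pull-back of cycles -/

section pullback

variable {A B C : Type v} [CommRing A] [CommRing B] [CommRing C]

/-- For a closed immersion, the local ring at `q` is a quotient of the local ring at its image, so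
lengths over the two agree. Multiplicities of restrictions to faces are thereby computed on the
ambient cube. -/
lemma length_eq_locLength_of_surjective {φ : A →+* B} (hφ : Function.Surjective φ)
    (I : Ideal A) (q : PrimeSpectrum B) :
    Module.length (Localization.AtPrime q.asIdeal) (Localization.AtPrime q.asIdeal ⧸
      I.map ((algebraMap B (Localization.AtPrime q.asIdeal)).comp φ)) =
      locLength (PrimeSpectrum.comap φ q) (A ⧸ (I ⊔ RingHom.ker φ)) := by
  let Q := PrimeSpectrum.comap φ q
  let f : Localization.AtPrime Q.asIdeal →+* Localization.AtPrime q.asIdeal :=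
    Localization.localRingHom Q.asIdeal q.asIdeal φ rfl
  have hfA : ∀ x, f (algebraMap A _ x) = algebraMap B _ (φ x) :=
    fun x => Localization.localRingHom_to_map _ _ _ _ x
  have hf : Function.Surjective f := by
    intro x
    obtain ⟨b, s, rfl⟩ := IsLocalization.exists_mk'_eq q.asIdeal.primeCompl x
    obtain ⟨a, rfl⟩ := hφ b
    obtain ⟨t, ht⟩ := hφ s
    have htQ : t ∉ Q.asIdeal := fun h => s.2 (by rw [← ht]; exact h)
    refine ⟨IsLocalization.mk' _ a (⟨t, htQ⟩ : Q.asIdeal.primeCompl), ?_⟩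
    refine (Localization.localRingHom_mk' _ _ _ rfl a
      (⟨t, htQ⟩ : Q.asIdeal.primeCompl)).trans ?_
    congr 1
    exact Subtype.ext ht
  let _ : Algebra (Localization.AtPrime Q.asIdeal) (Localization.AtPrime q.asIdeal) := f.toAlgebra
  let J := I.map ((algebraMap B (Localization.AtPrime q.asIdeal)).comp φ)
  have hJ : J = (I.map (algebraMap A (Localization.AtPrime Q.asIdeal))).map f := by
    rw [Ideal.map_map]
    exact congrArg (I.map ·) (RingHom.ext fun x => (hfA x).symm)
  rw [locLength_quotient, ← Module.length_eq_of_surjective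
    (S := Localization.AtPrime Q.asIdeal) hf]
  let g : Localization.AtPrime Q.asIdeal →ₗ[Localization.AtPrime Q.asIdeal]
      (Localization.AtPrime q.asIdeal ⧸ J) :=
    ((Ideal.Quotient.mkₐ _ J).comp (Algebra.ofId (Localization.AtPrime Q.asIdeal) _)).toLinearMap
  have hg : Function.Surjective g := Ideal.Quotient.mk_surjective.comp hf
  have hker : LinearMap.ker g =
      (I ⊔ RingHom.ker φ).map (algebraMap A (Localization.AtPrime Q.asIdeal)) := by
    apply le_antisymm
    · intro x hx
      obtain ⟨a, s, rfl⟩ := IsLocalization.exists_mk'_eq Q.asIdeal.primeCompl x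
      have hx' : f (IsLocalization.mk' _ a s) ∈ J := Ideal.Quotient.eq_zero_iff_mem.1 hx
      have h1 : f (algebraMap A _ a) ∈ J := by
        rw [← IsLocalization.mk'_spec' (Localization.AtPrime Q.asIdeal) a s, map_mul]
        exact Ideal.mul_mem_left _ _ hx'
      have h2 : algebraMap B (Localization.AtPrime q.asIdeal) (φ a) ∈
          (I.map φ).map (algebraMap B (Localization.AtPrime q.asIdeal)) := by
        rw [Ideal.map_map]
        rwa [hfA] at h1
      rw [IsLocalization.algebraMap_mem_map_algebraMap_iff q.asIdeal.primeCompl] at h2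
      obtain ⟨t, ht, htI⟩ := h2
      obtain ⟨t, rfl⟩ := hφ t
      rw [← map_mul, Ideal.mem_map_iff_of_surjective _ hφ] at htI
      obtain ⟨y, hy, hyt⟩ := htI
      have h3 : t * a ∈ I ⊔ RingHom.ker φ := by
        rw [show t * a = y + (t * a - y) by ring]
        exact Ideal.add_mem _ (Ideal.mem_sup_left hy) (Ideal.mem_sup_right (by
          rw [RingHom.mem_ker, map_sub, hyt, sub_self]))
      have h4 : algebraMap A (Localization.AtPrime Q.asIdeal) a ∈
          (I ⊔ RingHom.ker φ).map (algebraMap A (Localization.AtPrime Q.asIdeal)) :=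
        (IsLocalization.algebraMap_mem_map_algebraMap_iff Q.asIdeal.primeCompl _ _ _).2
          ⟨t, ht, h3⟩
      rw [IsLocalization.mk'_eq_mul_mk'_one]
      exact Ideal.mul_mem_right _ _ h4
    · rw [Ideal.map_le_iff_le_comap]
      refine sup_le ?_ ?_
      · intro x hx
        refine Ideal.Quotient.eq_zero_iff_mem.2 (?_ : f (algebraMap A _ x) ∈ J)
        rw [hJ]
        exact Ideal.mem_map_of_mem _ (Ideal.mem_map_of_mem _ hx)
      · intro x hx
        refine Ideal.Quotient.eq_zero_iff_mem.2 (?_ : f (algebraMap A _ x) ∈ J)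
        rw [hfA, (RingHom.mem_ker).1 hx, map_zero]
        exact zero_mem _
  exact ((Submodule.quotEquivOfEq _ _ hker.symm) ≪≫ₗ
    g.quotKerEquivOfSurjective hg).length_eq.symm

variable [IsNoetherianRing A] [IsNoetherianRing B] [IsNoetherianRing C]

open Classical in
lemma pullbackPrime_apply (φ : A →+* B) (p : PrimeSpectrum A) (q : PrimeSpectrum B) :
    pullbackPrime φ p q = if q ∈ minPrimes (p.asIdeal.map φ) then
      ((Module.length (Localization.AtPrime q.asIdeal) (Localization.AtPrime q.asIdeal ⧸
        p.asIdeal.map ((algebraMap B (Localization.AtPrime q.asIdeal)).comp φ))).toNat : ℤ)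
      else 0 := by
  unfold pullbackPrime
  rw [Finsupp.finsetSum_apply]
  split_ifs with h
  · rw [mem_minPrimes] at h
    rw [Finset.sum_eq_single_of_mem ⟨q.asIdeal,
      ((Ideal.finite_minimalPrimes_of_isNoetherianRing B (p.asIdeal.map φ)).mem_toFinset.2 h)⟩
      (Finset.mem_attach _ _)]
    · exact Finsupp.single_eq_same
    · intro b _ hb
      rw [Finsupp.single_apply, if_neg]
      exact fun h' => hb (Subtype.ext (congrArg PrimeSpectrum.asIdeal h'))
  · refine Finset.sum_eq_zero fun b _ => ?_
    rw [Finsupp.single_apply, if_neg]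
    rintro rfl
    exact h (mem_minPrimes.2
      ((Ideal.finite_minimalPrimes_of_isNoetherianRing B (p.asIdeal.map φ)).mem_toFinset.1 b.2))

lemma mem_minPrimes_of_mem_support {φ : A →+* B} {p : PrimeSpectrum A} {q : PrimeSpectrum B}
    (h : q ∈ (pullbackPrime φ p).support) : q ∈ minPrimes (p.asIdeal.map φ) := by
  classical
  rw [Finsupp.mem_support_iff, pullbackPrime_apply] at h
  by_contra hq
  rw [if_neg hq] at h
  exact h rfl

lemma pullback_single (φ : A →+* B) (p : PrimeSpectrum A) (m : ℤ) :
    pullback φ (Finsupp.single p m) = m • pullbackPrime φ p := by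
  simp [pullback]

lemma pullback_eq_sum (φ : A →+* B) (Z : Cycle A) :
    pullback φ Z = Z.sum fun p m => m • pullbackPrime φ p := by
  rw [pullback, Finsupp.liftAddHom_apply]
  rfl

lemma pullback_apply_of_subset (φ : A →+* B) (Z : Cycle A) (T : Finset (PrimeSpectrum A))
    (hT : Z.support ⊆ T) (q : PrimeSpectrum B) :
    pullback φ Z q = ∑ p ∈ T, Z p * pullbackPrime φ p q := by
  rw [pullback_eq_sum, Finsupp.sum_apply, Finsupp.sum_of_support_subset _ hT]
  · simp
  · simp

/-- Two homomorphisms out of the group of cycles agree on a cycle if they agree on its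
components. -/
lemma map_eq_of_forall_single {G : Type*} [AddCommGroup G] (f g : Cycle A →+ G) (Z : Cycle A)
    (h : ∀ p ∈ Z.support, f (Finsupp.single p 1) = g (Finsupp.single p 1)) : f Z = g Z := by
  rw [← Finsupp.sum_single Z, Finsupp.sum, map_sum, map_sum]
  refine Finset.sum_congr rfl fun p hp => ?_
  rw [show Finsupp.single p (Z p) = Z p • Finsupp.single p (1 : ℤ) by simp, map_zsmul, map_zsmul,
    h p hp]

lemma map_mem_of_forall_single {G : Type*} [AddCommGroup G] (f : Cycle A →+ G) (H : AddSubgroup G)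
    (Z : Cycle A) (h : ∀ p ∈ Z.support, f (Finsupp.single p 1) ∈ H) : f Z ∈ H := by
  rw [← Finsupp.sum_single Z, Finsupp.sum, map_sum]
  refine sum_mem fun p hp => ?_
  rw [show Finsupp.single p (Z p) = Z p • Finsupp.single p (1 : ℤ) by simp, map_zsmul]
  exact zsmul_mem (h p hp) _

/-- A prime cycle whose ideal extends to a prime ideal pulls back to a prime cycle. -/
lemma pullbackPrime_of_isPrime (φ : A →+* B) (p : PrimeSpectrum A)
    (h : (p.asIdeal.map φ).IsPrime) :
    pullbackPrime φ p = Finsupp.single ⟨p.asIdeal.map φ, h⟩ 1 := by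
  classical
  ext q
  rw [pullbackPrime_apply, Finsupp.single_apply]
  have hmin : q ∈ minPrimes (p.asIdeal.map φ) ↔ ⟨p.asIdeal.map φ, h⟩ = q := by
    rw [mem_minPrimes, Ideal.minimalPrimes_eq_subsingleton_self, Set.mem_singleton_iff,
      PrimeSpectrum.ext_iff, eq_comm]
  simp only [hmin]
  split_ifs with hq
  · subst hq
    rw [← Ideal.map_map, Localization.AtPrime.map_eq_maximalIdeal, Module.length_eq_one_iff.2]
    · rfl
    · rw [isSimpleModule_iff_isCoatom]
      exact (IsLocalRing.maximalIdeal.isMaximal _).out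
  · rfl

/-- The first pull-back is a prime cycle of multiplicity one, and both sides are then determined by
the same extended ideal in `C`. -/
lemma pullback_pullbackPrime_of_isPrime (φ : A →+* B) (ψ : B →+* C) (p : PrimeSpectrum A)
    (h : (p.asIdeal.map φ).IsPrime) :
    pullback ψ (pullbackPrime φ p) = pullbackPrime (ψ.comp φ) p := by
  classical
  rw [pullbackPrime_of_isPrime φ p h, pullback_single, one_smul]
  ext q
  rw [pullbackPrime_apply, pullbackPrime_apply]
  have hI : (p.asIdeal.map φ).map ((algebraMap C (Localization.AtPrime q.asIdeal)).comp ψ) =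
      p.asIdeal.map ((algebraMap C (Localization.AtPrime q.asIdeal)).comp (ψ.comp φ)) := by
    rw [Ideal.map_map, RingHom.comp_assoc]
  rw [hI, Ideal.map_map]

open Classical in
lemma pullbackPrime_apply_of_surjective {φ : A →+* B} (hφ : Function.Surjective φ)
    (p : PrimeSpectrum A) (q : PrimeSpectrum B) :
    pullbackPrime φ p q =
      if PrimeSpectrum.comap φ q ∈ minPrimes (p.asIdeal ⊔ RingHom.ker φ) then
        ((locLength (PrimeSpectrum.comap φ q) (A ⧸ (p.asIdeal ⊔ RingHom.ker φ))).toNat : ℤ)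
      else 0 := by
  have hmin : q ∈ minPrimes (p.asIdeal.map φ) ↔
      PrimeSpectrum.comap φ q ∈ minPrimes (p.asIdeal ⊔ RingHom.ker φ) := by
    rw [mem_minPrimes, mem_minPrimes, ← Ideal.comap_map_of_surjective' φ hφ,
      Ideal.comap_minimalPrimes_eq_of_surjective hφ, PrimeSpectrum.comap_asIdeal]
    exact ((Ideal.comap_injective_of_surjective φ hφ).mem_set_image).symm
  rw [pullbackPrime_apply, length_eq_locLength_of_surjective hφ]
  simp only [hmin]

open Classical in
/-- Iterated intersection with two principal divisors. -/
lemma pullback_pullbackPrime_apply_of_surjective {φ : A →+* B} {ψ : B →+* C}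
    (hφ : Function.Surjective φ) (hψ : Function.Surjective ψ) {a b : A}
    (ha : RingHom.ker φ = Ideal.span {a}) (hb : RingHom.ker ψ = Ideal.span {φ b})
    (p : PrimeSpectrum A) (q : PrimeSpectrum C)
    (hmin : ∀ P ∈ minPrimes (p.asIdeal ⊔ Ideal.span {a}),
      ∀ Q ∈ minPrimes (P.asIdeal ⊔ Ideal.span {b}),
      Q ∈ minPrimes (p.asIdeal ⊔ Ideal.span {a} ⊔ Ideal.span {b})) :
    pullback ψ (pullbackPrime φ p) q =
      if PrimeSpectrum.comap (ψ.comp φ) q ∈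
          minPrimes (p.asIdeal ⊔ Ideal.span {a} ⊔ Ideal.span {b}) then
        ∑ P ∈ minPrimes (p.asIdeal ⊔ Ideal.span {a}),
          ((locLength P (A ⧸ (p.asIdeal ⊔ Ideal.span {a}))).toNat : ℤ) *
            (locLength (PrimeSpectrum.comap (ψ.comp φ) q) (A ⧸ (P.asIdeal ⊔ Ideal.span {b}))).toNat
      else 0 := by
  set Q := PrimeSpectrum.comap (ψ.comp φ) q with hQdef
  have hψφ : Function.Surjective (ψ.comp φ) := hψ.comp hφ
  have hker : RingHom.ker (ψ.comp φ) = Ideal.span {a} ⊔ Ideal.span {b} := by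
    rw [← RingHom.comap_ker, hb, show Ideal.span {φ b} = (Ideal.span {b}).map φ by
      rw [Ideal.map_span, Set.image_singleton], Ideal.comap_map_of_surjective' φ hφ, ha, sup_comm]
  have hsub : (pullbackPrime φ p).support ⊆ minPrimes (p.asIdeal.map φ) := fun x hx =>
    mem_minPrimes_of_mem_support hx
  have hminB : ∀ q₁ : PrimeSpectrum B, q₁ ∈ minPrimes (p.asIdeal.map φ) ↔
      PrimeSpectrum.comap φ q₁ ∈ minPrimes (p.asIdeal ⊔ Ideal.span {a}) := by
    intro q₁
    rw [mem_minPrimes, mem_minPrimes, ← ha, ← Ideal.comap_map_of_surjective' φ hφ,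
      Ideal.comap_minimalPrimes_eq_of_surjective hφ, PrimeSpectrum.comap_asIdeal]
    exact ((Ideal.comap_injective_of_surjective φ hφ).mem_set_image).symm
  -- A prime of the quotient `B` is the pull-back of its preimage in `A`, so the second intersection
  -- can be computed from that preimage along the composite map.
  have hterm : ∀ q₁ ∈ minPrimes (p.asIdeal.map φ), pullbackPrime ψ q₁ q =
      if Q ∈ minPrimes ((PrimeSpectrum.comap φ q₁).asIdeal ⊔ Ideal.span {b}) then
        ((locLength Q (A ⧸ ((PrimeSpectrum.comap φ q₁).asIdeal ⊔ Ideal.span {b}))).toNat : ℤ)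
      else 0 := by
    intro q₁ hq₁
    have hle : Ideal.span {a} ≤ (PrimeSpectrum.comap φ q₁).asIdeal := by
      rw [← ha]
      intro x hx
      rw [PrimeSpectrum.comap_asIdeal, Ideal.mem_comap, (RingHom.mem_ker).1 hx]
      exact zero_mem _
    have heq : pullbackPrime ψ q₁ q = pullbackPrime (ψ.comp φ) (PrimeSpectrum.comap φ q₁) q := by
      have hm : (PrimeSpectrum.comap φ q₁).asIdeal.map φ = q₁.asIdeal :=
        Ideal.map_comap_of_surjective φ hφ _
      rw [← pullback_pullbackPrime_of_isPrime φ ψ _ (by rw [hm]; exact q₁.2),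
        pullbackPrime_of_isPrime φ _ (by rw [hm]; exact q₁.2), pullback_single, one_smul]
      congr 2
      exact PrimeSpectrum.ext hm.symm
    rw [heq, pullbackPrime_apply_of_surjective hψφ, hker, ← sup_assoc, sup_eq_left.2 hle]
  rw [pullback_apply_of_subset ψ _ _ hsub]
  split_ifs with hQ
  · refine Finset.sum_bij' (fun q₁ _ => PrimeSpectrum.comap φ q₁)
      (fun P hP => ⟨P.asIdeal.map φ, Ideal.map_isPrime_of_surjective hφ (by
        rw [ha]; exact le_sup_right.trans (mem_minPrimes.1 hP).1.2)⟩) ?_ ?_ ?_ ?_ ?_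
    · intro q₁ hq₁
      exact (hminB q₁).1 hq₁
    · intro P hP
      rw [hminB]
      convert hP
      refine PrimeSpectrum.ext ?_
      change (P.asIdeal.map φ).comap φ = _
      rw [Ideal.comap_map_of_surjective' φ hφ, ha,
        sup_eq_left.2 (le_sup_right.trans (mem_minPrimes.1 hP).1.2)]
    · intro q₁ _
      exact PrimeSpectrum.ext (Ideal.map_comap_of_surjective φ hφ _)
    · intro P hP
      refine PrimeSpectrum.ext ?_
      change (P.asIdeal.map φ).comap φ = _
      rw [Ideal.comap_map_of_surjective' φ hφ, ha,
        sup_eq_left.2 (le_sup_right.trans (mem_minPrimes.1 hP).1.2)]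
    · intro q₁ hq₁
      have hq₁' := (hminB q₁).1 hq₁
      rw [hterm q₁ hq₁, pullbackPrime_apply_of_surjective hφ, ha, if_pos hq₁']
      congr 1
      -- As `Q` is minimal over `(p, a, b)`, it is minimal over `(P, b)` as soon as it contains this
      -- ideal; otherwise the length at `Q` is zero, in agreement with the default value.
      split_ifs with h
      · rfl
      · rw [locLength_quotient_eq_zero]
        · rfl
        intro hle
        apply h
        rw [mem_minPrimes] at hQ ⊢
        refine ⟨⟨Q.2, hle⟩, ?_⟩
        rintro J ⟨hJ1, hJ2⟩ hJQ
        exact hQ.2 ⟨hJ1, le_trans (sup_le_sup_right (mem_minPrimes.1 hq₁').1.2 _) hJ2⟩ hJQ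
  · refine Finset.sum_eq_zero fun q₁ hq₁ => ?_
    rw [hterm q₁ hq₁, if_neg, mul_zero]
    exact fun h => hQ (hmin _ ((hminB q₁).1 hq₁) _ h)

/-- Intersections with two principal divisors commute. -/
lemma pullback_pullbackPrime_comm {B' : Type v} [CommRing B'] [IsNoetherianRing B'] {φ : A →+* B}
    {ψ : B →+* C} {φ' : A →+* B'} {ψ' : B' →+* C} (h : ψ.comp φ = ψ'.comp φ')
    (hφ : Function.Surjective φ) (hψ : Function.Surjective ψ)
    (hφ' : Function.Surjective φ') (hψ' : Function.Surjective ψ') {a b : A}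
    (ha : RingHom.ker φ = Ideal.span {a}) (hb : RingHom.ker ψ = Ideal.span {φ b})
    (hb' : RingHom.ker φ' = Ideal.span {b}) (ha' : RingHom.ker ψ' = Ideal.span {φ' a})
    (p : PrimeSpectrum A) (hap : a ∉ p.asIdeal) (hbp : b ∉ p.asIdeal)
    (hab : ∀ P ∈ minPrimes (p.asIdeal ⊔ Ideal.span {a}), b ∉ P.asIdeal)
    (hba : ∀ P ∈ minPrimes (p.asIdeal ⊔ Ideal.span {b}), a ∉ P.asIdeal)
    (hmin : ∀ P ∈ minPrimes (p.asIdeal ⊔ Ideal.span {a}),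
      ∀ Q ∈ minPrimes (P.asIdeal ⊔ Ideal.span {b}),
        Q ∈ minPrimes (p.asIdeal ⊔ Ideal.span {a} ⊔ Ideal.span {b}))
    (hmin' : ∀ P ∈ minPrimes (p.asIdeal ⊔ Ideal.span {b}),
      ∀ Q ∈ minPrimes (P.asIdeal ⊔ Ideal.span {a}),
        Q ∈ minPrimes (p.asIdeal ⊔ Ideal.span {b} ⊔ Ideal.span {a})) :
    pullback ψ (pullbackPrime φ p) = pullback ψ' (pullbackPrime φ' p) := by
  classical
  ext q
  rw [pullback_pullbackPrime_apply_of_surjective hφ hψ ha hb p q hmin,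
    pullback_pullbackPrime_apply_of_surjective hφ' hψ' hb' ha' p q hmin', ← h, sup_right_comm]
  split_ifs with hQ
  · rw [sup_right_comm] at hQ
    exact sum_locLength_symm (mem_minPrimes.1 hQ) hap hbp hab hba
  · rfl

/-- Lengths are preserved by flat local homomorphisms with reduced closed fibre. -/
lemma length_quotient_map_of_flat {ψ : B →+* C} (hflat : ψ.Flat) (P : PrimeSpectrum B)
    (q : PrimeSpectrum C) (hq : q.asIdeal = P.asIdeal.map ψ) (hloc : P.asIdeal = q.asIdeal.comap ψ)
    (I : Ideal B) :
    Module.length (Localization.AtPrime q.asIdeal) (Localization.AtPrime q.asIdeal ⧸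
      I.map ((algebraMap C (Localization.AtPrime q.asIdeal)).comp ψ)) =
    Module.length (Localization.AtPrime P.asIdeal) (Localization.AtPrime P.asIdeal ⧸
      I.map (algebraMap B (Localization.AtPrime P.asIdeal))) := by
  let f : Localization.AtPrime P.asIdeal →+* Localization.AtPrime q.asIdeal :=
    Localization.localRingHom P.asIdeal q.asIdeal ψ hloc
  have hf : f.Flat := hflat.localRingHom q.asIdeal P.asIdeal hloc
  have hl : IsLocalHom f := Localization.isLocalHom_localRingHom P.asIdeal q.asIdeal ψ hloc
  have hfc : f.comp (algebraMap B (Localization.AtPrime P.asIdeal)) =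
      (algebraMap C (Localization.AtPrime q.asIdeal)).comp ψ := by
    exact RingHom.ext fun x => Localization.localRingHom_to_map _ _ _ hloc x
  let _ : Algebra (Localization.AtPrime P.asIdeal) (Localization.AtPrime q.asIdeal) := f.toAlgebra
  have : Module.Flat (Localization.AtPrime P.asIdeal) (Localization.AtPrime q.asIdeal) := hf
  have : IsLocalHom (algebraMap (Localization.AtPrime P.asIdeal)
    (Localization.AtPrime q.asIdeal)) := hl
  have h1 := IsLocalRing.length_baseChange (Localization.AtPrime P.asIdeal)
    (Localization.AtPrime q.asIdeal) (Localization.AtPrime P.asIdeal ⧸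
      I.map (algebraMap B (Localization.AtPrime P.asIdeal)))
  have h2 : (IsLocalRing.maximalIdeal (Localization.AtPrime P.asIdeal)).map
      (algebraMap _ (Localization.AtPrime q.asIdeal)) =
      IsLocalRing.maximalIdeal (Localization.AtPrime q.asIdeal) := by
    rw [← Localization.AtPrime.map_eq_maximalIdeal, ← Localization.AtPrime.map_eq_maximalIdeal,
      Ideal.map_map]
    change P.asIdeal.map (f.comp _) = _
    rw [hfc, ← Ideal.map_map]
    exact congrArg _ hq.symm
  have h3 : Module.length (Localization.AtPrime q.asIdeal)
      (Localization.AtPrime q.asIdeal ⧸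
        IsLocalRing.maximalIdeal (Localization.AtPrime q.asIdeal)) = 1 := by
    rw [Module.length_eq_one_iff, isSimpleModule_iff_isCoatom]
    exact (IsLocalRing.maximalIdeal.isMaximal _).out
  rw [h2, h3, mul_one, ← (Ideal.qoutMapEquivTensorQout _).length_eq, Ideal.map_map] at h1
  rw [← h1, ← hfc]
  rfl

/-- Functoriality of the pull-back of cycles when the second morphism is flat and irreducible
closed subsets have irreducible inverse images. -/
lemma pullback_pullbackPrime_of_flat (φ : A →+* B) (ψ : B →+* C) (hflat : ψ.Flat)
    (hprime : ∀ P : Ideal B, P.IsPrime → (P.map ψ).IsPrime ∧ (P.map ψ).comap ψ = P)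
    (p : PrimeSpectrum A) : pullback ψ (pullbackPrime φ p) = pullbackPrime (ψ.comp φ) p := by
  classical
  ext q
  let E : PrimeSpectrum B → PrimeSpectrum C := fun P => ⟨P.asIdeal.map ψ, (hprime _ P.2).1⟩
  have hE : ∀ P, PrimeSpectrum.comap ψ (E P) = P := fun P =>
    PrimeSpectrum.ext (hprime _ P.2).2
  have hEinj : Function.Injective E := fun P P' h => by rw [← hE P, ← hE P', h]
  have hmin : ∀ q, q ∈ minPrimes (p.asIdeal.map (ψ.comp φ)) ↔
      ∃ P ∈ minPrimes (p.asIdeal.map φ), E P = q := by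
    intro q
    simp only [mem_minPrimes, ← Ideal.map_map]
    constructor
    · intro hq
      obtain ⟨P, hP, hPq⟩ := exists_mem_minPrimes_le (I := p.asIdeal.map φ)
        (P := PrimeSpectrum.comap ψ q) (Ideal.map_le_iff_le_comap.1 hq.1.2)
      refine ⟨P, mem_minPrimes.1 hP, PrimeSpectrum.ext (le_antisymm ?_ ?_)⟩
      · exact Ideal.map_le_iff_le_comap.2 hPq
      · exact hq.2 ⟨(E P).2, Ideal.map_mono (mem_minPrimes.1 hP).1.2⟩
          (Ideal.map_le_iff_le_comap.2 hPq)
    · rintro ⟨P, hP, rfl⟩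
      refine ⟨⟨(E P).2, Ideal.map_mono hP.1.2⟩, ?_⟩
      rintro J ⟨hJ1, hJ2⟩ hJP
      have h1 : J.comap ψ ≤ P.asIdeal := by
        rw [← (hprime _ P.2).2]
        exact Ideal.comap_mono hJP
      have h2 := hP.2 ⟨Ideal.comap_isPrime ψ J, Ideal.map_le_iff_le_comap.1 hJ2⟩ h1
      exact Ideal.map_le_iff_le_comap.2 h2
  have hsub : (pullbackPrime φ p).support ⊆ minPrimes (p.asIdeal.map φ) := fun x hx =>
    mem_minPrimes_of_mem_support hx
  rw [pullback_apply_of_subset ψ _ _ hsub, pullbackPrime_apply (ψ.comp φ)]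
  have hψ : ∀ P : PrimeSpectrum B, pullbackPrime ψ P q = if E P = q then 1 else 0 := by
    intro P
    rw [pullbackPrime_of_isPrime ψ P (hprime _ P.2).1, Finsupp.single_apply]
  simp only [hψ, mul_ite, mul_one, mul_zero]
  split_ifs with hq
  · obtain ⟨P, hP, rfl⟩ := (hmin q).1 hq
    rw [Finset.sum_eq_single_of_mem P hP]
    · rw [if_pos rfl, pullbackPrime_apply, if_pos hP]
      rw [← Ideal.map_map, ← length_quotient_map_of_flat hflat P (E P) rfl (hprime _ P.2).2.symm,
        Ideal.map_map, RingHom.comp_assoc]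
    · intro P' _ hne
      rw [if_neg (fun h => hne (hEinj h))]
  · refine Finset.sum_eq_zero fun P hP => ?_
    rw [if_neg (fun h => hq ((hmin q).2 ⟨P, hP, h⟩))]

end pullback

open TopologicalSpace Topology

/-! ### Irreducible closed subsets of subspaces -/

section topology

lemma isIrreducible_preimage_of_isInducing {T T' : Type*} [TopologicalSpace T]
    [TopologicalSpace T'] {ι : T → T'} (hι : IsInducing ι) {C : Set T}
    (hC : IsIrreducible (ι '' C)) : IsIrreducible C := by
  refine ⟨Set.image_nonempty.1 hC.1, fun U V hU hV hCU hCV => ?_⟩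
  obtain ⟨U', hU', rfl⟩ := hι.isOpen_iff.1 hU
  obtain ⟨V', hV', rfl⟩ := hι.isOpen_iff.1 hV
  obtain ⟨_, ⟨x, hx, rfl⟩, hxU, hxV⟩ := hC.2 U' V' hU' hV'
    (hCU.elim fun x hx => ⟨ι x, ⟨x, hx.1, rfl⟩, hx.2⟩)
    (hCV.elim fun x hx => ⟨ι x, ⟨x, hx.1, rfl⟩, hx.2⟩)
  exact ⟨x, hx, hxU, hxV⟩

/-- Taking images turns chains of irreducible closed subsets of `T` into such chains in `T'`, so
coheights can only grow. This transfers codimension bounds from a face to the surrounding cube. -/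
lemma codim_le_coheight_of_isClosedEmbedding {T T' : Type*} [TopologicalSpace T]
    [TopologicalSpace T'] {ι : T → T'} (hι : IsClosedEmbedding ι) {Z : Set T}
    (C : IrreducibleCloseds T') (hC : (C : Set T') ⊆ Set.range ι) (hZ : ι ⁻¹' C ⊆ Z) :
    codim T Z ≤ Order.coheight C := by
  let m : IrreducibleCloseds T → IrreducibleCloseds T' := fun D =>
    ⟨ι '' D, D.isIrreducible.image ι hι.continuous.continuousOn, hι.isClosedMap _ D.isClosed⟩
  have hm : StrictMono m := by
    refine strictMono_of_le_iff_le fun D D' => ?_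
    change (D : Set T) ⊆ D' ↔ ι '' (D : Set T) ⊆ ι '' D'
    exact (Set.image_subset_image_iff hι.injective).symm
  have him : ι '' (ι ⁻¹' C) = C := Set.image_preimage_eq_of_subset hC
  have hirr : IsIrreducible (ι ⁻¹' (C : Set T')) :=
    isIrreducible_preimage_of_isInducing hι.isInducing (by rw [him]; exact C.isIrreducible)
  let D : IrreducibleCloseds T := ⟨ι ⁻¹' C, hirr, C.isClosed.preimage hι.continuous⟩
  have hD : m D = C := IrreducibleCloseds.ext him
  rw [← hD]
  exact (iInf₂_le D hZ).trans (Order.coheight_le_coheight_apply_of_strictMono m hm D)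

lemma natCast_le_coheight {α : Type*} [Preorder α] (f : ℕ → α) (m : ℕ)
    (h : ∀ i < m, f (i + 1) < f i) : (m : ℕ∞) ≤ Order.coheight (f m) := by
  induction m with
  | zero => simp
  | succ m ih =>
    have h1 := ih fun i hi => h i (by omega)
    calc ((m + 1 : ℕ) : ℕ∞) = m + 1 := by push_cast; rfl
      _ ≤ Order.coheight (f m) + 1 := by gcongr
      _ ≤ _ := Order.coheight_add_one_le (h m (by omega))

lemma coheight_le_of_strictMono {α : Type*} [Preorder α] (d : α → ℕ) (hd : StrictMono d) (m : ℕ)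
    (hm : ∀ x, d x ≤ m) (x : α) : Order.coheight x ≤ ((m - d x : ℕ) : ℕ∞) := by
  refine Order.coheight_le fun l hl => ?_
  have h1 := LTSeries.head_add_length_le_nat (l.map d hd)
  have h2 := hm l.last
  simp only [LTSeries.head_map, LTSeries.last_map, LTSeries.map_length, hl] at h1
  exact_mod_cast (by omega)

/-- A constructible set that is dense in the closure of a point contains a neighbourhood of this
point in its closure. -/
lemma exists_open_inter_closure_subset {X : Type*} [TopologicalSpace X] {W : Set X}
    (hW : IsConstructible W) (s : X) (hs : s ∈ closure (W ∩ closure {s})) :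
    ∃ U : Set X, IsOpen U ∧ s ∈ U ∧ U ∩ closure {s} ⊆ W := by
  -- A constructible set either contains or misses a neighbourhood of `s` in its closure. This
  -- dichotomy is stable under complements and unions; density then rules out the second
  -- alternative.
  have key : (∃ U : Set X, IsOpen U ∧ s ∈ U ∧ U ∩ closure {s} ⊆ W) ∨
      (∃ U : Set X, IsOpen U ∧ s ∈ U ∧ U ∩ closure {s} ⊆ Wᶜ) := by
    clear hs
    induction hW using IsConstructible.empty_union_induction with
    | open_retrocompact U hU _ =>
      by_cases h : s ∈ U
      · exact Or.inl ⟨U, hU, h, Set.inter_subset_left⟩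
      · refine Or.inr ⟨Set.univ, isOpen_univ, Set.mem_univ _, fun x hx hxU => h ?_⟩
        exact (specializes_iff_mem_closure.2 hx.2).mem_open hU hxU
    | union W₁ _ W₂ _ h₁ h₂ =>
      rcases h₁ with ⟨U, hU, hsU, h⟩ | ⟨U, hU, hsU, h⟩
      · exact Or.inl ⟨U, hU, hsU, h.trans Set.subset_union_left⟩
      · rcases h₂ with ⟨U', hU', hsU', h'⟩ | ⟨U', hU', hsU', h'⟩
        · exact Or.inl ⟨U', hU', hsU', h'.trans Set.subset_union_right⟩
        · refine Or.inr ⟨U ∩ U', hU.inter hU', ⟨hsU, hsU'⟩, ?_⟩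
          rintro x ⟨⟨hx, hx'⟩, hxs⟩
          rw [Set.compl_union]
          exact ⟨h ⟨hx, hxs⟩, h' ⟨hx', hxs⟩⟩
    | compl W _ h =>
      rw [compl_compl]
      exact h.symm
  refine key.resolve_right ?_
  rintro ⟨U, hU, hsU, h⟩
  obtain ⟨x, hxU, hxW, hxs⟩ := mem_closure_iff.1 hs U hU hsU
  exact h ⟨hxU, hxs⟩ hxW

end topology

/-! ### Generic points of closed subsets of subspaces of a spectrum. -/

section spectrum

variable {A : Type v} [CommRing A]

/-- The generic point (in the spectrum) of an irreducible closed subset of a subspace. -/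
lemma exists_generic {Y : Set (PrimeSpectrum A)} (C : IrreducibleCloseds Y) :
    ∃ c : PrimeSpectrum A, closure (Subtype.val '' (C : Set Y)) = closure {c} ∧
      ∀ y : Y, y ∈ (C : Set Y) ↔ c ≤ y := by
  have hirr := C.isIrreducible.image Subtype.val continuous_subtype_val.continuousOn
  have hgen : closure {hirr.genericPoint} = closure (Subtype.val '' (C : Set Y)) :=
    hirr.isGenericPoint_genericPoint_closure
  refine ⟨hirr.genericPoint, hgen.symm, fun y => ?_⟩
  rw [PrimeSpectrum.le_iff_mem_closure, hgen]
  rw [← closure_subtype, C.isClosed.closure_eq]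

lemma mem_of_isClosed_of_closure_eq {Y : Set (PrimeSpectrum A)} {C : Set Y} {c : PrimeSpectrum A}
    (hc : closure (Subtype.val '' C) = closure {c}) {Z : Set (PrimeSpectrum A)} (hZ : IsClosed Z)
    (hCZ : ∀ y ∈ C, (y : PrimeSpectrum A) ∈ Z) : c ∈ Z := by
  have h1 : closure {c} ⊆ Z := by
    rw [← hc]
    refine closure_minimal ?_ hZ
    rintro _ ⟨y, hy, rfl⟩
    exact hCZ y hy
  exact h1 (subset_closure rfl)

/-- The generic point `c` is taken in the whole spectrum and could lie outside the subspace. For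
constructible `W` it does not: the image of `C` is dense in the closure of `f c`, and a
constructible set dense there contains `f c`. -/
lemma mem_of_isConstructible_of_closure_eq {Y : Set (PrimeSpectrum A)} {C : Set Y}
    {c : PrimeSpectrum A} (hc : closure (Subtype.val '' C) = closure {c}) {X : Type*}
    [TopologicalSpace X] {f : PrimeSpectrum A → X} (hf : Continuous f) {W : Set X}
    (hW : IsConstructible W) (hCW : ∀ y ∈ C, f y ∈ W) : f c ∈ W := by
  have hsub : Subtype.val '' C ⊆ f ⁻¹' (W ∩ closure {f c}) := by
    rintro _ ⟨y, hy, rfl⟩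
    refine ⟨hCW y hy, ?_⟩
    have h1 : (y : PrimeSpectrum A) ∈ closure {c} := hc ▸ subset_closure ⟨y, hy, rfl⟩
    exact specializes_iff_mem_closure.1 ((specializes_iff_mem_closure.2 h1).map hf)
  have h2 : c ∈ closure (f ⁻¹' (W ∩ closure {f c})) :=
    closure_mono hsub (hc ▸ subset_closure rfl)
  have h3 : f c ∈ closure (W ∩ closure {f c}) := closure_mono (Set.image_preimage_subset f _)
    (image_closure_subset_closure_image hf ⟨c, h2, rfl⟩)
  obtain ⟨U, hU, hcU, hUW⟩ := exists_open_inter_closure_subset hW (f c) h3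
  exact hUW ⟨hcU, subset_closure rfl⟩

/-- The closure of a point in a subspace of the spectrum. -/
def closureIn (Y : Set (PrimeSpectrum A)) (y : Y) : IrreducibleCloseds Y :=
  ⟨closure {y}, isIrreducible_singleton.closure, isClosed_closure⟩

lemma mem_closureIn {Y : Set (PrimeSpectrum A)} (y z : Y) :
    z ∈ (closureIn Y y : Set Y) ↔ (y : PrimeSpectrum A) ≤ z := by
  change z ∈ closure {y} ↔ _
  rw [← specializes_iff_mem_closure, subtype_specializes_iff, PrimeSpectrum.le_iff_specializes]

/-- The closures in `Y` of the points of a chain of successive specializations decrease strictly,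
and the last of them is `C`, whose points are the specializations of `c`. -/
lemma natCast_le_coheight_of_chain {Y : Set (PrimeSpectrum A)} (C : IrreducibleCloseds Y)
    {c : PrimeSpectrum A} (hC : ∀ y : Y, y ∈ (C : Set Y) ↔ c ≤ y) (m : ℕ)
    (f : ℕ → PrimeSpectrum A) (hfm : f m = c) (hf : ∀ i < m, f i < f (i + 1))
    (hY : ∀ i ≤ m, f i ∈ Y) : (m : ℕ∞) ≤ Order.coheight C := by
  classical
  let F : ℕ → IrreducibleCloseds Y := fun i =>
    if h : i ≤ m then closureIn Y ⟨f i, hY i h⟩ else C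
  have hFm : F m = C := by
    refine IrreducibleCloseds.ext (Set.ext fun y => ?_)
    simp only [F, dif_pos le_rfl, mem_closureIn, hC, hfm]
  rw [← hFm]
  refine natCast_le_coheight F m fun i hi => ?_
  simp only [F, dif_pos hi.le, dif_pos (show i + 1 ≤ m from hi)]
  refine lt_of_le_not_ge ?_ ?_
  · intro y hy
    have h1 := (mem_closureIn _ _).1 hy
    exact (mem_closureIn _ _).2 ((hf i hi).le.trans h1)
  · intro h
    have h1 := h ((mem_closureIn ⟨f i, hY i hi.le⟩ ⟨f i, hY i hi.le⟩).2 le_rfl)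
    exact absurd ((mem_closureIn _ _).1 h1) (not_le_of_gt (hf i hi))

end spectrum

/-! ### Codimension conditions as inequalities between dimensions. -/

section

variable {S : Type v} [CommRing S]

lemma mem_faceLocus {n : ℕ} {F : Face n} {P : PrimeSpectrum (CubeRing S n)} :
    P ∈ faceLocus S F ↔ ∀ (i : Fin n) (ε : Fin 2), F i = some ε →
      (MvPolynomial.X i - MvPolynomial.C ((ε : ℕ) : S) : CubeRing S n) ∈ P.asIdeal := by
  rw [faceLocus, PrimeSpectrum.mem_zeroLocus]
  constructor
  · exact fun h i ε hF => h ⟨i, ε, hF, rfl⟩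
  · rintro h _ ⟨i, ε, hF, rfl⟩
    exact h i ε hF

lemma mem_primeSupport {n : ℕ} {p P : PrimeSpectrum (CubeRing S n)} :
    P ∈ primeSupport p ↔ p ≤ P := by
  rw [primeSupport, PrimeSpectrum.mem_zeroLocus]
  rfl

lemma isClosed_faceLocus {n : ℕ} (F : Face n) : IsClosed (faceLocus S F) :=
  PrimeSpectrum.isClosed_zeroLocus _

lemma isClosed_primeSupport {n : ℕ} (p : PrimeSpectrum (CubeRing S n)) :
    IsClosed (primeSupport p) :=
  PrimeSpectrum.isClosed_zeroLocus _

lemma mem_faceLocus_of_le {n : ℕ} {F : Face n} {P Q : PrimeSpectrum (CubeRing S n)}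
    (h : P ∈ faceLocus S F) (hPQ : P ≤ Q) : Q ∈ faceLocus S F :=
  mem_faceLocus.2 fun i ε hF => hPQ (mem_faceLocus.1 h i ε hF)

lemma card_isNone_add_codim {n : ℕ} (F : Face n) :
    Fintype.card {i // (F i).isNone} + F.codim = n := by
  rw [Fintype.card_subtype, Face.codim]
  have h := Finset.card_filter_add_card_filter_not (s := (Finset.univ : Finset (Fin n)))
    (fun i => (F i).isNone)
  rw [Finset.card_univ, Fintype.card_fin] at h
  convert h using 4
  simp [Option.isSome_iff_ne_none]

lemma chain_le {α : Type*} [Preorder α] {f : ℕ → α} {m : ℕ} (hf : ∀ i < m, f i < f (i + 1)) :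
    ∀ i ≤ m, f 0 ≤ f i := by
  intro i
  induction i with
  | zero => exact fun _ => le_rfl
  | succ i ih => exact fun hi => (ih (by omega)).trans (hf i (by omega)).le

variable {R : Type v} [CommRing R] [IsDomain R] [IsNoetherianRing S] [Algebra R S]
  [Algebra.FiniteType R S]

instance (n : ℕ) : Algebra.FiniteType R (CubeRing S n) :=
  Algebra.FiniteType.trans (S := S) inferInstance inferInstance

/-- All points of V(p) lie over the generic point of Spec R, so codimension in V(p) is a difference
of dimensions. The dimension of generic points is strictly monotone on irreducible closed subsets,
which bounds coheights from above; chains of primes of maximal length bound them from below. -/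
lemma faceCondition_iff {n : ℕ} {p : PrimeSpectrum (CubeRing S n)}
    (hp : ∀ Q, p ≤ Q → Q.asIdeal.comap (algebraMap R (CubeRing S n)) = ⊥) :
    FaceCondition p ↔ ∀ (F : Face n) (Q : PrimeSpectrum (CubeRing S n)), p ≤ Q →
      Q ∈ faceLocus S F → pdim R Q.asIdeal + F.codim ≤ pdim R p.asIdeal := by
  constructor
  · intro h F Q hpQ hQF
    choose gen hgen1 hgen2 using
      fun C : IrreducibleCloseds (primeSupport p) => exists_generic C
    have hgenp : ∀ C, p ≤ gen C := fun C => mem_primeSupport.1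
      (mem_of_isClosed_of_closure_eq (hgen1 C) (isClosed_primeSupport p) fun y _ => y.2)
    have hself : ∀ C : IrreducibleCloseds (primeSupport p),
        (⟨gen C, mem_primeSupport.2 (hgenp C)⟩ : primeSupport p) ∈ (C : Set (primeSupport p)) := fun C => (hgen2 C _).2 le_rfl
    let d : IrreducibleCloseds (primeSupport p) → ℕ := fun C => pdim R (gen C).asIdeal
    have hd : StrictMono d := by
      intro C C' hCC'
      have h1 : gen C' ≤ gen C := (hgen2 C' ⟨gen C, _⟩).1 (hCC'.le (hself C))
      have h2 : gen C' ≠ gen C := by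
        intro heq
        refine hCC'.not_ge fun y hy => (hgen2 C y).2 ?_
        rw [← heq]
        exact (hgen2 C' y).1 hy
      exact pdim_lt (lt_of_le_of_ne h1 fun h => h2 (PrimeSpectrum.ext h)) (hp _ (hgenp C))
    let C := closureIn (primeSupport p) ⟨Q, mem_primeSupport.2 hpQ⟩
    have hCQ : gen C = Q := by
      refine le_antisymm ?_ ?_
      · exact (hgen2 C ⟨Q, mem_primeSupport.2 hpQ⟩).1 ((mem_closureIn _ _).2 le_rfl)
      · exact (mem_closureIn ⟨Q, mem_primeSupport.2 hpQ⟩ _).1 (hself C)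
    have h1 : (F.codim : ℕ∞) ≤ Order.coheight C := (h F).trans (iInf₂_le C fun y hy =>
      mem_faceLocus_of_le hQF ((mem_closureIn _ y).1 hy))
    have h2 := h1.trans (coheight_le_of_strictMono d hd (pdim R p.asIdeal)
      (fun C => pdim_le_of_le (hgenp C)) C)
    have h3 : F.codim ≤ pdim R p.asIdeal - pdim R (gen C).asIdeal := by exact_mod_cast h2
    rw [hCQ] at h3
    have h4 : pdim R Q.asIdeal ≤ pdim R p.asIdeal := pdim_le_of_le hpQ
    omega
  · intro h F
    refine le_iInf₂ fun C hC => ?_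
    obtain ⟨c, hc1, hc2⟩ := exists_generic C
    have hpc : p ≤ c := mem_primeSupport.1
      (mem_of_isClosed_of_closure_eq hc1 (isClosed_primeSupport p) fun y _ => y.2)
    have hcF : c ∈ faceLocus S F :=
      mem_of_isClosed_of_closure_eq hc1 (isClosed_faceLocus F) fun y hy => hC hy
    have h1 := h F c hpc hcF
    -- Nothing has to be avoided here, so the function is `1`; only the length of the chain matters.
    obtain ⟨f, hf0, hfm, hf⟩ := exists_chain_avoiding (R := R) (1 : CubeRing S n)
      (pdim R p.asIdeal - pdim R c.asIdeal) p c hpc (hp c hpc)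
      ((Ideal.ne_top_iff_one _).1 p.2.ne_top) (by omega)
    have h2 := natCast_le_coheight_of_chain C hc2 _ f hfm (fun i hi => (hf i hi).1) fun i hi => by
      rw [mem_primeSupport, ← hf0]
      exact chain_le (fun i hi => (hf i hi).1) i hi
    exact le_trans (by exact_mod_cast (by omega)) h2

/-- The generic point of `W × F`, where `ω` is the generic point of `W`. -/
lemma exists_generic_prodFace {n : ℕ} (ω : PrimeSpectrum S)
    (hω : ω.asIdeal.comap (algebraMap R S) = ⊥) (F : Face n) :
    ∃ η : PrimeSpectrum (CubeRing S n),
      η ∈ faceLocus S F ∧ PrimeSpectrum.comap (MvPolynomial.C : S →+* CubeRing S n) η = ω ∧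
      (∀ c, ω ≤ PrimeSpectrum.comap (MvPolynomial.C : S →+* CubeRing S n) c → c ∈ faceLocus S F →
        η ≤ c) ∧ pdim R η.asIdeal + F.codim = pdim R ω.asIdeal + n := by
  classical
  let σ := {i // (F i).isNone}
  -- The restriction of functions to the integral scheme V(ω) × F, whose kernel is the sought
  -- generic point. The default value of `getD` never enters, since that branch requires `F i` to be
  -- prescribed.
  let θ : CubeRing S n →ₐ[S] MvPolynomial σ (S ⧸ ω.asIdeal) := MvPolynomial.aeval fun i =>
    if h : (F i).isNone then MvPolynomial.X ⟨i, h⟩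
    else MvPolynomial.C ((((F i).getD 0 : Fin 2) : ℕ) : S ⧸ ω.asIdeal)
  have hθX : ∀ i, θ (MvPolynomial.X i) = if h : (F i).isNone then MvPolynomial.X ⟨i, h⟩
    else MvPolynomial.C ((((F i).getD 0 : Fin 2) : ℕ) : S ⧸ ω.asIdeal) := fun i => by simp [θ]
  have hθC : ∀ a : S, θ (MvPolynomial.C a) = MvPolynomial.C (Ideal.Quotient.mk ω.asIdeal a) :=
    fun a => by
      rw [← MvPolynomial.algebraMap_eq, AlgHom.commutes]
      rfl
  have hprime : (RingHom.ker θ).IsPrime := RingHom.ker_isPrime θ.toRingHom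
  have hsurj : Function.Surjective θ := by
    intro x
    induction x using MvPolynomial.induction_on with
    | C a =>
      obtain ⟨a, rfl⟩ := Ideal.Quotient.mk_surjective a
      exact ⟨MvPolynomial.C a, hθC a⟩
    | add x y hx hy =>
      obtain ⟨x, rfl⟩ := hx
      obtain ⟨y, rfl⟩ := hy
      exact ⟨x + y, map_add _ _ _⟩
    | mul_X x i hx =>
      obtain ⟨x, rfl⟩ := hx
      refine ⟨x * MvPolynomial.X i.1, ?_⟩
      rw [map_mul, hθX, dif_pos i.2]
  have hinj := (injective_algebraMap_quotient_iff ω.asIdeal).2 hω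
  have : FaithfulSMul R (S ⧸ ω.asIdeal) := (faithfulSMul_iff_algebraMap_injective _ _).2 hinj
  refine ⟨⟨RingHom.ker θ, hprime⟩, ?_, ?_, ?_, ?_⟩
  · rw [mem_faceLocus]
    intro i ε hF
    change θ _ = 0
    rw [map_sub, hθX, hθC, dif_neg (by simp [hF]), hF]
    simp
  · refine PrimeSpectrum.ext ?_
    ext a
    change θ (MvPolynomial.C a) = 0 ↔ _
    rw [hθC, MvPolynomial.C_eq_zero, Ideal.Quotient.eq_zero_iff_mem]
  · intro c hc hcF
    let β : S ⧸ ω.asIdeal →+* CubeRing S n ⧸ c.asIdeal :=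
      Ideal.Quotient.lift ω.asIdeal ((Ideal.Quotient.mk c.asIdeal).comp MvPolynomial.C)
        fun a ha => Ideal.Quotient.eq_zero_iff_mem.2 (hc ha)
    -- A point of F over V(ω) factors through the coordinate ring of V(ω) × F, so its ideal contains
    -- the kernel of `θ`.
    let γ : MvPolynomial σ (S ⧸ ω.asIdeal) →+* CubeRing S n ⧸ c.asIdeal :=
      MvPolynomial.eval₂Hom β fun i => Ideal.Quotient.mk c.asIdeal (MvPolynomial.X i.1)
    have hγ : γ.comp θ.toRingHom = Ideal.Quotient.mk c.asIdeal := by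
      refine MvPolynomial.ringHom_ext (fun a => ?_) fun i => ?_
      · change γ (θ _) = _
        rw [hθC]
        simp [γ, β]
      · change γ (θ _) = _
        rw [hθX]
        split_ifs with h
        · simp [γ]
        · obtain ⟨ε, hε⟩ := Option.ne_none_iff_exists'.1 (by simpa using h : F i ≠ none)
          have h1 := Ideal.Quotient.eq_zero_iff_mem.2 (mem_faceLocus.1 hcF i ε hε)
          rw [map_sub, sub_eq_zero] at h1
          rw [h1, hε]
          simp [γ]
    intro x hx
    have hx' : θ x = 0 := hx
    rw [← Ideal.Quotient.eq_zero_iff_mem, ← hγ]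
    change γ (θ x) = 0
    rw [hx', map_zero]
  · have h1 : pdim R (RingHom.ker θ) = tdeg R (MvPolynomial σ (S ⧸ ω.asIdeal)) :=
      tdeg_congr (Ideal.quotientKerAlgEquivOfSurjective
        (f := (θ.restrictScalars R)) hsurj)
    change pdim R (RingHom.ker θ) + _ = _
    rw [h1, tdeg_mvPolynomial, add_assoc, card_isNone_add_codim]
    rfl

/-- A maximal chain from the generic point of V(ω) × F down to `c` can be chosen to avoid `g = 0`
before its end. Outside `g = 0` the closure of W lies in W, so the chain stays in W × F and
witnesses the codimension there even though W is only constructible. -/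
lemma natCast_le_coheight_prodFace {W : Set (PrimeSpectrum S)} {ω : PrimeSpectrum S}
    (hω : ω.asIdeal.comap (algebraMap R S) = ⊥) {g : S} (hg : g ∉ ω.asIdeal)
    (hgW : ∀ s : PrimeSpectrum S, ω ≤ s → g ∉ s.asIdeal → s ∈ W) {n : ℕ} {F : Face n}
    (C : IrreducibleCloseds (prodFace W F)) {c : PrimeSpectrum (CubeRing S n)}
    (hC : ∀ y : prodFace W F, y ∈ (C : Set (prodFace W F)) ↔ c ≤ y)
    (hc0 : c.asIdeal.comap (algebraMap R (CubeRing S n)) = ⊥) (hc : c ∈ prodFace W F)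
    (hωc : ω ≤ PrimeSpectrum.comap (MvPolynomial.C : S →+* CubeRing S n) c) (r : ℕ)
    (hr : pdim R c.asIdeal + r + F.codim ≤ pdim R ω.asIdeal + n) :
    (r : ℕ∞) ≤ Order.coheight C := by
  obtain ⟨η, hηF, hηω, hη, hdim⟩ := exists_generic_prodFace ω hω F
  obtain ⟨f, hf0, hfm, hf⟩ := exists_chain_avoiding (R := R) (MvPolynomial.C g : CubeRing S n)
    (pdim R η.asIdeal - pdim R c.asIdeal) η c (hη c hωc hc.2) hc0
    (by
      rw [← hηω] at hg
      exact hg) (by omega)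
  have h2 := natCast_le_coheight_of_chain C hC _ f hfm (fun i hi => (hf i hi).1) fun i hi => by
    rcases hi.lt_or_eq with hi | rfl
    · have h1 : η ≤ f i := hf0 ▸ chain_le (fun i hi => (hf i hi).1) i hi.le
      refine ⟨hgW _ ?_ (hf i hi).2, mem_faceLocus_of_le hηF h1⟩
      rw [← hηω]
      exact Ideal.comap_mono h1
    · rw [hfm]
      exact hc
  exact le_trans (by exact_mod_cast (by omega)) h2

end

/-! ### Polynomial extensions -/

section polynomialExtension

variable {B C : Type v} [CommRing B] [CommRing C]

/-- `ψ` identifies `C` with the polynomial ring in `t` over `B`. -/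
def IsPolynomialExtension (ψ : B →+* C) (t : C) : Prop :=
  Function.Bijective (Polynomial.eval₂RingHom ψ t)

namespace IsPolynomialExtension

variable {ψ : B →+* C} {t : C} (h : IsPolynomialExtension ψ t)

/-- The isomorphism with the polynomial ring. -/
def equiv : Polynomial B ≃+* C := RingEquiv.ofBijective _ h

lemma equiv_C (b : B) : h.equiv (Polynomial.C b) = ψ b := by
  simp [equiv, RingEquiv.ofBijective]

lemma equiv_comp_C : (h.equiv : Polynomial B →+* C).comp Polynomial.C = ψ :=
  RingHom.ext h.equiv_C

include h in
lemma flat : ψ.Flat := by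
  rw [← h.equiv_comp_C]
  refine RingHom.Flat.comp ?_ (.of_bijective h.equiv.bijective)
  have : Module.Flat B (Polynomial B) := inferInstance
  rw [← Polynomial.algebraMap_eq]
  exact (RingHom.flat_algebraMap_iff).2 this

include h in
lemma isPrime_map (P : Ideal B) (hP : P.IsPrime) :
    (P.map ψ).IsPrime ∧ (P.map ψ).comap ψ = P := by
  have h1 : P.map ψ = (P.map Polynomial.C).map (h.equiv : Polynomial B →+* C) := by
    rw [Ideal.map_map, h.equiv_comp_C]
  constructor
  · rw [h1]
    have := Ideal.isPrime_map_C_of_isPrime (P := P)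
    exact Ideal.map_isPrime_of_equiv h.equiv
  · have h2 : ∀ I : Ideal (Polynomial B), (I.map (h.equiv : Polynomial B →+* C)).comap
        (h.equiv : Polynomial B →+* C) = I := fun I =>
      Ideal.comap_map_of_bijective _ h.equiv.bijective
    have h3 : (P.map ψ).comap ψ =
        ((P.map ψ).comap (h.equiv : Polynomial B →+* C)).comap Polynomial.C := by
      rw [Ideal.comap_comap, h.equiv_comp_C]
    rw [h3, h1, h2]
    ext x
    rw [Ideal.mem_comap, Ideal.mem_map_C_iff]
    constructor
    · intro hx
      simpa using hx 0
    · intro hx m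
      rw [Polynomial.coeff_C]
      split_ifs
      · exact hx
      · exact zero_mem _

include h in
lemma exists_eq_eval₂ (x : C) : ∃ f : Polynomial B, f.eval₂ ψ t = x :=
  h.2 x

variable {R : Type v} [CommRing R] [IsDomain R] [Algebra R B] [Algebra R C]
  [Algebra.FiniteType R B] [Algebra.FiniteType R C]

include h in
lemma pdim_map (hψ : ψ.comp (algebraMap R B) = algebraMap R C) (P : Ideal B) [hP : P.IsPrime]
    (hP0 : P.comap (algebraMap R B) = ⊥) : pdim R (P.map ψ) = pdim R P + 1 := by
  have : FaithfulSMul R (B ⧸ P) := (faithfulSMul_iff_algebraMap_injective _ _).2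
    ((injective_algebraMap_quotient_iff P).2 hP0)
  let f : C →+* Polynomial (B ⧸ P) :=
    (Polynomial.mapRingHom (Ideal.Quotient.mk P)).comp (h.equiv.symm : C →+* Polynomial B)
  have hfψ : ∀ b, f (ψ b) = Polynomial.C (Ideal.Quotient.mk P b) := fun b => by
    change Polynomial.map _ (h.equiv.symm (ψ b)) = _
    rw [← h.equiv_C, RingEquiv.symm_apply_apply, Polynomial.map_C]
  let F : C →ₐ[R] Polynomial (B ⧸ P) :=
    { f with
      commutes' := fun a => by
        change f (algebraMap R C a) = _
        rw [← hψ]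
        exact hfψ _ }
  have hsurj : Function.Surjective F :=
    (Polynomial.map_surjective _ Ideal.Quotient.mk_surjective).comp h.equiv.symm.surjective
  have hker : P.map ψ = RingHom.ker F := by
    change P.map ψ = RingHom.ker f
    rw [← RingHom.comap_ker, Polynomial.ker_mapRingHom, Ideal.mk_ker]
    change _ = Ideal.comap h.equiv.symm _
    rw [Ideal.comap_symm]
    change _ = Ideal.map (h.equiv : Polynomial B →+* C) _
    rw [Ideal.map_map, h.equiv_comp_C]
  change _ = tdeg R (B ⧸ P) + 1
  rw [hker, ← tdeg_polynomial (R := R) (D := B ⧸ P)]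
  exact tdeg_congr (Ideal.quotientKerAlgEquivOfSurjective hsurj)

lemma _root_.ModulusCycles.comap_algebraMap_comap (hψ : ψ.comp (algebraMap R B) = algebraMap R C)
    (Q : Ideal C) : (Q.comap ψ).comap (algebraMap R B) = Q.comap (algebraMap R C) := by
  rw [Ideal.comap_comap, hψ]

include h in
lemma pdim_le_comap_add_one (hψ : ψ.comp (algebraMap R B) = algebraMap R C) (Q : Ideal C)
    [hQ : Q.IsPrime] (hQ0 : Q.comap (algebraMap R C) = ⊥) :
    pdim R Q ≤ pdim R (Q.comap ψ) + 1 := by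
  have hQB := (comap_algebraMap_comap hψ Q).trans hQ0
  have := (h.isPrime_map (Q.comap ψ) inferInstance).1
  rw [← h.pdim_map hψ (Q.comap ψ) hQB]
  exact pdim_le_of_le Ideal.map_comap_le

include h in
-- Modulo `Q` the variable `t` equals an element of `B`, so `B` already maps onto `C ⧸ Q`.
lemma pdim_le_comap (hψ : ψ.comp (algebraMap R B) = algebraMap R C) (Q : Ideal C)
    [Q.IsPrime] {b : B} (hb : t - ψ b ∈ Q) : pdim R Q ≤ pdim R (Q.comap ψ) := by
  let f : B →+* C ⧸ Q := (Ideal.Quotient.mk Q).comp ψ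
  let F : B →ₐ[R] C ⧸ Q :=
    { f with
      commutes' := fun a => by
        change f (algebraMap R B a) = _
        change Ideal.Quotient.mk Q ((ψ.comp (algebraMap R B)) a) = _
        rw [hψ]
        rfl }
  have hsurj : Function.Surjective F := by
    intro x
    obtain ⟨x, rfl⟩ := Ideal.Quotient.mk_surjective x
    obtain ⟨p, rfl⟩ := h.exists_eq_eval₂ x
    refine ⟨p.eval b, ?_⟩
    change Ideal.Quotient.mk Q (ψ (p.eval b)) = _
    have ht : Ideal.Quotient.mk Q t = Ideal.Quotient.mk Q (ψ b) := Ideal.Quotient.eq.2 hb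
    rw [Polynomial.hom_eval₂, ht]
    exact (Polynomial.eval₂_at_apply ((Ideal.Quotient.mk Q).comp ψ) b).symm
  have hker : Q.comap ψ = RingHom.ker F := by
    change _ = RingHom.ker f
    rw [← RingHom.comap_ker, Ideal.mk_ker]
  rw [hker]
  exact (tdeg_congr (Ideal.quotientKerAlgEquivOfSurjective hsurj)).ge

end IsPolynomialExtension

/-- Dimensions do not change under the closed immersion given by a surjection. -/
lemma pdim_comap_of_surjective {R : Type v} [CommRing R] [IsDomain R] [Algebra R B] [Algebra R C]
    {φ : B →+* C} (hφ : Function.Surjective φ) (hφR : φ.comp (algebraMap R B) = algebraMap R C)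
    (Q : Ideal C) : pdim R (Q.comap φ) = pdim R Q := by
  let F : B →ₐ[R] C ⧸ Q :=
    { (Ideal.Quotient.mk Q).comp φ with
      commutes' := fun a => by
        change Ideal.Quotient.mk Q ((φ.comp (algebraMap R B)) a) = _
        rw [hφR]
        rfl }
  have hsurj : Function.Surjective F := Ideal.Quotient.mk_surjective.comp hφ
  have hker : Q.comap φ = RingHom.ker F := by
    change _ = RingHom.ker ((Ideal.Quotient.mk Q).comp φ)
    rw [← RingHom.comap_ker, Ideal.mk_ker]
  rw [hker]
  exact tdeg_congr (Ideal.quotientKerAlgEquivOfSurjective hsurj)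

end polynomialExtension

/-! ### Faces -/

section faces

variable {S : Type v} [CommRing S] {n : ℕ}

@[simp]
lemma faceMap_C (i : Fin (n + 1)) (ε : Fin 2) (a : S) :
    faceMap S i ε (MvPolynomial.C a) = MvPolynomial.C a := by
  change MvPolynomial.aeval _ _ = _
  rw [MvPolynomial.aeval_C]
  rfl

@[simp]
lemma faceMap_X_same (i : Fin (n + 1)) (ε : Fin 2) :
    faceMap S i ε (MvPolynomial.X i) = MvPolynomial.C ((ε : ℕ) : S) := by
  change MvPolynomial.aeval _ _ = _
  rw [MvPolynomial.aeval_X, Fin.insertNth_apply_same]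

@[simp]
lemma faceMap_X_succAbove (i : Fin (n + 1)) (ε : Fin 2) (j : Fin n) :
    faceMap S i ε (MvPolynomial.X (i.succAbove j)) = MvPolynomial.X j := by
  change MvPolynomial.aeval _ _ = _
  rw [MvPolynomial.aeval_X, Fin.insertNth_apply_succAbove]

@[simp]
lemma degeneracyMap_C (i : Fin (n + 1)) (a : S) :
    degeneracyMap S i (MvPolynomial.C a) = MvPolynomial.C a :=
  MvPolynomial.rename_C _ _

@[simp]
lemma degeneracyMap_X (i : Fin (n + 1)) (j : Fin n) :
    degeneracyMap S i (MvPolynomial.X j) = MvPolynomial.X (i.succAbove j) :=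
  MvPolynomial.rename_X _ _

lemma faceMap_comp_degeneracyMap_same (i : Fin (n + 1)) (ε : Fin 2) :
    (faceMap S i ε).comp (degeneracyMap S i) = RingHom.id _ := by
  refine MvPolynomial.ringHom_ext (fun a => ?_) fun j => ?_ <;> simp

lemma faceMap_surjective (i : Fin (n + 1)) (ε : Fin 2) : Function.Surjective (faceMap S i ε) :=
  fun x => ⟨degeneracyMap S i x, by
    rw [← RingHom.comp_apply, faceMap_comp_degeneracyMap_same, RingHom.id_apply]⟩

/-- Modulo `zᵢ - ε`, restricting to the face and pulling back along the projection is the identity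
on the variables, hence everywhere. -/
lemma ker_faceMap (i : Fin (n + 1)) (ε : Fin 2) :
    RingHom.ker (faceMap S i ε) =
      Ideal.span {MvPolynomial.X i - MvPolynomial.C ((ε : ℕ) : S)} := by
  obtain ⟨I, hI⟩ : ∃ I : Ideal (CubeRing S (n + 1)),
    I = Ideal.span {MvPolynomial.X i - MvPolynomial.C ((ε : ℕ) : S)} := ⟨_, rfl⟩
  rw [← hI]
  refine le_antisymm ?_ ?_
  · have hmk : (Ideal.Quotient.mk I).comp ((degeneracyMap S i).comp (faceMap S i ε)) =
        Ideal.Quotient.mk I := by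
      refine MvPolynomial.ringHom_ext (fun a => ?_) fun l => ?_
      · rw [RingHom.comp_apply, RingHom.comp_apply, faceMap_C, degeneracyMap_C]
      rcases Fin.eq_self_or_eq_succAbove i l with rfl | ⟨j, rfl⟩
      · rw [RingHom.comp_apply, RingHom.comp_apply, faceMap_X_same, degeneracyMap_C]
        exact (Ideal.Quotient.eq.2 (hI ▸ Ideal.subset_span rfl)).symm
      · rw [RingHom.comp_apply, RingHom.comp_apply, faceMap_X_succAbove, degeneracyMap_X]
    intro x hx
    rw [← Ideal.Quotient.eq_zero_iff_mem, ← hmk, RingHom.comp_apply, RingHom.comp_apply,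
      (RingHom.mem_ker).1 hx, map_zero, map_zero]
  · rw [hI, Ideal.span_le, Set.singleton_subset_iff, SetLike.mem_coe, RingHom.mem_ker]
    simp

/-- The cubical identity, phrased with `succAbove` and `predAbove` so that both relative positions
of the two indices are covered at once. -/
lemma faceMap_comp_faceMap (i : Fin (n + 2)) (j : Fin (n + 1)) (ε δ : Fin 2) :
    (faceMap S j δ).comp (faceMap S i ε) =
      (faceMap S (j.predAbove i) ε).comp (faceMap S (i.succAbove j) δ) := by
  have key : ∀ l, faceMap S j δ (faceMap S i ε (MvPolynomial.X l)) =
      faceMap S (j.predAbove i) ε (faceMap S (i.succAbove j) δ (MvPolynomial.X l)) := by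
    intro l
    rcases Fin.eq_self_or_eq_succAbove i l with h | ⟨l, rfl⟩
    · subst h
      have h1 := faceMap_X_succAbove (S := S) (l.succAbove j) δ (j.predAbove l)
      rw [Fin.succAbove_succAbove_predAbove] at h1
      rw [h1]
      simp
    · rw [faceMap_X_succAbove]
      rcases Fin.eq_self_or_eq_succAbove j l with rfl | ⟨k, rfl⟩
      · simp
      · rw [← Fin.succAbove_succAbove_succAbove_predAbove]
        simp
  exact MvPolynomial.ringHom_ext (fun a => by simp) key

variable {R : Type v} [CommRing R] [Algebra R S]

lemma faceMap_comp_algebraMap (i : Fin (n + 1)) (ε : Fin 2) :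
    (faceMap S i ε).comp (algebraMap R (CubeRing S (n + 1))) = algebraMap R (CubeRing S n) := by
  refine RingHom.ext fun a => ?_
  rw [RingHom.comp_apply, MvPolynomial.algebraMap_apply, MvPolynomial.algebraMap_apply, faceMap_C]

/-- The face of `□ⁿ⁺¹` corresponding to the face `F` of the hyperplane `zᵢ = ε`. -/
def Face.insert (i : Fin (n + 1)) (ε : Fin 2) (F : Face n) : Face (n + 1) :=
  i.insertNth (α := fun _ => Option (Fin 2)) (some ε) F

lemma codim_eq_sum (F : Face n) : F.codim = ∑ i, if (F i).isSome then 1 else 0 := by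
  rw [Face.codim, Finset.card_filter]

lemma codim_succAbove (F : Face (n + 1)) (i : Fin (n + 1)) :
    F.codim = (if (F i).isSome then 1 else 0) + Face.codim (fun j => F (i.succAbove j)) := by
  rw [codim_eq_sum, codim_eq_sum, Fin.sum_univ_succAbove _ i]

lemma codim_insert (i : Fin (n + 1)) (ε : Fin 2) (F : Face n) :
    (F.insert i ε).codim = F.codim + 1 := by
  rw [codim_succAbove _ i]
  simp [Face.insert, add_comm]

lemma comap_faceMap_mem_faceLocus_iff {i : Fin (n + 1)} {ε : Fin 2} {F : Face (n + 1)}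
    (hF : F i = none ∨ F i = some ε) {Q : PrimeSpectrum (CubeRing S n)} :
    PrimeSpectrum.comap (faceMap S i ε) Q ∈ faceLocus S F ↔
      Q ∈ faceLocus S (fun j => F (i.succAbove j)) := by
  rw [mem_faceLocus, mem_faceLocus]
  constructor
  · intro h j δ hj
    have := h _ δ hj
    rw [PrimeSpectrum.comap_asIdeal, Ideal.mem_comap, map_sub, faceMap_X_succAbove,
      faceMap_C] at this
    exact this
  · intro h l δ hl
    rw [PrimeSpectrum.comap_asIdeal, Ideal.mem_comap]
    rcases Fin.eq_self_or_eq_succAbove i l with rfl | ⟨j, rfl⟩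
    · rw [hl] at hF
      obtain rfl : δ = ε := by simpa using hF
      simp
    · rw [map_sub, faceMap_X_succAbove, faceMap_C]
      exact h j δ hl

lemma preimage_prodFace (W : Set (PrimeSpectrum S)) {i : Fin (n + 1)} {ε : Fin 2}
    {F : Face (n + 1)} (hF : F i = none ∨ F i = some ε) :
    PrimeSpectrum.comap (faceMap S i ε) ⁻¹' (prodFace W F) =
      prodFace W (fun j => F (i.succAbove j)) := by
  ext Q
  refine and_congr ?_ (comap_faceMap_mem_faceLocus_iff hF)
  rw [Set.mem_preimage, Set.mem_preimage]
  have : PrimeSpectrum.comap (MvPolynomial.C : S →+* CubeRing S (n + 1))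
      (PrimeSpectrum.comap (faceMap S i ε) Q) =
      PrimeSpectrum.comap (MvPolynomial.C : S →+* CubeRing S n) Q := by
    rw [← PrimeSpectrum.comap_comp_apply]
    congr 2
    exact RingHom.ext fun a => by simp
  rw [this]

end faces

/-! ### The maps of the homotopy -/

section shear

variable {R : Type v} [CommRing R] {d n : ℕ}

lemma cubeRing_ringHom_ext {D : Type*} [CommRing D]
    {f g : CubeRing (MvPolynomial (Fin d) R) n →+* D}
    (h0 : ∀ a, f (MvPolynomial.C (MvPolynomial.C a)) = g (MvPolynomial.C (MvPolynomial.C a)))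
    (h1 : ∀ j, f (MvPolynomial.C (MvPolynomial.X j)) = g (MvPolynomial.C (MvPolynomial.X j)))
    (h2 : ∀ l, f (MvPolynomial.X l) = g (MvPolynomial.X l)) : f = g := by
  refine MvPolynomial.ringHom_ext' ?_ h2
  exact MvPolynomial.ringHom_ext h0 h1

/-- The ring map of `𝔸ᵈ × □ⁿ⁺¹ → 𝔸ᵈ × □ⁿ`, `(x, z) ↦ (x + zᵢ v, (zₗ)_{l ≠ i})`. -/
def shearMap (v : Fin d → R) (i : Fin (n + 1)) :
    CubeRing (MvPolynomial (Fin d) R) n →+* CubeRing (MvPolynomial (Fin d) R) (n + 1) :=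
  MvPolynomial.eval₂Hom
    (MvPolynomial.eval₂Hom (MvPolynomial.C.comp MvPolynomial.C)
      fun j => MvPolynomial.C (MvPolynomial.X j) +
        MvPolynomial.X i * MvPolynomial.C (MvPolynomial.C (v j)))
    fun l => MvPolynomial.X (i.succAbove l)

@[simp]
lemma shearMap_C_C (v : Fin d → R) (i : Fin (n + 1)) (a : R) :
    shearMap v i (MvPolynomial.C (MvPolynomial.C a)) = MvPolynomial.C (MvPolynomial.C a) := by
  simp [shearMap]

@[simp]
lemma shearMap_C_X (v : Fin d → R) (i : Fin (n + 1)) (j : Fin d) :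
    shearMap v i (MvPolynomial.C (MvPolynomial.X j)) = MvPolynomial.C (MvPolynomial.X j) +
      MvPolynomial.X i * MvPolynomial.C (MvPolynomial.C (v j)) := by
  simp [shearMap]

@[simp]
lemma shearMap_X (v : Fin d → R) (i : Fin (n + 1)) (l : Fin n) :
    shearMap v i (MvPolynomial.X l) = MvPolynomial.X (i.succAbove l) := by
  simp [shearMap]

/-- Degeneracies are the shears with `v = 0`; their properties are obtained below as special cases.
-/
lemma shearMap_zero (i : Fin (n + 1)) :
    shearMap (0 : Fin d → R) i = degeneracyMap (MvPolynomial (Fin d) R) i :=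
  cubeRing_ringHom_ext (by simp) (by simp) (by simp)

lemma shearMap_comp_algebraMap (v : Fin d → R) (i : Fin (n + 1)) :
    (shearMap v i).comp (algebraMap R (CubeRing (MvPolynomial (Fin d) R) n)) =
      algebraMap R (CubeRing (MvPolynomial (Fin d) R) (n + 1)) := by
  exact RingHom.ext fun a => shearMap_C_C v i a

/-- The map is the projection forgetting `zᵢ` after the automorphism `x ↦ x + zᵢ v` of the total
space; the inverse below substitutes `x - zᵢ v`. -/
lemma isPolynomialExtension_shearMap (v : Fin d → R) (i : Fin (n + 1)) :
    IsPolynomialExtension (shearMap v i) (MvPolynomial.X i) := by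
  let back : CubeRing (MvPolynomial (Fin d) R) (n + 1) →+*
      Polynomial (CubeRing (MvPolynomial (Fin d) R) n) :=
    MvPolynomial.eval₂Hom
      (MvPolynomial.eval₂Hom (Polynomial.C.comp (MvPolynomial.C.comp MvPolynomial.C))
        fun j => Polynomial.C (MvPolynomial.C (MvPolynomial.X j)) -
          Polynomial.X * Polynomial.C (MvPolynomial.C (MvPolynomial.C (v j))))
      (i.insertNth (α := fun _ => Polynomial (CubeRing (MvPolynomial (Fin d) R) n))
        Polynomial.X fun l => Polynomial.C (MvPolynomial.X l))
  have h1 : back.comp (Polynomial.eval₂RingHom (shearMap v i) (MvPolynomial.X i)) =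
      RingHom.id _ := by
    refine Polynomial.ringHom_ext' ?_ ?_
    · refine cubeRing_ringHom_ext (fun a => ?_) (fun j => ?_) fun l => ?_ <;> simp [back]
    · simp [back]
  have h2 : (Polynomial.eval₂RingHom (shearMap v i) (MvPolynomial.X i)).comp back =
      RingHom.id _ := by
    refine cubeRing_ringHom_ext (fun a => ?_) (fun j => ?_) fun l => ?_
    · simp [back]
    · simp [back]
      ring
    · rcases Fin.eq_self_or_eq_succAbove i l with rfl | ⟨l, rfl⟩ <;> simp [back]
  refine Function.bijective_iff_has_inverse.2 ⟨back, fun x => ?_, fun x => ?_⟩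
  · exact congrArg (fun f => f x) h1
  · exact congrArg (fun f => f x) h2

lemma faceMap_comp_shearMap_succAbove (v : Fin d → R) (i : Fin (n + 2)) (j : Fin (n + 1))
    (ε : Fin 2) :
    (faceMap (MvPolynomial (Fin d) R) (i.succAbove j) ε).comp (shearMap v i) =
      (shearMap v (j.predAbove i)).comp (faceMap (MvPolynomial (Fin d) R) j ε) := by
  have hi : faceMap (MvPolynomial (Fin d) R) (i.succAbove j) ε (MvPolynomial.X i) =
      MvPolynomial.X (j.predAbove i) := by
    have h1 := faceMap_X_succAbove (S := MvPolynomial (Fin d) R) (i.succAbove j) ε (j.predAbove i)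
    rwa [Fin.succAbove_succAbove_predAbove] at h1
  refine cubeRing_ringHom_ext (fun a => by simp) (fun k => ?_) fun l => ?_
  · simp [hi]
  · rcases Fin.eq_self_or_eq_succAbove j l with rfl | ⟨k, rfl⟩
    · simp
    · rw [RingHom.comp_apply, RingHom.comp_apply, shearMap_X, faceMap_X_succAbove, shearMap_X,
        ← Fin.succAbove_succAbove_succAbove_predAbove, faceMap_X_succAbove]

lemma faceMap_zero_comp_shearMap (v : Fin d → R) (i : Fin (n + 1)) :
    (faceMap (MvPolynomial (Fin d) R) i 0).comp (shearMap v i) = RingHom.id _ :=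
  cubeRing_ringHom_ext (by simp) (by simp) (by simp)

end shear

/-! ### Integral elements and valuation rings -/

section integral

lemma isIntegralElem_comp_iff {D E K : Type*} [CommRing D] [CommRing E] [CommRing K] {g : D →+* E}
    (hg : Function.Surjective g) (h : E →+* K) (x : K) :
    (h.comp g).IsIntegralElem x ↔ h.IsIntegralElem x := by
  refine ⟨RingHom.isIntegralElem.of_comp g h, ?_⟩
  rintro ⟨f, hf, hfx⟩
  obtain ⟨q, hq, -, hqm⟩ := Polynomial.lifts_and_natDegree_eq_and_monic
    (f := g) ((Polynomial.mem_lifts f).2 (Polynomial.map_surjective g hg f)) hf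
  refine ⟨q, hqm, ?_⟩
  rw [← Polynomial.eval₂_map, hq, hfx]

/-- An integral dependence specializes. -/
lemma isIntegralElem_of_ker_le {D L K K' : Type*} [CommRing D] [CommRing L] [CommRing K]
    [CommRing K'] (δ : D →+* L) {α : L →+* K} {β : L →+* K'} (h : RingHom.ker α ≤ RingHom.ker β)
    {c : L} (hc : (α.comp δ).IsIntegralElem (α c)) : (β.comp δ).IsIntegralElem (β c) := by
  obtain ⟨f, hf, hfc⟩ := hc
  refine ⟨f, hf, ?_⟩
  rw [← Polynomial.hom_eval₂] at hfc ⊢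
  exact h hfc

lemma map_inverse_of_isUnit {L K : Type*} [CommRing L] [Field K] (α : L →+* K) {x : L}
    (hx : IsUnit x) : α (Ring.inverse x) = (α x)⁻¹ := by
  refine eq_inv_of_mul_eq_one_left ?_
  rw [← map_mul, Ring.inverse_mul_cancel x hx, map_one]

lemma mem_valuationSubring_of_isIntegralElem {E K : Type*} [CommRing E] [Field K] {h : E →+* K}
    {x : K} (hx : h.IsIntegralElem x) (O : ValuationSubring K) (hO : ∀ a, h a ∈ O) : x ∈ O := by
  have h1 : (algebraMap O K).comp (h.codRestrict O.toSubring hO) = h := RingHom.ext fun _ => rfl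
  rw [← h1] at hx
  have h2 : IsIntegral O x := RingHom.isIntegralElem.of_comp _ _ hx
  obtain ⟨y, rfl⟩ := IsIntegrallyClosed.isIntegral_iff.1 h2
  exact y.2

/-- The integral closure of a subring of a field is the intersection of the valuation rings
containing it. -/
lemma isIntegralElem_of_forall_mem {E K : Type*} [CommRing E] [Field K] {h : E →+* K}
    {x : K} (hx : ∀ O : ValuationSubring K, (∀ a, h a ∈ O) → x ∈ O) : h.IsIntegralElem x := by
  have h1 : x ∈ (⨅ V : {V : ValuationSubring K // (h.range : Set K) ⊆ V.toSubring},
      V.1.toSubring) := by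
    rw [Subring.mem_iInf]
    exact fun V => hx V.1 fun a => V.2 ⟨a, rfl⟩
  rw [iInf_valuationSubring_superset, Subring.closure_eq] at h1
  exact (isIntegralElem_comp_iff h.rangeRestrict_surjective h.range.subtype x).2 h1

end integral

/-! ### The modulus condition -/

section modulus

variable {S : Type v} [CommRing S] {n : ℕ} {u : S}

/-- The coordinates on the chart `U_J`, as functions on a prime cycle. -/
def chartHom (p : PrimeSpectrum (CubeRing S n)) (J : Finset (Fin n)) :
    CubeRing S n →ₐ[S] functionField p :=
  MvPolynomial.aeval fun i => if i ∈ J then (coordFun p i)⁻¹ else coordFun p i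

lemma closureChart_eq_range (p : PrimeSpectrum (CubeRing S n)) (J : Finset (Fin n)) :
    closureChart p J = (chartHom p J).range := by
  rw [chartHom, ← Algebra.adjoin_range_eq_range_aeval, closureChart]
  congr 1
  ext x
  constructor
  · rintro (⟨i, hi, rfl⟩ | ⟨i, hi, rfl⟩)
    · exact ⟨i, if_neg hi⟩
    · exact ⟨i, if_pos hi⟩
  · rintro ⟨i, rfl⟩
    by_cases hi : i ∈ J
    · exact Or.inr ⟨i, hi, if_pos hi⟩
    · exact Or.inl ⟨i, hi, if_neg hi⟩

lemma mem_integralClosure_closureChart_iff (p : PrimeSpectrum (CubeRing S n))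
    (J : Finset (Fin n)) (c : functionField p) :
    c ∈ integralClosure (closureChart p J) (functionField p) ↔
      (chartHom p J).toRingHom.IsIntegralElem c := by
  rw [mem_integralClosure_iff, closureChart_eq_range]
  exact (isIntegralElem_comp_iff (chartHom p J).rangeRestrict_surjective
    (algebraMap (chartHom p J).range (functionField p)) c).symm

lemma modulusCondition_iff (p : PrimeSpectrum (CubeRing S n)) :
    ModulusCondition u p ↔ algebraMap S (functionField p) u ≠ 0 ∧
      ∀ J : Finset (Fin n), (∀ j ∈ J, coordFun p j ≠ 0) →
        (chartHom p J).toRingHom.IsIntegralElem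
          ((∏ j ∈ J, (coordFun p j)⁻¹) * (algebraMap S (functionField p) u)⁻¹) := by
  constructor
  · intro h
    have hu : algebraMap S (functionField p) u ≠ 0 := by
      obtain ⟨c, -, hc⟩ := h ∅ (by simp)
      rw [Finset.prod_empty] at hc
      exact left_ne_zero_of_mul_eq_one hc
    refine ⟨hu, fun J hJ => ?_⟩
    obtain ⟨c, hc, hcu⟩ := h J hJ
    rw [← hcu, mul_comm, inv_mul_cancel_left₀ hu]
    exact (mem_integralClosure_closureChart_iff p J c).1 hc
  · rintro ⟨hu, h⟩ J hJ
    refine ⟨_, (mem_integralClosure_closureChart_iff p J _).2 (h J hJ), ?_⟩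
    rw [mul_comm, inv_mul_cancel_right₀ hu]

open Classical in
-- A valuation ring containing the image of `S` has its centre in the chart where exactly the
-- coordinates with a pole are inverted, and integrality over a chart can be tested on valuation
-- rings. All charts are thus handled uniformly.
lemma modulusCondition_iff_valuation (p : PrimeSpectrum (CubeRing S n)) :
    ModulusCondition u p ↔ algebraMap S (functionField p) u ≠ 0 ∧
      ∀ O : ValuationSubring (functionField p), (∀ s, algebraMap S (functionField p) s ∈ O) →
        (∏ j with coordFun p j ∉ O, (coordFun p j)⁻¹) *
          (algebraMap S (functionField p) u)⁻¹ ∈ O := by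
  rw [modulusCondition_iff]
  refine and_congr_right fun hu => ⟨fun h O hO => ?_, fun h J hJ => ?_⟩
  · refine mem_valuationSubring_of_isIntegralElem (h _ fun j hj h0 => ?_) O fun a => ?_
    · rw [Finset.mem_filter, h0] at hj
      exact hj.2 O.zero_mem
    · change chartHom p _ a ∈ O
      induction a using MvPolynomial.induction_on with
      | C a =>
        rw [← MvPolynomial.algebraMap_eq, AlgHom.commutes]
        exact hO a
      | add a b ha hb =>
        rw [map_add]
        exact add_mem ha hb
      | mul_X a i ha =>
        rw [map_mul]
        refine mul_mem ha ?_
        rw [chartHom, MvPolynomial.aeval_X]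
        split_ifs with hi
        · exact (O.mem_or_inv_mem _).resolve_left (Finset.mem_filter.1 hi).2
        · simpa using hi
  · refine isIntegralElem_of_forall_mem fun O hO => ?_
    have hS : ∀ s, algebraMap S (functionField p) s ∈ O := fun s => by
      rw [← (chartHom p J).commutes]
      exact hO _
    have hX : ∀ i, (if i ∈ J then (coordFun p i)⁻¹ else coordFun p i) ∈ O := fun i => by
      have := hO (MvPolynomial.X i)
      change chartHom p J _ ∈ O at this
      rwa [chartHom, MvPolynomial.aeval_X] at this
    -- If `O` contains the ring of the chart `U_J`, every coordinate with a pole at `O` is inverted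
    -- in it. The other coordinates in `J` contribute factors `zⱼ⁻¹` that lie in `O`.
    have hsub : (Finset.univ.filter fun j => coordFun p j ∉ O) ⊆ J := by
      intro j hj
      by_contra hjJ
      have := hX j
      rw [if_neg hjJ] at this
      exact (Finset.mem_filter.1 hj).2 this
    rw [← Finset.prod_sdiff hsub, mul_assoc]
    refine mul_mem (prod_mem fun j hj => ?_) (h O hS)
    have := hX j
    rwa [if_pos (Finset.mem_sdiff.1 hj).1] at this

lemma algebraMap_functionField_eq_zero_iff {p : PrimeSpectrum (CubeRing S n)} {s : S} :
    algebraMap S (functionField p) s = 0 ↔ MvPolynomial.C s ∈ p.asIdeal := by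
  rw [← Ideal.algebraMap_residueField_eq_zero, ← MvPolynomial.algebraMap_eq,
    ← IsScalarTower.algebraMap_apply]

lemma coordFun_eq_zero_iff {p : PrimeSpectrum (CubeRing S n)} {i : Fin n} :
    coordFun p i = 0 ↔ MvPolynomial.X i ∈ p.asIdeal :=
  Ideal.algebraMap_residueField_eq_zero

/-- A cycle with modulus does not meet the divisor. -/
lemma ModulusCondition.notMem {p : PrimeSpectrum (CubeRing S n)} (h : ModulusCondition u p)
    {Q : PrimeSpectrum (CubeRing S n)} (hpQ : p ≤ Q) : MvPolynomial.C u ∉ Q.asIdeal := by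
  intro huQ
  obtain ⟨hu, h⟩ := (modulusCondition_iff p).1 h
  have h0 := h ∅ (by simp)
  rw [Finset.prod_empty, one_mul] at h0
  obtain ⟨f, hf, hfu⟩ := h0
  let φ := algebraMap (CubeRing S n) (functionField p)
  have hφ : (chartHom p ∅).toRingHom = φ := by
    refine MvPolynomial.ringHom_ext (fun a => ?_) fun i => ?_
    · change chartHom p ∅ _ = _
      rw [← MvPolynomial.algebraMap_eq, AlgHom.commutes, ← IsScalarTower.algebraMap_apply]
    · change chartHom p ∅ _ = _
      rw [chartHom, MvPolynomial.aeval_X]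
      rfl
  have hφu : φ (MvPolynomial.C u) = algebraMap S (functionField p) u := by
    rw [← MvPolynomial.algebraMap_eq, ← IsScalarTower.algebraMap_apply]
  rw [hφ, ← hφu] at hfu
  let _ : Invertible (φ (MvPolynomial.C u)) := invertibleOfNonzero (by rwa [hφu])
  let _ : Invertible (φ (MvPolynomial.C u))⁻¹ := invertibleOfNonzero (inv_ne_zero (by rwa [hφu]))
  -- Reversing the integral equation of `u⁻¹` gives a polynomial with constant term `1` that
  -- vanishes at `u` on V. At a point where `u` vanishes this would read `1 = 0`.
  rw [← Polynomial.eval₂_reverse_eq_zero_iff, invOf_eq_inv, inv_inv, Polynomial.eval₂_at_apply] at hfu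
  have h1 : f.reverse.eval (MvPolynomial.C u) ∈ Q.asIdeal :=
    hpQ (Ideal.algebraMap_residueField_eq_zero.1 hfu)
  have h2 := Polynomial.sub_dvd_eval_sub (MvPolynomial.C u) 0 f.reverse
  rw [sub_zero, ← Polynomial.coeff_zero_eq_eval_zero, Polynomial.coeff_zero_reverse,
    hf.leadingCoeff] at h2
  have h3 := Ideal.mem_of_dvd _ h2 huQ
  refine (Ideal.ne_top_iff_one _).1 Q.2.ne_top ?_
  have := Ideal.sub_mem _ h1 h3
  rwa [sub_sub_cancel] at this

/-- The modulus condition is inherited by the closed subsets of a face. -/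
lemma ModulusCondition.of_le_comap_faceMap {i : Fin (n + 1)} {ε : Fin 2}
    {p : PrimeSpectrum (CubeRing S (n + 1))} (h : ModulusCondition u p)
    {q : PrimeSpectrum (CubeRing S n)} (hpq : p ≤ PrimeSpectrum.comap (faceMap S i ε) q) :
    ModulusCondition u q := by
  classical
  set Q := PrimeSpectrum.comap (faceMap S i ε) q with hQ
  have huQ : MvPolynomial.C u ∉ Q.asIdeal := h.notMem hpq
  rw [modulusCondition_iff] at h ⊢
  have huq : algebraMap S (functionField q) u ≠ 0 := by
    rw [Ne, algebraMap_functionField_eq_zero_iff]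
    rw [hQ, PrimeSpectrum.comap_asIdeal, Ideal.mem_comap, faceMap_C] at huQ
    exact huQ
  refine ⟨huq, fun J hJ => ?_⟩
  -- The local ring at `Q` maps to both function fields, to that of `p` by generization and to that
  -- of `q` as its residue field. Integral equations for `p` with data in `L` therefore specialize
  -- to `q`.
  let L := Localization.AtPrime Q.asIdeal
  let φp := algebraMap (CubeRing S (n + 1)) (functionField p)
  let φq := (algebraMap (CubeRing S n) (functionField q)).comp (faceMap S i ε)
  have hφp : ∀ x : Q.asIdeal.primeCompl, IsUnit (φp x) := fun x => by
    rw [isUnit_iff_ne_zero, Ne, Ideal.algebraMap_residueField_eq_zero]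
    exact fun hx => x.2 (hpq hx)
  have hφq : ∀ x : Q.asIdeal.primeCompl, IsUnit (φq x) := fun x => by
    rw [isUnit_iff_ne_zero, Ne, RingHom.comp_apply, Ideal.algebraMap_residueField_eq_zero]
    exact fun hx => x.2 hx
  let α : L →+* functionField p := IsLocalization.lift hφp
  let β : L →+* functionField q := IsLocalization.lift hφq
  have hα : ∀ x, α (algebraMap _ L x) = φp x := fun x => IsLocalization.lift_eq hφp x
  have hβ : ∀ x, β (algebraMap _ L x) = φq x := fun x => IsLocalization.lift_eq hφq x
  have hker : RingHom.ker α ≤ RingHom.ker β := by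
    intro x hx
    obtain ⟨a, s, rfl⟩ := IsLocalization.exists_mk'_eq Q.asIdeal.primeCompl x
    have h1 : α (algebraMap _ L a) = 0 := by
      rw [← IsLocalization.mk'_spec' L a s, map_mul, (RingHom.mem_ker).1 hx, mul_zero]
    rw [hα] at h1
    have h2 : a ∈ Q.asIdeal := hpq (Ideal.algebraMap_residueField_eq_zero.1 h1)
    have h3 : β (algebraMap _ L a) = 0 := by
      rw [hβ]
      exact Ideal.algebraMap_residueField_eq_zero.2 h2
    rw [RingHom.mem_ker, IsLocalization.mk'_eq_mul_mk'_one, map_mul, h3, zero_mul]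
  have hunit : ∀ x, x ∉ Q.asIdeal → IsUnit (algebraMap _ L x) := fun x hx =>
    IsLocalization.map_units L (⟨x, hx⟩ : Q.asIdeal.primeCompl)
  have hαi : ∀ x, x ∉ Q.asIdeal → α (Ring.inverse (algebraMap _ L x)) = (φp x)⁻¹ := fun x hx => by
    rw [map_inverse_of_isUnit α (hunit x hx), hα]
  have hβi : ∀ x, x ∉ Q.asIdeal → β (Ring.inverse (algebraMap _ L x)) = (φq x)⁻¹ := fun x hx => by
    rw [map_inverse_of_isUnit β (hunit x hx), hβ]
  have hXQ : ∀ j ∈ J, (MvPolynomial.X (i.succAbove j) : CubeRing S (n + 1)) ∉ Q.asIdeal := by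
    intro j hj hjQ
    apply hJ j hj
    rw [coordFun_eq_zero_iff]
    rw [hQ, PrimeSpectrum.comap_asIdeal, Ideal.mem_comap, faceMap_X_succAbove] at hjQ
    exact hjQ
  -- The chart in the larger cube does not invert `zᵢ`, which takes the finite value `ε` on the
  -- face.
  let J' : Finset (Fin (n + 1)) := J.map i.succAboveEmb
  have hJ' : ∀ j ∈ J', (MvPolynomial.X j : CubeRing S (n + 1)) ∉ Q.asIdeal := by
    intro j hj
    obtain ⟨j', hj', rfl⟩ := Finset.mem_map.1 hj
    exact hXQ j' hj'
  have hiJ : i ∉ J' := by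
    intro hi
    obtain ⟨j, -, hj⟩ := Finset.mem_map.1 hi
    exact Fin.succAbove_ne i j hj
  let δ : CubeRing S (n + 1) →+* L := MvPolynomial.eval₂Hom
    ((algebraMap (CubeRing S (n + 1)) L).comp MvPolynomial.C) fun j =>
      if j ∈ J' then Ring.inverse (algebraMap _ L (MvPolynomial.X j : CubeRing S (n + 1)))
      else algebraMap _ L (MvPolynomial.X j : CubeRing S (n + 1))
  have hαδ : α.comp δ = (chartHom p J').toRingHom := by
    refine MvPolynomial.ringHom_ext (fun a => ?_) fun j => ?_
    · rw [RingHom.comp_apply, MvPolynomial.coe_eval₂Hom, MvPolynomial.eval₂_C, RingHom.comp_apply,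
        hα]
      change _ = chartHom p J' _
      rw [← MvPolynomial.algebraMap_eq, AlgHom.commutes, ← IsScalarTower.algebraMap_apply]
    · rw [RingHom.comp_apply, MvPolynomial.coe_eval₂Hom, MvPolynomial.eval₂_X]
      change _ = chartHom p J' _
      rw [chartHom, MvPolynomial.aeval_X]
      split_ifs with hj
      · rw [hαi _ (hJ' j hj)]
        rfl
      · rw [hα]
        rfl
  have hβδ : β.comp δ = (chartHom q J).toRingHom.comp (faceMap S i ε) := by
    refine MvPolynomial.ringHom_ext (fun a => ?_) fun j => ?_
    · rw [RingHom.comp_apply, MvPolynomial.coe_eval₂Hom, MvPolynomial.eval₂_C, RingHom.comp_apply,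
        hβ, RingHom.comp_apply, RingHom.comp_apply, faceMap_C]
      change _ = chartHom q J _
      rw [← MvPolynomial.algebraMap_eq, AlgHom.commutes, ← IsScalarTower.algebraMap_apply]
    · rw [RingHom.comp_apply, RingHom.comp_apply, MvPolynomial.coe_eval₂Hom, MvPolynomial.eval₂_X]
      change _ = chartHom q J _
      rcases Fin.eq_self_or_eq_succAbove i j with rfl | ⟨j, rfl⟩
      · rw [if_neg hiJ, hβ, RingHom.comp_apply, faceMap_X_same, ← MvPolynomial.algebraMap_eq,
          AlgHom.commutes, ← IsScalarTower.algebraMap_apply]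
      · rw [faceMap_X_succAbove, chartHom, MvPolynomial.aeval_X]
        have hmem : i.succAbove j ∈ J' ↔ j ∈ J := by
          change i.succAboveEmb j ∈ J' ↔ _
          exact Finset.mem_map' _
        simp only [hmem]
        split_ifs with hj
        · rw [hβi _ (hXQ j hj), RingHom.comp_apply, faceMap_X_succAbove]
          rfl
        · rw [hβ, RingHom.comp_apply, faceMap_X_succAbove]
          rfl
  -- The function tested by the modulus condition is defined at `Q`, because `u` and the coordinates
  -- in `J'` are units there.
  let c : L := (∏ j ∈ J', Ring.inverse (algebraMap _ L (MvPolynomial.X j : CubeRing S (n + 1)))) *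
    Ring.inverse (algebraMap _ L (MvPolynomial.C u : CubeRing S (n + 1)))
  have hαc : α c = (∏ j ∈ J', (coordFun p j)⁻¹) * (algebraMap S (functionField p) u)⁻¹ := by
    rw [map_mul, map_prod, hαi _ huQ, Finset.prod_congr rfl fun j hj => hαi _ (hJ' j hj)]
    change _ * (φp (algebraMap S _ u))⁻¹ = _
    rw [← IsScalarTower.algebraMap_apply]
    rfl
  have hβc : β c = (∏ j ∈ J, (coordFun q j)⁻¹) * (algebraMap S (functionField q) u)⁻¹ := by
    rw [map_mul, map_prod, hβi _ huQ, Finset.prod_congr rfl fun j hj => hβi _ (hJ' j hj),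
      Finset.prod_map, RingHom.comp_apply, faceMap_C]
    change _ * (algebraMap _ _ (algebraMap S _ u))⁻¹ = _
    rw [← IsScalarTower.algebraMap_apply]
    congr 1
    refine Finset.prod_congr rfl fun j _ => ?_
    change (φq (MvPolynomial.X (i.succAbove j)))⁻¹ = _
    rw [RingHom.comp_apply, faceMap_X_succAbove]
    rfl
  have h1 := h.2 J' fun j hj h0 => hJ' j hj (hpq (coordFun_eq_zero_iff.1 h0))
  rw [← hαc, ← hαδ] at h1
  have h2 := isIntegralElem_of_ker_le δ hker h1
  rw [hβδ, hβc] at h2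
  exact (isIntegralElem_comp_iff (faceMap_surjective i ε) _ _).1 h2

end modulus

/-! ### The modulus condition under the homotopy. -/

section shear

variable {R : Type v} [CommRing R] {d n : ℕ}

/-- The modulus condition is preserved by the pull-back along `(x, z) ↦ (x + zᵢ v, (zₗ)_{l ≠ i})`
if `v` is divisible by the equation of the divisor. -/
lemma ModulusCondition.of_shearMap {u : R} {v : Fin d → R} (hv : ∀ j, u ∣ v j) (i : Fin (n + 1))
    {p : PrimeSpectrum (CubeRing (MvPolynomial (Fin d) R) n)}
    (h : ModulusCondition (MvPolynomial.C u) p)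
    {P : PrimeSpectrum (CubeRing (MvPolynomial (Fin d) R) (n + 1))}
    (hP : PrimeSpectrum.comap (shearMap v i) P = p) : ModulusCondition (MvPolynomial.C u) P := by
  classical
  subst hP
  set p := PrimeSpectrum.comap (shearMap v i) P with hp
  let ρ : functionField p →+* functionField P :=
    Ideal.ResidueField.map p.asIdeal P.asIdeal (shearMap v i) rfl
  have hρ : ∀ x, ρ (algebraMap _ _ x) = algebraMap _ _ (shearMap v i x) := fun x =>
    Ideal.ResidueField.map_algebraMap p.asIdeal P.asIdeal (shearMap v i) rfl x
  rw [modulusCondition_iff_valuation] at h ⊢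
  have hS : ∀ s, algebraMap (MvPolynomial (Fin d) R) (functionField P) s =
      algebraMap _ (functionField P) (MvPolynomial.C s : CubeRing (MvPolynomial (Fin d) R) (n + 1)) :=
    fun s => by rw [← MvPolynomial.algebraMap_eq, ← IsScalarTower.algebraMap_apply]
  have hSp : ∀ s, ρ (algebraMap (MvPolynomial (Fin d) R) (functionField p) s) =
      algebraMap _ (functionField P) (shearMap v i (MvPolynomial.C s)) :=
    fun s => by
      rw [← hρ, ← MvPolynomial.algebraMap_eq, ← IsScalarTower.algebraMap_apply]
  have hρu : ρ (algebraMap (MvPolynomial (Fin d) R) (functionField p) (MvPolynomial.C u)) =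
      algebraMap (MvPolynomial (Fin d) R) (functionField P) (MvPolynomial.C u) := by
    rw [hSp, shearMap_C_C, hS]
  have hρX : ∀ l, ρ (coordFun p l) = coordFun P (i.succAbove l) := fun l => by
    rw [coordFun, hρ, shearMap_X, coordFun]
  have huP : algebraMap (MvPolynomial (Fin d) R) (functionField P) (MvPolynomial.C u) ≠ 0 := by
    rw [← hρu]
    exact (map_ne_zero ρ).2 h.1
  refine ⟨huP, fun O hO => ?_⟩
  have hprod : (∏ j with coordFun P j ∉ O, (coordFun P j)⁻¹) =
      (if coordFun P i ∉ O then (coordFun P i)⁻¹ else 1) *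
        ∏ j with coordFun P (i.succAbove j) ∉ O, (coordFun P (i.succAbove j))⁻¹ := by
    rw [Finset.prod_filter, Fin.prod_univ_succAbove _ i, Finset.prod_filter]
  have hmem : (∏ j with coordFun P (i.succAbove j) ∉ O, (coordFun P (i.succAbove j))⁻¹) ∈ O :=
    prod_mem fun j hj => (O.mem_or_inv_mem _).resolve_left (Finset.mem_filter.1 hj).2
  have hmemi : (if coordFun P i ∉ O then (coordFun P i)⁻¹ else 1) ∈ O := by
    split_ifs with hi
    · exact O.one_mem
    · exact (O.mem_or_inv_mem _).resolve_left hi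
  rw [hprod]
  -- If the functions `x + zᵢ v` are all regular at `O`, then `O` induces a valuation ring on the
  -- function field of `p` containing the image of `S`, and the modulus condition of `p` applies;
  -- the possible extra factor `zᵢ⁻¹` does no harm.
  by_cases hcase : ∀ s, algebraMap (MvPolynomial (Fin d) R) (functionField p) s ∈ O.comap ρ
  · have h1 := h.2 (O.comap ρ) hcase
    rw [ValuationSubring.mem_comap, map_mul, map_prod, map_inv₀, hρu] at h1
    rw [mul_assoc]
    refine mul_mem hmemi ?_
    convert h1 using 2
    refine Finset.prod_congr ?_ fun j _ => ?_
    · ext j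
      rw [Finset.mem_filter, Finset.mem_filter, ValuationSubring.mem_comap, hρX]
    · rw [map_inv₀, hρX]
  -- Otherwise some `zᵢ vⱼ` has a pole. As `u` divides `vⱼ`, so does `zᵢ u`; hence `zᵢ⁻¹ u⁻¹` lies
  -- in `O` and the coordinate `zᵢ` alone accounts for the modulus.
  · have hi : ∃ j, coordFun P i *
        algebraMap (MvPolynomial (Fin d) R) (functionField P) (MvPolynomial.C (v j)) ∉ O := by
      by_contra hcon
      push Not at hcon
      apply hcase
      intro s
      rw [ValuationSubring.mem_comap, hSp]
      induction s using MvPolynomial.induction_on with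
      | C a =>
        rw [shearMap_C_C, ← hS]
        exact hO _
      | add a b ha hb =>
        rw [map_add, map_add, map_add]
        exact add_mem ha hb
      | mul_X a j ha =>
        rw [map_mul, map_mul, map_mul]
        refine mul_mem ha ?_
        rw [shearMap_C_X, map_add, map_mul, ← hS, ← hS]
        exact add_mem (hO _) (hcon j)
    obtain ⟨j, hj⟩ := hi
    obtain ⟨w, hw⟩ := hv j
    have htu : coordFun P i *
        algebraMap (MvPolynomial (Fin d) R) (functionField P) (MvPolynomial.C u) ∉ O := by
      intro hmem
      apply hj
      rw [hw, map_mul, map_mul, ← mul_assoc]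
      exact mul_mem hmem (hO _)
    have ht : coordFun P i ∉ O := fun ht => htu (mul_mem ht (hO _))
    have h1 := (O.mem_or_inv_mem _).resolve_left htu
    rw [mul_inv] at h1
    rw [if_pos ht, mul_right_comm]
    exact mul_mem h1 hmem

end shear

/-! ### Generic translations -/

section avoiding

variable {R : Type v} [CommRing R] [IsDomain R]

/-- Successive generic hyperplane sections: the values `v j` can be chosen in any infinite subset
of `R` such that each equation `a v j = g j` lowers the dimension outside `a = 0`. -/
lemma exists_avoiding {ι : Type*} [Finite ι] (B : ι → Type v) [∀ i, CommRing (B i)]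
    [∀ i, IsNoetherianRing (B i)] [∀ i, Algebra R (B i)] [∀ i, Algebra.FiniteType R (B i)]
    {V : Set R} (hV : V.Infinite) (a : ∀ i, B i) (D : ι → ℕ) (m : ℕ) :
    ∀ (k : ℕ) (g : ∀ i, Fin m → B i) (I : ∀ i, Ideal (B i)),
      (∀ i (Q : Ideal (B i)) [Q.IsPrime], I i ≤ Q → Q.comap (algebraMap R (B i)) = ⊥ → a i ∉ Q →
        pdim R Q + k ≤ D i) →
      ∃ v : Fin m → R, (∀ j, v j ∈ V) ∧
        ∀ i (Q : Ideal (B i)) [Q.IsPrime], I i ≤ Q → Q.comap (algebraMap R (B i)) = ⊥ → a i ∉ Q →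
          (∀ j, a i * algebraMap R (B i) (v j) - g i j ∈ Q) → pdim R Q + k + m ≤ D i := by
  induction m with
  | zero => exact fun k g I h => ⟨Fin.elim0, fun j => j.elim0, fun i Q _ h1 h2 h3 _ => h i Q h1 h2 h3⟩
  | succ m ih =>
    intro k g I h
    -- The values for which the new equation holds identically on a component. Each component
    -- excludes at most one value: two of them would differ by an element of `P ∩ R = 0`, as `a` is
    -- not in `P`.
    let bad : Set R := ⋃ i, ⋃ P ∈ {P ∈ (I i).minimalPrimes |
      P.comap (algebraMap R (B i)) = ⊥ ∧ a i ∉ P}, {w | a i * algebraMap R (B i) w - g i 0 ∈ P}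
    have hbad : bad.Finite := by
      refine Set.finite_iUnion fun i => Set.Finite.biUnion
        ((Ideal.finite_minimalPrimes_of_isNoetherianRing (B i) (I i)).subset fun P hP => hP.1) ?_
      rintro P ⟨hP, hP0, haP⟩
      have hPp : P.IsPrime := hP.1.1
      refine Set.Subsingleton.finite fun w hw w' hw' => ?_
      have h1 : a i * algebraMap R (B i) (w - w') ∈ P := by
        have := P.sub_mem hw hw'
        rw [map_sub]
        convert this using 1
        ring
      have h2 := (hPp.mem_or_mem h1).resolve_left haP
      have h3 : w - w' ∈ P.comap (algebraMap R (B i)) := h2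
      rw [hP0, Ideal.mem_bot, sub_eq_zero] at h3
      exact h3
    obtain ⟨w, hwV, hwbad⟩ := (hV.sdiff hbad).nonempty
    -- The equation for a value that is not bad is added to the ideals. It does not vanish on any
    -- relevant component, so the dimension drops by one and `k` increases.
    obtain ⟨v, hv, hvQ⟩ := ih (k + 1) (fun i j => g i j.succ)
      (fun i => I i ⊔ Ideal.span {a i * algebraMap R (B i) w - g i 0}) (by
        intro i Q _ hIQ hQ0 haQ
        obtain ⟨P, hP, hPQ⟩ := Ideal.exists_minimalPrimes_le (le_sup_left.trans hIQ)
        have hPp : P.IsPrime := hP.1.1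
        have haP : a i ∉ P := fun h => haQ (hPQ h)
        have hP0 := comap_eq_bot_of_le hPQ hQ0
        have hwP : a i * algebraMap R (B i) w - g i 0 ∉ P := fun h => hwbad
          (Set.mem_iUnion.2 ⟨i, Set.mem_biUnion (show P ∈ {P ∈ (I i).minimalPrimes |
            P.comap (algebraMap R (B i)) = ⊥ ∧ a i ∉ P} from ⟨hP, hP0, haP⟩) h⟩)
        obtain ⟨Q', hQ', hQQ'⟩ := Ideal.exists_minimalPrimes_le
          (sup_le hPQ (le_sup_right.trans hIQ))
        have hQp : Q'.IsPrime := hQ'.1.1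
        have h1 := pdim_add_one_of_mem_minimalPrimes hwP hQ' (comap_eq_bot_of_le hQQ' hQ0)
        have h2 : pdim R Q ≤ pdim R Q' := pdim_le_of_le hQQ'
        have h3 := h i P hP.1.2 hP0 haP
        omega)
    refine ⟨Fin.cons w v, fun j => ?_, ?_⟩
    · refine Fin.cases ?_ (fun j => ?_) j
      · exact hwV
      · exact hv j
    · intro i Q _ hIQ hQ0 haQ hgQ
      have := hvQ i Q (sup_le hIQ ((Ideal.span_singleton_le_iff_mem _).2 (hgQ 0))) hQ0 haQ
        fun j => hgQ j.succ
      omega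

end avoiding

/-! ### Dimension of closed subsets of products. -/

section compositum

variable {R : Type v} [CommRing R] [IsDomain R]

/-- The union of transcendence bases of the two images and of `T` generates a subalgebra over which
all generators of `E`, hence `E` itself, are algebraic. -/
lemma tdeg_le_of_adjoin_eq_top {D₁ D₂ E : Type v} [CommRing D₁] [CommRing D₂] [CommRing E]
    [IsDomain E] [Algebra R D₁] [Algebra R D₂] [Algebra R E] [Algebra.FiniteType R D₁]
    [Algebra.FiniteType R D₂] (φ₁ : D₁ →ₐ[R] E) (φ₂ : D₂ →ₐ[R] E)
    (hE : Function.Injective (algebraMap R E)) (T : Set E) (hT : T.Finite)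
    (hgen : Algebra.adjoin R (Set.range φ₁ ∪ Set.range φ₂ ∪ T) = ⊤) :
    tdeg R E ≤ pdim R (RingHom.ker φ₁) + pdim R (RingHom.ker φ₂) + T.ncard := by
  have key : ∀ {D : Type v} [CommRing D] [Algebra R D] [Algebra.FiniteType R D] (φ : D →ₐ[R] E),
      ∃ s : Set E, s.Finite ∧ s.ncard ≤ pdim R (RingHom.ker φ) ∧
        ∀ x, IsAlgebraic (Algebra.adjoin R s) (φ x) := by
    intro D _ _ _ φ
    have hfaith : FaithfulSMul R φ.range := (faithfulSMul_iff_algebraMap_injective _ _).2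
      fun x y hxy => hE (congrArg Subtype.val hxy)
    obtain ⟨s, hs⟩ := exists_isTranscendenceBasis R φ.range
    have hft : Algebra.FiniteType R φ.range :=
      Algebra.FiniteType.of_surjective φ.rangeRestrict φ.rangeRestrict_surjective
    have hcard : Cardinal.mk s = Algebra.trdeg R φ.range := hs.cardinalMk_eq_trdeg
    have hlt : Cardinal.mk s < Cardinal.aleph0 := hcard ▸ trdeg_lt_aleph0_of_finiteType
    have hsfin : s.Finite := Cardinal.lt_aleph0_iff_set_finite.1 hlt
    refine ⟨Subtype.val '' s, hsfin.image _, ?_, fun x => ?_⟩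
    · refine (Set.ncard_image_le hsfin).trans (le_of_eq ?_)
      have h1 : pdim R (RingHom.ker φ) = tdeg R φ.range :=
        tdeg_congr (Ideal.quotientKerEquivRange φ)
      rw [h1, tdeg, ← hcard]
      rfl
    · have halg := hs.isAlgebraic
      have h1 : IsAlgebraic (Algebra.adjoin R (Set.range ((↑) : s → φ.range))) (φ.rangeRestrict x) :=
        halg.isAlgebraic _
      rw [Subtype.range_coe] at h1
      obtain ⟨f, hf0, hf⟩ := h1
      let ρ : Algebra.adjoin R s →+* Algebra.adjoin R (Subtype.val '' s) :=
        (φ.range.val.toRingHom.comp (Algebra.adjoin R s).val.toRingHom).codRestrict _ (by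
          intro y
          change φ.range.val y ∈ Algebra.adjoin R (φ.range.val '' s)
          rw [← AlgHom.map_adjoin]
          exact ⟨y, y.2, rfl⟩)
      have hρ : Function.Injective ρ := by
        intro y y' hyy'
        have h2 : ((y : φ.range) : E) = (y' : φ.range) :=
          congrArg (fun z : Algebra.adjoin R (Subtype.val '' s) => (z : E)) hyy'
        exact Subtype.ext (Subtype.ext h2)
      refine ⟨f.map ρ, (Polynomial.map_ne_zero_iff hρ).2 hf0, ?_⟩
      have h3 := congrArg φ.range.val hf
      rw [map_zero, Polynomial.aeval_def] at h3
      change φ.range.val.toRingHom _ = 0 at h3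
      rw [Polynomial.hom_eval₂] at h3
      rw [Polynomial.aeval_def, Polynomial.eval₂_map]
      exact h3
  obtain ⟨s₁, hs₁, hc₁, ha₁⟩ := key φ₁
  obtain ⟨s₂, hs₂, hc₂, ha₂⟩ := key φ₂
  let s := s₁ ∪ s₂ ∪ T
  have hsfin : s.Finite := (hs₁.union hs₂).union hT
  have hmono : ∀ {s' : Set E} (_ : s' ⊆ s) {x : E}, IsAlgebraic (Algebra.adjoin R s') x →
      IsAlgebraic (Algebra.adjoin R s) x := by
    rintro s' hs' x ⟨f, hf0, hf⟩
    let ρ := Subalgebra.inclusion (Algebra.adjoin_mono (R := R) hs')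
    refine ⟨f.map ρ.toRingHom, (Polynomial.map_ne_zero_iff
      (Subalgebra.inclusion_injective _)).2 hf0, ?_⟩
    rw [Polynomial.aeval_def, Polynomial.eval₂_map]
    exact hf
  have hle : Algebra.adjoin R (Set.range φ₁ ∪ Set.range φ₂ ∪ T) ≤
      (Subalgebra.algebraicClosure (Algebra.adjoin R s) E).restrictScalars R := by
    refine Algebra.adjoin_le ?_
    rintro x ((⟨y, rfl⟩ | ⟨y, rfl⟩) | hx)
    · exact hmono (Set.subset_union_left.trans Set.subset_union_left) (ha₁ y)
    · exact hmono (Set.subset_union_right.trans Set.subset_union_left) (ha₂ y)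
    · exact isAlgebraic_algebraMap
        (⟨x, Algebra.subset_adjoin (Or.inr hx)⟩ : Algebra.adjoin R s)
  have halg : Algebra.IsAlgebraic (Algebra.adjoin R s) E := by
    refine ⟨fun x => ?_⟩
    have : x ∈ Algebra.adjoin R (Set.range φ₁ ∪ Set.range φ₂ ∪ T) := by
      rw [hgen]
      trivial
    exact hle this
  have h1 := tdeg_le_card (R := R) s hsfin
  have h2 : s.ncard ≤ s₁.ncard + s₂.ncard + T.ncard :=
    (Set.ncard_union_le _ _).trans (Nat.add_le_add_right (Set.ncard_union_le _ _) _)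
  omega

/-- An integral closed subset of a product of two schemes and a line has at most the dimension of
its projections to the two factors plus one for the line; the last contribution disappears where `t
= 1`. -/
lemma pdim_le_of_adjoin_eq_top {D₁ D₂ B : Type v} [CommRing D₁] [CommRing D₂] [CommRing B]
    [Algebra R D₁] [Algebra R D₂] [Algebra R B] [Algebra.FiniteType R D₁]
    [Algebra.FiniteType R D₂] (φ₁ : D₁ →ₐ[R] B) (φ₂ : D₂ →ₐ[R] B) (t : B)
    (hgen : Algebra.adjoin R (Set.range φ₁ ∪ Set.range φ₂ ∪ {t}) = ⊤)
    (Q : Ideal B) [Q.IsPrime] (hQ0 : Q.comap (algebraMap R B) = ⊥) :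
    pdim R Q ≤ pdim R (Q.comap φ₁) + pdim R (Q.comap φ₂) + 1 ∧
    (t - 1 ∈ Q → pdim R Q ≤ pdim R (Q.comap φ₁) + pdim R (Q.comap φ₂)) := by
  have hE := (injective_algebraMap_quotient_iff Q).2 hQ0
  let π := Ideal.Quotient.mkₐ R Q
  have hker : ∀ {D : Type v} [CommRing D] [Algebra R D] (φ : D →ₐ[R] B),
      RingHom.ker (π.comp φ) = Q.comap φ := fun φ => by
    ext x
    exact Ideal.Quotient.eq_zero_iff_mem
  have htop : Algebra.adjoin R (Set.range (π.comp φ₁) ∪ Set.range (π.comp φ₂) ∪ {π t}) = ⊤ := by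
    rw [AlgHom.coe_comp, AlgHom.coe_comp, Set.range_comp, Set.range_comp, ← Set.image_singleton,
      ← Set.image_union, ← Set.image_union, ← AlgHom.map_adjoin, hgen, Algebra.map_top,
      AlgHom.range_eq_top]
    exact Ideal.Quotient.mk_surjective
  rw [← hker, ← hker]
  constructor
  · have := tdeg_le_of_adjoin_eq_top (π.comp φ₁) (π.comp φ₂) hE {π t} (Set.finite_singleton _) htop
    rwa [Set.ncard_singleton] at this
  · intro h
    have := tdeg_le_of_adjoin_eq_top (π.comp φ₁) (π.comp φ₂) hE ∅ Set.finite_empty (by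
      have h1 : π t = 1 := by
        rw [← sub_eq_zero, ← map_one π, ← map_sub]
        exact Ideal.Quotient.eq_zero_iff_mem.2 h
      refine le_antisymm le_top (htop.ge.trans (Algebra.adjoin_le ?_))
      rintro x (hx | hx)
      · exact Algebra.subset_adjoin (Or.inl hx)
      · rw [Set.mem_singleton_iff.1 hx, h1]
        exact one_mem _)
    rwa [Set.ncard_empty, add_zero] at this

end compositum

/-! ### Incidence varieties and generic translations. -/

section

variable {R : Type v} [CommRing R] {d n : ℕ}

/-- The coordinate ring of the parameter space of the homotopy: `S[z₁, …, zₙ]` with further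
variables `t` (indexed by `none`) and `y₁, …, y_d`. -/
abbrev ParamRing (R : Type v) [CommRing R] (d n : ℕ) : Type v :=
  MvPolynomial (Option (Fin d)) (CubeRing (MvPolynomial (Fin d) R) n)

/-- The map `(x, t, z) ↦ ((x + t v, z), t, x)`. -/
def paramMap (v : Fin d → R) : ParamRing R d n →+* CubeRing (MvPolynomial (Fin d) R) (n + 1) :=
  MvPolynomial.eval₂Hom (shearMap v 0) fun o =>
    o.elim (MvPolynomial.X 0) fun j => MvPolynomial.C (MvPolynomial.X j)

lemma paramMap_C (v : Fin d → R) (a : CubeRing (MvPolynomial (Fin d) R) n) :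
    paramMap v (MvPolynomial.C a) = shearMap v 0 a := by
  simp [paramMap]

lemma paramMap_X_none (v : Fin d → R) :
    paramMap (n := n) v (MvPolynomial.X none) = MvPolynomial.X 0 := by
  simp [paramMap]

lemma paramMap_X_some (v : Fin d → R) (j : Fin d) :
    paramMap (n := n) v (MvPolynomial.X (some j)) = MvPolynomial.C (MvPolynomial.X j) := by
  simp [paramMap]

/-- The projection to the factor `𝔸ᵈ` with coordinates `y`. -/
def paramProj (R : Type v) [CommRing R] (d n : ℕ) : MvPolynomial (Fin d) R →ₐ[R] ParamRing R d n :=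
  MvPolynomial.aeval fun j => MvPolynomial.X (some j)

lemma paramProj_X (j : Fin d) :
    paramProj R d n (MvPolynomial.X j) = MvPolynomial.X (some j) := by
  simp [paramProj]

lemma paramMap_comp_algebraMap (v : Fin d → R) :
    (paramMap v).comp (algebraMap R (ParamRing R d n)) =
      algebraMap R (CubeRing (MvPolynomial (Fin d) R) (n + 1)) :=
  RingHom.ext fun a => (paramMap_C v _).trans (shearMap_C_C v 0 a)

lemma paramMap_paramProj (v : Fin d → R) (a : MvPolynomial (Fin d) R) :
    paramMap v (paramProj R d n a) = MvPolynomial.C a := by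
  have h : (paramMap v).comp (paramProj R d n).toRingHom = MvPolynomial.C := by
    refine MvPolynomial.ringHom_ext (fun a => ?_) fun j => ?_
    · change paramMap v (paramProj R d n _) = _
      rw [← MvPolynomial.algebraMap_eq, AlgHom.commutes]
      exact RingHom.congr_fun (paramMap_comp_algebraMap v) a
    · change paramMap v (paramProj R d n _) = _
      rw [paramProj_X, paramMap_X_some]
  exact RingHom.congr_fun h a

/-- The homotopy space is thus a closed subscheme of the parameter space, so dimensions of its
points can be estimated there. -/
lemma paramMap_surjective (v : Fin d → R) : Function.Surjective (paramMap (n := n) v) := by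
  intro x
  induction x using MvPolynomial.induction_on with
  | C a => exact ⟨_, paramMap_paramProj v a⟩
  | add x y hx hy =>
    obtain ⟨x, rfl⟩ := hx
    obtain ⟨y, rfl⟩ := hy
    exact ⟨x + y, map_add _ _ _⟩
  | mul_X x i hx =>
    obtain ⟨x, rfl⟩ := hx
    refine Fin.cases ?_ (fun l => ?_) i
    · exact ⟨x * MvPolynomial.X none, by rw [map_mul, paramMap_X_none]⟩
    · refine ⟨x * MvPolynomial.C (MvPolynomial.X l), ?_⟩
      rw [map_mul, paramMap_C, shearMap_X]
      rfl

variable [IsDomain R] [IsNoetherianRing R]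

instance : Algebra.FiniteType R (ParamRing R d n) :=
  Algebra.FiniteType.trans (S := CubeRing (MvPolynomial (Fin d) R) n) inferInstance inferInstance

lemma adjoin_paramRing :
    Algebra.adjoin R (Set.range (IsScalarTower.toAlgHom R (CubeRing (MvPolynomial (Fin d) R) n)
      (ParamRing R d n)) ∪ Set.range (paramProj R d n) ∪ {MvPolynomial.X none}) = ⊤ := by
  rw [_root_.eq_top_iff]
  rintro x -
  induction x using MvPolynomial.induction_on with
  | C a => exact Algebra.subset_adjoin (Or.inl (Or.inl ⟨a, rfl⟩))
  | add x y hx hy => exact add_mem hx hy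
  | mul_X x o hx =>
    refine mul_mem hx ?_
    rcases o with _ | j
    · exact Algebra.subset_adjoin (Or.inr rfl)
    · exact Algebra.subset_adjoin (Or.inl (Or.inr ⟨MvPolynomial.X j, paramProj_X j⟩))

lemma pdim_paramRing_le (Q : Ideal (ParamRing R d n)) [Q.IsPrime]
    (hQ0 : Q.comap (algebraMap R (ParamRing R d n)) = ⊥) :
    pdim R Q ≤ pdim R (Q.comap (MvPolynomial.C : CubeRing (MvPolynomial (Fin d) R) n →+* _)) +
      pdim R (Q.comap (paramProj R d n)) + 1 ∧
    (MvPolynomial.X none - 1 ∈ Q → pdim R Q ≤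
      pdim R (Q.comap (MvPolynomial.C : CubeRing (MvPolynomial (Fin d) R) n →+* _)) +
      pdim R (Q.comap (paramProj R d n))) :=
  pdim_le_of_adjoin_eq_top _ _ _ adjoin_paramRing Q hQ0

/-- The incidence conditions `(y, z) ∈ V(p) ∩ F`, `x ∈ V(ω)` (and `t = 1` if `F'` demands it). -/
def incidenceIdeal (p : PrimeSpectrum (CubeRing (MvPolynomial (Fin d) R) n))
    (ω : PrimeSpectrum (MvPolynomial (Fin d) R)) (F : Face (n + 1)) : Ideal (ParamRing R d n) :=
  (p.asIdeal ⊔ Ideal.span {f | ∃ (i : Fin n) (ε : Fin 2), F i.succ = some ε ∧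
      f = MvPolynomial.X i - MvPolynomial.C ((ε : ℕ) : MvPolynomial (Fin d) R)}).map
    MvPolynomial.C ⊔ ω.asIdeal.map (paramProj R d n) ⊔
    Ideal.span {f | F 0 = some 1 ∧ f = MvPolynomial.X none - 1}

lemma incidenceIdeal_le_iff {p : PrimeSpectrum (CubeRing (MvPolynomial (Fin d) R) n)}
    {ω : PrimeSpectrum (MvPolynomial (Fin d) R)} {F : Face (n + 1)}
    {Q : Ideal (ParamRing R d n)} [hQ : Q.IsPrime] :
    incidenceIdeal p ω F ≤ Q ↔ (p ≤ PrimeSpectrum.comap MvPolynomial.C ⟨Q, hQ⟩ ∧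
      PrimeSpectrum.comap MvPolynomial.C ⟨Q, hQ⟩ ∈ faceLocus (MvPolynomial (Fin d) R)
        fun i => F i.succ) ∧ ω.asIdeal ≤ Q.comap (paramProj R d n) ∧
      (F 0 = some 1 → MvPolynomial.X none - 1 ∈ Q) := by
  rw [incidenceIdeal, sup_le_iff, sup_le_iff, Ideal.map_le_iff_le_comap, sup_le_iff, and_assoc]
  refine and_congr (and_congr Iff.rfl ?_) (and_congr Ideal.map_le_iff_le_comap ?_)
  · rw [Ideal.span_le, mem_faceLocus]
    constructor
    · exact fun h i ε hF => h ⟨i, ε, hF, rfl⟩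
    · rintro h _ ⟨i, ε, hF, rfl⟩
      exact h i ε hF
  · rw [Ideal.span_le]
    constructor
    · exact fun h hF => h ⟨hF, rfl⟩
    · rintro h _ ⟨hF, rfl⟩
      exact h hF

/-- For a generic translation vector `v` in a given infinite set of coefficients, the inverse image
of finitely many cycles under `(x, t, z) ↦ (x + t v, z)` meets `W × F` properly away from
`t = 0`. -/
lemma exists_generic_translation {V : Set R} (hV : V.Infinite) {ι : Type*} [Finite ι] (n : ι → ℕ)
    (p : ∀ i, PrimeSpectrum (CubeRing (MvPolynomial (Fin d) R) (n i)))
    (ω : ι → PrimeSpectrum (MvPolynomial (Fin d) R))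
    (hp : ∀ i Q, p i ≤ Q → Q.asIdeal.comap
      (algebraMap R (CubeRing (MvPolynomial (Fin d) R) (n i))) = ⊥)
    (hface : ∀ i, FaceCondition (p i)) :
    ∃ v : Fin d → R, (∀ j, v j ∈ V) ∧ ∀ i (F : Face (n i + 1))
      (c : PrimeSpectrum (CubeRing (MvPolynomial (Fin d) R) (n i + 1))),
      c.asIdeal.comap (algebraMap R (CubeRing (MvPolynomial (Fin d) R) (n i + 1))) = ⊥ →
      ω i ≤ PrimeSpectrum.comap MvPolynomial.C c → c ∈ faceLocus _ F →
      MvPolynomial.X 0 ∉ c.asIdeal → p i ≤ PrimeSpectrum.comap (shearMap v 0) c →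
      pdim R c.asIdeal + F.codim + d ≤ pdim R (ω i).asIdeal + pdim R (p i).asIdeal + 1 := by
  -- Before the translation equations are imposed, the dimension is at most that of V(p) ∩ F plus
  -- that of V(ω), plus one for `t` unless F prescribes `t = 1`. The value `t = 0` is not counted,
  -- since only points with `t ≠ 0` are considered.
  have hdim : ∀ (iF : Σ i, Face (n i + 1)) (Q : Ideal (ParamRing R d (n iF.1))) [Q.IsPrime],
      incidenceIdeal (p iF.1) (ω iF.1) iF.2 ≤ Q →
      Q.comap (algebraMap R (ParamRing R d (n iF.1))) = ⊥ → MvPolynomial.X none ∉ Q →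
      pdim R Q + (if iF.2 0 = none then 0 else if iF.2 0 = some 1 then 1 else 0) +
        Face.codim (fun i => iF.2 i.succ) ≤
        pdim R (ω iF.1).asIdeal + pdim R (p iF.1).asIdeal + 1 := by
    rintro ⟨i, F⟩ Q hQ hIQ hQ0 ht
    obtain ⟨⟨h1, h2⟩, h3, h4⟩ := incidenceIdeal_le_iff.1 hIQ
    have h5 := (faceCondition_iff (hp i)).1 (hface i) _ _ h1 h2
    have h6 : pdim R (Q.comap (paramProj R d (n i))) ≤ pdim R (ω i).asIdeal := pdim_le_of_le h3
    obtain ⟨h7, h8⟩ := pdim_paramRing_le Q hQ0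
    change pdim R (Q.comap MvPolynomial.C) + _ ≤ _ at h5
    dsimp only at *
    split_ifs with hF hF'
    · omega
    · have := h8 (h4 hF')
      omega
    · omega
  -- The d hyperplane sections say that `t vⱼ` is the difference of the two points of affine space;
  -- their leading coefficient `t` is why `t = 0` must be excluded. All cycles and faces are treated
  -- simultaneously.
  obtain ⟨v, hvV, hv⟩ := exists_avoiding (R := R) (ι := Σ i, Face (n i + 1))
    (fun iF => ParamRing R d (n iF.1)) hV (fun iF => MvPolynomial.X none)
    (fun iF => pdim R (ω iF.1).asIdeal + pdim R (p iF.1).asIdeal + 1 - ((if iF.2 0 = none then 0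
      else if iF.2 0 = some 1 then 1 else 0) + Face.codim (fun i => iF.2 i.succ))) d 0
    (fun iF j => MvPolynomial.C (MvPolynomial.C (MvPolynomial.X j)) - MvPolynomial.X (some j))
    (fun iF => incidenceIdeal (p iF.1) (ω iF.1) iF.2) (by
      intro iF Q _ hIQ hQ0 ht
      have := hdim iF Q hIQ hQ0 ht
      omega)
  refine ⟨v, hvV, fun i F c hc0 hωc hcF ht hpc => ?_⟩
  let Q := c.asIdeal.comap (paramMap v)
  have hQ0 : Q.comap (algebraMap R (ParamRing R d (n i))) = ⊥ := by
    rw [comap_algebraMap_comap (paramMap_comp_algebraMap v), hc0]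
  have htQ : MvPolynomial.X none ∉ Q := by
    rw [Ideal.mem_comap, paramMap_X_none]
    exact ht
  have hIQ : incidenceIdeal (p i) (ω i) F ≤ Q := by
    refine incidenceIdeal_le_iff.2 ⟨⟨?_, ?_⟩, ?_, ?_⟩
    · intro x hx
      change paramMap v (MvPolynomial.C x) ∈ c.asIdeal
      rw [paramMap_C]
      exact hpc hx
    · rw [mem_faceLocus]
      intro l ε hl
      change paramMap v (MvPolynomial.C _) ∈ c.asIdeal
      rw [paramMap_C, map_sub, shearMap_X]
      have h1 := mem_faceLocus.1 hcF _ ε hl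
      have h2 : shearMap v 0 (MvPolynomial.C (((ε : ℕ) : MvPolynomial (Fin d) R)) :
          CubeRing (MvPolynomial (Fin d) R) (n i)) = MvPolynomial.C ((ε : ℕ) : MvPolynomial (Fin d) R) := by
        simp
      rw [h2]
      exact h1
    · intro x hx
      change paramMap v (paramProj R d (n i) x) ∈ c.asIdeal
      rw [paramMap_paramProj]
      exact hωc hx
    · intro hF
      have h1 := mem_faceLocus.1 hcF 0 1 hF
      change paramMap v _ ∈ c.asIdeal
      rw [map_sub, paramMap_X_none, map_one]
      simpa using h1
  have h1 := hv ⟨i, F⟩ Q hIQ hQ0 htQ (by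
    intro j
    change paramMap v _ ∈ c.asIdeal
    have h2 : paramMap (n := n i) v (algebraMap R _ (v j)) =
        MvPolynomial.C (MvPolynomial.C (v j)) :=
      RingHom.congr_fun (paramMap_comp_algebraMap (n := n i) v) (v j)
    rw [map_sub, map_mul, map_sub, paramMap_X_none, paramMap_X_some, paramMap_C, shearMap_C_X, h2]
    ring_nf
    exact zero_mem _)
  -- Needed again at this point to see that the truncated subtraction in the bound `h1` is a true
  -- one.
  have h2 := hdim ⟨i, F⟩ Q hIQ hQ0 htQ
  have h3 : pdim R Q = pdim R c.asIdeal :=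
    pdim_comap_of_surjective (paramMap_surjective v) (paramMap_comp_algebraMap v) _
  have h4 := codim_succAbove F 0
  -- The two counts differ only for `F 0 = some 0`, but then `t` vanishes at `c`, which is excluded.
  have h5 : (if (F 0).isSome then 1 else 0) =
      (if F 0 = none then 0 else if F 0 = some 1 then 1 else 0) := by
    rcases h0 : F 0 with _ | ε
    · rfl
    · fin_cases ε
      · have h6 := mem_faceLocus.1 hcF 0 0 h0
        exact absurd (by simpa using h6) ht
      · rfl
  simp only [Fin.succAbove_zero] at h4
  dsimp only at h1 h2
  rw [h3] at h1 h2
  rw [h5] at h4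
  omega

end

/-! ### Admissible prime cycles -/

/-! ### Pull-back along polynomial extensions. -/

section functoriality

variable {A B C : Type v} [CommRing A] [CommRing B] [CommRing C] [IsNoetherianRing A]
  [IsNoetherianRing B] [IsNoetherianRing C]

lemma pullback_id (Z : Cycle A) : pullback (RingHom.id A) Z = Z := by
  refine map_eq_of_forall_single (pullback (RingHom.id A)) (AddMonoidHom.id _) Z fun p _ => ?_
  rw [pullback_single, one_smul, pullbackPrime_of_isPrime _ _ (by rw [Ideal.map_id]; exact p.2)]
  simp only [Ideal.map_id]
  rfl

lemma IsPolynomialExtension.pullbackPrime {φ : A →+* B} {t : B} (h : IsPolynomialExtension φ t)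
    (p : PrimeSpectrum A) :
    pullbackPrime φ p = Finsupp.single ⟨p.asIdeal.map φ, (h.isPrime_map _ p.2).1⟩ 1 :=
  pullbackPrime_of_isPrime φ p _

lemma pullback_pullback_of_isPolynomialExtension {φ : A →+* B} {t : B}
    (h : IsPolynomialExtension φ t) (ψ : B →+* C) (Z : Cycle A) :
    pullback ψ (pullback φ Z) = pullback (ψ.comp φ) Z := by
  refine map_eq_of_forall_single ((pullback ψ).comp (pullback φ)) (pullback (ψ.comp φ)) Z
    fun p _ => ?_
  rw [AddMonoidHom.comp_apply, pullback_single, pullback_single, one_smul, one_smul,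
    pullback_pullbackPrime_of_isPrime φ ψ p (h.isPrime_map _ p.2).1]

lemma pullback_isPolynomialExtension_pullback (φ : A →+* B) {ψ : B →+* C} {t : C}
    (h : IsPolynomialExtension ψ t) (Z : Cycle A) :
    pullback ψ (pullback φ Z) = pullback (ψ.comp φ) Z := by
  refine map_eq_of_forall_single ((pullback ψ).comp (pullback φ)) (pullback (ψ.comp φ)) Z
    fun p _ => ?_
  rw [AddMonoidHom.comp_apply, pullback_single, pullback_single, one_smul, one_smul,
    pullback_pullbackPrime_of_flat φ ψ h.flat h.isPrime_map p]

end functoriality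

section admissible

variable {R : Type v} [CommRing R] [IsDomain R] [IsDiscreteValuationRing R] {u : R} {d n r : ℕ}

/-- Every nonzero element of R is a unit times a power of `u`, so a prime not containing `u`
contains no nonzero element of R. Together with `ModulusCondition.notMem` this puts all points of a
cycle with modulus over the generic point of Spec R. -/
lemma comap_algebraMap_eq_bot (hu : Irreducible u) {A : Type v} [CommRing A] [Algebra R A]
    {Q : Ideal A} [Q.IsPrime] (h : algebraMap R A u ∉ Q) : Q.comap (algebraMap R A) = ⊥ := by
  rw [eq_bot_iff]
  intro x hx
  by_contra hx0
  obtain ⟨m, hm⟩ := IsDiscreteValuationRing.associated_pow_irreducible hx0 hu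
  have h1 : algebraMap R A (u ^ m) ∈ Q := (Q.comap (algebraMap R A)).mem_of_dvd hm.dvd hx
  rw [map_pow] at h1
  exact h (Ideal.IsPrime.mem_of_pow_mem inferInstance m h1)

/-- The conditions on the components of a cycle in `cyclesWithModulus`. -/
def Admissible (u : R) (r : ℕ) (p : PrimeSpectrum (CubeRing (MvPolynomial (Fin d) R) n)) : Prop :=
  p.asIdeal.height = r ∧ FaceCondition p ∧ ModulusCondition (MvPolynomial.C u) p

lemma mem_cyclesWithModulus_iff {V : Cycle (CubeRing (MvPolynomial (Fin d) R) n)} :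
    V ∈ cyclesWithModulus (MvPolynomial.C u) r n ↔ ∀ p ∈ V.support, Admissible u r p :=
  Iff.rfl

lemma single_mem_cyclesWithModulus {p : PrimeSpectrum (CubeRing (MvPolynomial (Fin d) R) n)}
    (hp : Admissible u r p) (m : ℤ) :
    Finsupp.single p m ∈ cyclesWithModulus (MvPolynomial.C u) r n := by
  rw [mem_cyclesWithModulus_iff]
  intro q hq
  rw [Finset.mem_singleton.1 (Finsupp.support_single_subset hq)]
  exact hp

lemma tdeg_cubeRing : tdeg R (CubeRing (MvPolynomial (Fin d) R) n) = d + n := by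
  rw [tdeg_mvPolynomial, tdeg_mvPolynomial, Fintype.card_fin, Fintype.card_fin]
  simp [tdeg, trdeg_eq_zero]

lemma height_eq_iff {p : PrimeSpectrum (CubeRing (MvPolynomial (Fin d) R) n)}
    (hp : p.asIdeal.comap (algebraMap R (CubeRing (MvPolynomial (Fin d) R) n)) = ⊥) :
    p.asIdeal.height = r ↔ pdim R p.asIdeal + r = d + n := by
  have h := height_add_pdim (R := R) p.asIdeal hp
  rw [tdeg_cubeRing] at h
  have hfin : p.asIdeal.height ≠ ⊤ := fun h' => by
    rw [h', top_add] at h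
    exact ENat.natCast_ne_top _ h.symm
  obtain ⟨m, hm⟩ := ENat.ne_top_iff_exists.1 hfin
  rw [← hm] at h ⊢
  have h' : m + pdim R p.asIdeal = d + n := by exact_mod_cast h
  rw [Nat.cast_inj]
  omega

namespace Admissible

variable {p : PrimeSpectrum (CubeRing (MvPolynomial (Fin d) R) n)}

lemma comap_eq_bot (hu : Irreducible u) (h : Admissible u r p)
    {Q : PrimeSpectrum (CubeRing (MvPolynomial (Fin d) R) n)} (hQ : p ≤ Q) :
    Q.asIdeal.comap (algebraMap R (CubeRing (MvPolynomial (Fin d) R) n)) = ⊥ :=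
  comap_algebraMap_eq_bot hu (h.2.2.notMem hQ)

lemma pdim_add (hu : Irreducible u) (h : Admissible u r p) : pdim R p.asIdeal + r = d + n :=
  (height_eq_iff (h.comap_eq_bot hu le_rfl)).1 h.1

lemma pdim_add_codim_le (hu : Irreducible u) (h : Admissible u r p) {F : Face n}
    {Q : PrimeSpectrum (CubeRing (MvPolynomial (Fin d) R) n)} (hQ : p ≤ Q)
    (hQF : Q ∈ faceLocus _ F) : pdim R Q.asIdeal + F.codim ≤ pdim R p.asIdeal :=
  (faceCondition_iff fun _ hQ => h.comap_eq_bot hu hQ).1 h.2.1 F Q hQ hQF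

end Admissible

lemma comap_faceMap_mem_faceLocus_insert {S : Type v} [CommRing S] {i : Fin (n + 1)} {ε : Fin 2}
    {F : Face n} {Q : PrimeSpectrum (CubeRing S n)} (hQ : Q ∈ faceLocus S F) :
    PrimeSpectrum.comap (faceMap S i ε) Q ∈ faceLocus S (F.insert i ε) := by
  rw [comap_faceMap_mem_faceLocus_iff (Or.inr (by simp [Face.insert]))]
  simpa [Face.insert] using hQ

lemma pdim_comap_faceMap (i : Fin (n + 1)) (ε : Fin 2)
    (Q : Ideal (CubeRing (MvPolynomial (Fin d) R) n)) :
    pdim R (Q.comap (faceMap (MvPolynomial (Fin d) R) i ε)) = pdim R Q :=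
  pdim_comap_of_surjective (faceMap_surjective i ε) (faceMap_comp_algebraMap i ε) Q

lemma mem_faceLocus_single_iff {S : Type v} [CommRing S] {i : Fin (n + 1)} {ε : Fin 2}
    {Q : PrimeSpectrum (CubeRing S (n + 1))} :
    Q ∈ faceLocus S (Face.insert i ε fun _ => none) ↔
      MvPolynomial.X i - MvPolynomial.C ((ε : ℕ) : S) ∈ Q.asIdeal := by
  rw [mem_faceLocus]
  constructor
  · exact fun h => h i ε (by simp [Face.insert])
  · intro h l δ hl
    rcases Fin.eq_self_or_eq_succAbove i l with rfl | ⟨j, rfl⟩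
    · obtain rfl : ε = δ := by simpa [Face.insert] using hl
      exact h
    · simp [Face.insert] at hl

lemma codim_none (n : ℕ) : Face.codim (fun _ : Fin n => none) = 0 := by
  simp [Face.codim]

/-- An admissible cycle contains no face `zᵢ = ε`. -/
lemma Admissible.notMem (hu : Irreducible u)
    {p : PrimeSpectrum (CubeRing (MvPolynomial (Fin d) R) (n + 1))} (hp : Admissible u r p)
    (i : Fin (n + 1)) (ε : Fin 2) :
    MvPolynomial.X i - MvPolynomial.C ((ε : ℕ) : MvPolynomial (Fin d) R) ∉ p.asIdeal := by
  intro h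
  have h1 := hp.pdim_add_codim_le hu le_rfl (mem_faceLocus_single_iff.2 h)
  rw [codim_insert, codim_none] at h1
  omega

/-- The components of the restriction of an admissible cycle to a face are admissible. -/
lemma Admissible.face (hu : Irreducible u)
    {p : PrimeSpectrum (CubeRing (MvPolynomial (Fin d) R) (n + 1))} (hp : Admissible u r p)
    {i : Fin (n + 1)} {ε : Fin 2} {q : PrimeSpectrum (CubeRing (MvPolynomial (Fin d) R) n)}
    (hq : q ∈ minPrimes (p.asIdeal.map (faceMap (MvPolynomial (Fin d) R) i ε))) :
    Admissible u r q ∧ p ≤ PrimeSpectrum.comap (faceMap (MvPolynomial (Fin d) R) i ε) q := by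
  have hpq : p ≤ PrimeSpectrum.comap (faceMap (MvPolynomial (Fin d) R) i ε) q :=
    Ideal.map_le_iff_le_comap.1 (mem_minPrimes.1 hq).1.2
  have hmod := hp.2.2.of_le_comap_faceMap hpq
  have hq0 : ∀ Q, q ≤ Q → Q.asIdeal.comap
      (algebraMap R (CubeRing (MvPolynomial (Fin d) R) n)) = ⊥ :=
    fun Q hQ => comap_algebraMap_eq_bot hu (hmod.notMem hQ)
  have hmin : (PrimeSpectrum.comap (faceMap (MvPolynomial (Fin d) R) i ε) q).asIdeal ∈
      (p.asIdeal ⊔ Ideal.span {MvPolynomial.X i -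
        MvPolynomial.C ((ε : ℕ) : MvPolynomial (Fin d) R)}).minimalPrimes := by
    rw [← ker_faceMap, ← Ideal.comap_map_of_surjective' _ (faceMap_surjective i ε),
      Ideal.comap_minimalPrimes_eq_of_surjective (faceMap_surjective i ε)]
    exact ⟨_, mem_minPrimes.1 hq, rfl⟩
  have hdim := pdim_add_one_of_mem_minimalPrimes (hp.notMem hu i ε) hmin (hp.comap_eq_bot hu hpq)
  rw [PrimeSpectrum.comap_asIdeal, pdim_comap_faceMap] at hdim
  refine ⟨⟨?_, ?_, hmod⟩, hpq⟩
  · rw [height_eq_iff (hq0 q le_rfl)]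
    have := hp.pdim_add hu
    omega
  · rw [faceCondition_iff hq0]
    intro F Q hqQ hQF
    have h1 := hp.pdim_add_codim_le hu (hpq.trans (Ideal.comap_mono hqQ))
      (comap_faceMap_mem_faceLocus_insert (i := i) (ε := ε) hQF)
    rw [codim_insert, PrimeSpectrum.comap_asIdeal, pdim_comap_faceMap] at h1
    omega

/-- The inverse image of a prime cycle under `(x, z) ↦ (x + zᵢ v, (zₗ)_{l ≠ i})`. -/
def shearPrime (v : Fin d → R) (i : Fin (n + 1))
    (p : PrimeSpectrum (CubeRing (MvPolynomial (Fin d) R) n)) :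
    PrimeSpectrum (CubeRing (MvPolynomial (Fin d) R) (n + 1)) :=
  ⟨p.asIdeal.map (shearMap v i), ((isPolynomialExtension_shearMap v i).isPrime_map _ p.2).1⟩

lemma comap_shearPrime (v : Fin d → R) (i : Fin (n + 1))
    (p : PrimeSpectrum (CubeRing (MvPolynomial (Fin d) R) n)) :
    PrimeSpectrum.comap (shearMap v i) (shearPrime v i p) = p :=
  PrimeSpectrum.ext ((isPolynomialExtension_shearMap v i).isPrime_map _ p.2).2

lemma shearPrime_le_iff {v : Fin d → R} {i : Fin (n + 1)}
    {p : PrimeSpectrum (CubeRing (MvPolynomial (Fin d) R) n)}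
    {Q : PrimeSpectrum (CubeRing (MvPolynomial (Fin d) R) (n + 1))} :
    shearPrime v i p ≤ Q ↔ p ≤ PrimeSpectrum.comap (shearMap v i) Q :=
  Ideal.map_le_iff_le_comap

/-- The inverse image has dimension one more than V(p). A point of it on F projects to V(p) on the
face with the condition on `zᵢ` dropped. The projection lowers its dimension by at most one, and not
at all if F prescribes `zᵢ`, so the face condition carries over. -/
lemma Admissible.shear (hu : Irreducible u)
    {p : PrimeSpectrum (CubeRing (MvPolynomial (Fin d) R) n)} (hp : Admissible u r p)
    {v : Fin d → R} (hv : ∀ j, u ∣ v j) (i : Fin (n + 1)) : Admissible u r (shearPrime v i p) := by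
  have hmod := hp.2.2.of_shearMap hv i (comap_shearPrime v i p)
  have hP0 : ∀ Q, shearPrime v i p ≤ Q → Q.asIdeal.comap
      (algebraMap R (CubeRing (MvPolynomial (Fin d) R) (n + 1))) = ⊥ :=
    fun Q hQ => comap_algebraMap_eq_bot hu (hmod.notMem hQ)
  have hpoly := isPolynomialExtension_shearMap v i
  have hdim : pdim R (shearPrime v i p).asIdeal = pdim R p.asIdeal + 1 :=
    hpoly.pdim_map (shearMap_comp_algebraMap v i) p.asIdeal (hp.comap_eq_bot hu le_rfl)
  refine ⟨?_, ?_, hmod⟩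
  · rw [height_eq_iff (hP0 _ le_rfl)]
    have := hp.pdim_add hu
    omega
  · rw [faceCondition_iff hP0]
    intro F Q hPQ hQF
    have hQF' : PrimeSpectrum.comap (shearMap v i) Q ∈ faceLocus _ fun j => F (i.succAbove j) := by
      rw [mem_faceLocus]
      intro j ε hj
      have h1 := mem_faceLocus.1 hQF _ ε hj
      rw [PrimeSpectrum.comap_asIdeal, Ideal.mem_comap, map_sub, shearMap_X]
      convert h1 using 2
      simp
    have h1 := hp.pdim_add_codim_le hu (shearPrime_le_iff.1 hPQ) hQF'
    rw [PrimeSpectrum.comap_asIdeal] at h1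
    rw [codim_succAbove F i, hdim]
    rcases hFi : F i with _ | ε
    · have h2 := hpoly.pdim_le_comap_add_one (shearMap_comp_algebraMap v i) Q.asIdeal
        (hP0 Q hPQ)
      simp only [Option.isSome_none, Bool.false_eq_true, if_false]
      omega
    · have h2 := hpoly.pdim_le_comap (shearMap_comp_algebraMap v i) Q.asIdeal
        (b := MvPolynomial.C ((ε : ℕ) : MvPolynomial (Fin d) R)) (by
          have h3 := mem_faceLocus.1 hQF i ε hFi
          convert h3 using 2
          simp)
      simp only [Option.isSome_some, if_true]
      omega

end admissible

/-! ### The cycle complex -/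

section complex

variable {R : Type v} [CommRing R] [IsDomain R] [IsDiscreteValuationRing R] {u : R} {d n r : ℕ}

lemma pullback_faceMap_mem (hu : Irreducible u) (i : Fin (n + 1)) (ε : Fin 2)
    {V : Cycle (CubeRing (MvPolynomial (Fin d) R) (n + 1))}
    (hV : V ∈ cyclesWithModulus (MvPolynomial.C u) r (n + 1)) :
    pullback (faceMap _ i ε) V ∈ cyclesWithModulus (MvPolynomial.C u) r n := by
  refine map_mem_of_forall_single _ _ V fun p hp => ?_
  rw [pullback_single, one_smul, mem_cyclesWithModulus_iff]
  exact fun q hq => ((mem_cyclesWithModulus_iff.1 hV p hp).face hu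
    (mem_minPrimes_of_mem_support hq)).1

lemma pullback_shearMap_single (v : Fin d → R) (i : Fin (n + 1))
    (p : PrimeSpectrum (CubeRing (MvPolynomial (Fin d) R) n)) :
    pullback (shearMap v i) (Finsupp.single p 1) = Finsupp.single (shearPrime v i p) 1 := by
  rw [pullback_single, one_smul, (isPolynomialExtension_shearMap v i).pullbackPrime]
  rfl

lemma pullback_shearMap_mem (hu : Irreducible u) {v : Fin d → R} (hv : ∀ j, u ∣ v j)
    (i : Fin (n + 1)) {V : Cycle (CubeRing (MvPolynomial (Fin d) R) n)}
    (hV : V ∈ cyclesWithModulus (MvPolynomial.C u) r n) :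
    pullback (shearMap v i) V ∈ cyclesWithModulus (MvPolynomial.C u) r (n + 1) := by
  refine map_mem_of_forall_single _ _ V fun p hp => ?_
  rw [pullback_shearMap_single]
  exact single_mem_cyclesWithModulus ((mem_cyclesWithModulus_iff.1 hV p hp).shear hu hv i) 1

lemma pullback_degeneracyMap_mem (hu : Irreducible u) (i : Fin (n + 1))
    {V : Cycle (CubeRing (MvPolynomial (Fin d) R) n)}
    (hV : V ∈ cyclesWithModulus (MvPolynomial.C u) r n) :
    pullback (degeneracyMap _ i) V ∈ cyclesWithModulus (MvPolynomial.C u) r (n + 1) := by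
  rw [← shearMap_zero]
  exact pullback_shearMap_mem hu (fun _ => dvd_zero u) i hV

lemma isPolynomialExtension_degeneracyMap (i : Fin (n + 1)) :
    IsPolynomialExtension (degeneracyMap (MvPolynomial (Fin d) R) i) (MvPolynomial.X i) := by
  rw [← shearMap_zero]
  exact isPolynomialExtension_shearMap 0 i

lemma boundary_apply (V : Cycle (CubeRing (MvPolynomial (Fin d) R) (n + 1))) :
    boundary _ n V = ∑ i : Fin (n + 1), (-1 : ℤ) ^ (i : ℕ) •
      (pullback (faceMap _ i 1) V - pullback (faceMap _ i 0) V) := by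
  simp [boundary]

lemma boundary_mem (hu : Irreducible u) {V : Cycle (CubeRing (MvPolynomial (Fin d) R) (n + 1))}
    (hV : V ∈ cyclesWithModulus (MvPolynomial.C u) r (n + 1)) :
    boundary _ n V ∈ cyclesWithModulus (MvPolynomial.C u) r n := by
  rw [boundary_apply]
  exact sum_mem fun i _ => zsmul_mem
    (sub_mem (pullback_faceMap_mem hu i 1 hV) (pullback_faceMap_mem hu i 0 hV)) _

lemma degenerateCycles_le (hu : Irreducible u) (n : ℕ) :
    degenerateCycles (S := MvPolynomial (Fin d) R) (MvPolynomial.C u) r n ≤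
      cyclesWithModulus (MvPolynomial.C u) r n := by
  cases n with
  | zero => exact bot_le
  | succ n =>
    refine iSup_le fun i => ?_
    rintro _ ⟨V, hV, rfl⟩
    exact pullback_degeneracyMap_mem hu i hV

lemma pullback_degeneracyMap_mem_degenerateCycles (i : Fin (n + 1))
    {V : Cycle (CubeRing (MvPolynomial (Fin d) R) n)}
    (hV : V ∈ cyclesWithModulus (MvPolynomial.C u) r n) :
    pullback (degeneracyMap _ i) V ∈
      degenerateCycles (S := MvPolynomial (Fin d) R) (MvPolynomial.C u) r (n + 1) :=
  (le_iSup (fun i : Fin (n + 1) => (cyclesWithModulus (MvPolynomial.C u) r n).map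
    (pullback (degeneracyMap (MvPolynomial (Fin d) R) i))) i) ⟨V, hV, rfl⟩

/-- To prove that a homomorphism maps degenerate cycles into a subgroup, it suffices to consider
the pull-backs along the projections. -/
lemma map_mem_of_mem_degenerateCycles {G : Type*} [AddCommGroup G] (H : AddSubgroup G)
    (f : Cycle (CubeRing (MvPolynomial (Fin d) R) (n + 1)) →+ G)
    (h : ∀ (i : Fin (n + 1)), ∀ V ∈ cyclesWithModulus (MvPolynomial.C u) r n,
      f (pullback (degeneracyMap _ i) V) ∈ H)
    {V : Cycle (CubeRing (MvPolynomial (Fin d) R) (n + 1))}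
    (hV : V ∈ degenerateCycles (S := MvPolynomial (Fin d) R) (MvPolynomial.C u) r (n + 1)) :
    f V ∈ H := by
  have hle : degenerateCycles (S := MvPolynomial (Fin d) R) (MvPolynomial.C u) r (n + 1) ≤
      H.comap f := by
    refine iSup_le fun i => ?_
    rintro _ ⟨W, hW, rfl⟩
    exact h i W hW
  exact hle hV

lemma pullback_faceMap_degeneracyMap_same (i : Fin (n + 1)) (ε : Fin 2)
    (V : Cycle (CubeRing (MvPolynomial (Fin d) R) n)) :
    pullback (faceMap _ i ε) (pullback (degeneracyMap _ i) V) = V := by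
  rw [pullback_pullback_of_isPolynomialExtension (isPolynomialExtension_degeneracyMap i),
    faceMap_comp_degeneracyMap_same, pullback_id]

lemma pullback_faceMap_shearMap_succAbove (v : Fin d → R) (i : Fin (n + 2)) (j : Fin (n + 1))
    (ε : Fin 2) (V : Cycle (CubeRing (MvPolynomial (Fin d) R) (n + 1))) :
    pullback (faceMap _ (i.succAbove j) ε) (pullback (shearMap v i) V) =
      pullback (shearMap v (j.predAbove i)) (pullback (faceMap _ j ε) V) := by
  rw [pullback_pullback_of_isPolynomialExtension (isPolynomialExtension_shearMap v i),
    pullback_isPolynomialExtension_pullback _ (isPolynomialExtension_shearMap v _),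
    faceMap_comp_shearMap_succAbove]

lemma pullback_faceMap_degeneracyMap_mem (hu : Irreducible u) (i l : Fin (n + 2)) (hil : l ≠ i)
    (ε : Fin 2) {V : Cycle (CubeRing (MvPolynomial (Fin d) R) (n + 1))}
    (hV : V ∈ cyclesWithModulus (MvPolynomial.C u) r (n + 1)) :
    pullback (faceMap _ l ε) (pullback (degeneracyMap _ i) V) ∈
      degenerateCycles (S := MvPolynomial (Fin d) R) (MvPolynomial.C u) r (n + 1) := by
  obtain ⟨j, rfl⟩ := Fin.exists_succAbove_eq hil
  rw [← shearMap_zero, pullback_faceMap_shearMap_succAbove, shearMap_zero]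
  exact pullback_degeneracyMap_mem_degenerateCycles _ (pullback_faceMap_mem hu j ε hV)

/-- The two faces in the direction of a degeneracy give back the same cycle and cancel; those in the
other directions are degenerate again. -/
lemma boundary_degenerate_mem (hu : Irreducible u) (n : ℕ)
    {V : Cycle (CubeRing (MvPolynomial (Fin d) R) (n + 1))}
    (hV : V ∈ degenerateCycles (S := MvPolynomial (Fin d) R) (MvPolynomial.C u) r (n + 1)) :
    boundary _ n V ∈
      degenerateCycles (S := MvPolynomial (Fin d) R) (MvPolynomial.C u) r n := by
  refine map_mem_of_mem_degenerateCycles _ (boundary _ n) (fun i W hW => ?_) hV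
  rw [boundary_apply]
  refine sum_mem fun l _ => zsmul_mem ?_ _
  by_cases hil : l = i
  · subst hil
    rw [pullback_faceMap_degeneracyMap_same, pullback_faceMap_degeneracyMap_same, sub_self]
    exact zero_mem _
  · cases n with
    | zero => exact absurd (Subsingleton.elim (α := Fin 1) l i) hil
    | succ n =>
      exact sub_mem (pullback_faceMap_degeneracyMap_mem hu i l hil 1 hW)
        (pullback_faceMap_degeneracyMap_mem hu i l hil 0 hW)

/-- Restricting an admissible cycle to two different faces successively in either order gives the
same result. -/
lemma pullback_faceMap_comm (hu : Irreducible u) (i : Fin (n + 2)) (j : Fin (n + 1)) (ε δ : Fin 2)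
    {V : Cycle (CubeRing (MvPolynomial (Fin d) R) (n + 2))}
    (hV : V ∈ cyclesWithModulus (MvPolynomial.C u) r (n + 2)) :
    pullback (faceMap _ j δ) (pullback (faceMap _ i ε) V) =
      pullback (faceMap _ (j.predAbove i) ε) (pullback (faceMap _ (i.succAbove j) δ) V) := by
  refine map_eq_of_forall_single ((pullback (faceMap _ j δ)).comp (pullback (faceMap _ i ε)))
    ((pullback (faceMap _ (j.predAbove i) ε)).comp (pullback (faceMap _ (i.succAbove j) δ))) V
    fun p hp => ?_
  have hp' := mem_cyclesWithModulus_iff.1 hV p hp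
  rw [AddMonoidHom.comp_apply, AddMonoidHom.comp_apply, pullback_single, pullback_single, one_smul,
    one_smul]
  -- By the face condition for the codimension two face, intersecting with both hyperplanes lowers
  -- the dimension by at least two, while each single step lowers it by exactly one. So the second
  -- hyperplane contains no component of the first intersection, and the components obtained
  -- successively are those of the double intersection.
  have key : ∀ (i l : Fin (n + 2)) (ε δ : Fin 2), l ≠ i → ∀ P ∈ minPrimes (p.asIdeal ⊔
      Ideal.span {MvPolynomial.X i - MvPolynomial.C ((ε : ℕ) : MvPolynomial (Fin d) R)}),
      MvPolynomial.X l - MvPolynomial.C ((δ : ℕ) : MvPolynomial (Fin d) R) ∉ P.asIdeal ∧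
      ∀ Q ∈ minPrimes (P.asIdeal ⊔
        Ideal.span {MvPolynomial.X l - MvPolynomial.C ((δ : ℕ) : MvPolynomial (Fin d) R)}),
        Q ∈ minPrimes (p.asIdeal ⊔
          Ideal.span {MvPolynomial.X i - MvPolynomial.C ((ε : ℕ) : MvPolynomial (Fin d) R)} ⊔
          Ideal.span {MvPolynomial.X l - MvPolynomial.C ((δ : ℕ) : MvPolynomial (Fin d) R)}) := by
    intro i l ε δ hil P hP
    obtain ⟨j, rfl⟩ := Fin.exists_succAbove_eq hil
    rw [mem_minPrimes] at hP
    have hpP : p ≤ P := le_sup_left.trans hP.1.2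
    have hcodim : ∀ Q, p ≤ Q →
        MvPolynomial.X i - MvPolynomial.C ((ε : ℕ) : MvPolynomial (Fin d) R) ∈ Q.asIdeal →
        MvPolynomial.X (i.succAbove j) - MvPolynomial.C ((δ : ℕ) : MvPolynomial (Fin d) R) ∈
          Q.asIdeal → pdim R Q.asIdeal + 2 ≤ pdim R p.asIdeal := by
      intro Q hpQ h1 h2
      have h3 : Q ∈ faceLocus _ (Face.insert i ε (Face.insert j δ fun _ => none)) := by
        rw [mem_faceLocus]
        intro l ε' hl
        rcases Fin.eq_self_or_eq_succAbove i l with rfl | ⟨k, rfl⟩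
        · obtain rfl : ε = ε' := by simpa [Face.insert] using hl
          exact h1
        · rcases Fin.eq_self_or_eq_succAbove j k with rfl | ⟨k, rfl⟩
          · obtain rfl : δ = ε' := by simpa [Face.insert] using hl
            exact h2
          · simp [Face.insert] at hl
      have h4 := hp'.pdim_add_codim_le hu hpQ h3
      rwa [codim_insert, codim_insert, codim_none] at h4
    have hPi : MvPolynomial.X i - MvPolynomial.C ((ε : ℕ) : MvPolynomial (Fin d) R) ∈ P.asIdeal :=
      hP.1.2 (Ideal.mem_sup_right (Ideal.mem_span_singleton_self _))
    have hdim := pdim_add_one_of_mem_minimalPrimes (hp'.notMem hu i ε) hP (hp'.comap_eq_bot hu hpP)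
    have hPl : MvPolynomial.X (i.succAbove j) -
        MvPolynomial.C ((δ : ℕ) : MvPolynomial (Fin d) R) ∉ P.asIdeal := by
      intro h
      have := hcodim P hpP hPi h
      omega
    refine ⟨hPl, fun Q hQ => ?_⟩
    rw [mem_minPrimes] at hQ ⊢
    have hPQ : P ≤ Q := le_sup_left.trans hQ.1.2
    have hdimQ := pdim_add_one_of_mem_minimalPrimes hPl hQ (hp'.comap_eq_bot hu (hpP.trans hPQ))
    refine ⟨⟨Q.2, sup_le (hP.1.2.trans hPQ) (le_sup_right.trans hQ.1.2)⟩, ?_⟩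
    rintro J ⟨hJ, hJle⟩ hJQ
    have h1 := hcodim ⟨J, hJ⟩ (le_sup_left.trans (le_sup_left.trans hJle))
      (hJle (Ideal.mem_sup_left (Ideal.mem_sup_right (Ideal.mem_span_singleton_self _))))
      (hJle (Ideal.mem_sup_right (Ideal.mem_span_singleton_self _)))
    exact (eq_of_le_of_pdim_le hJQ (hp'.comap_eq_bot hu (hpP.trans hPQ)) (by
      change pdim R J + 2 ≤ _ at h1
      omega)).ge
  have hne := Fin.succAbove_ne i j
  refine pullback_pullbackPrime_comm (faceMap_comp_faceMap i j ε δ) (faceMap_surjective _ _)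
    (faceMap_surjective _ _) (faceMap_surjective _ _) (faceMap_surjective _ _)
    (ker_faceMap i ε) (b := MvPolynomial.X (i.succAbove j) -
      MvPolynomial.C ((δ : ℕ) : MvPolynomial (Fin d) R)) ?_ (ker_faceMap _ δ) ?_ p
    (hp'.notMem hu _ _) (hp'.notMem hu _ _) (fun P hP => (key _ _ _ _ hne P hP).1)
    (fun P hP => (key _ _ _ _ hne.symm P hP).1) (fun P hP => (key _ _ _ _ hne P hP).2)
    (fun P hP => (key _ _ _ _ hne.symm P hP).2)
  · rw [ker_faceMap, map_sub, faceMap_X_succAbove, faceMap_C]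
  · have h1 := faceMap_X_succAbove (S := MvPolynomial (Fin d) R) (i.succAbove j) δ (j.predAbove i)
    rw [Fin.succAbove_succAbove_predAbove] at h1
    rw [ker_faceMap, map_sub, h1, faceMap_C]

/-- The involution of pairs of indices that exchanges the order of two face inclusions. -/
def facePairEquiv (n : ℕ) : Fin (n + 2) × Fin (n + 1) ≃ Fin (n + 2) × Fin (n + 1) where
  toFun x := (x.1.succAbove x.2, x.2.predAbove x.1)
  invFun x := (x.1.succAbove x.2, x.2.predAbove x.1)
  left_inv _ := Prod.ext (Fin.succAbove_succAbove_predAbove _ _)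
    (Fin.predAbove_predAbove_succAbove _ _)
  right_inv _ := Prod.ext (Fin.succAbove_succAbove_predAbove _ _)
    (Fin.predAbove_predAbove_succAbove _ _)

/-- Exchanging the order of the two restrictions preserves the terms and reverses the signs. The
double sum thus equals its negative, and it vanishes because groups of cycles are torsion-free. -/
lemma boundary_boundary (hu : Irreducible u) (n : ℕ)
    {V : Cycle (CubeRing (MvPolynomial (Fin d) R) (n + 2))}
    (hV : V ∈ cyclesWithModulus (MvPolynomial.C u) r (n + 2)) :
    boundary _ n (boundary _ (n + 1) V) = 0 := by
  let T : Fin (n + 2) × Fin (n + 1) → Cycle (CubeRing (MvPolynomial (Fin d) R) n) := fun x =>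
    (pullback (faceMap _ x.2 1) (pullback (faceMap _ x.1 1) V) -
      pullback (faceMap _ x.2 1) (pullback (faceMap _ x.1 0) V)) -
    (pullback (faceMap _ x.2 0) (pullback (faceMap _ x.1 1) V) -
      pullback (faceMap _ x.2 0) (pullback (faceMap _ x.1 0) V))
  have hsum : boundary _ n (boundary _ (n + 1) V) =
      ∑ x : Fin (n + 2) × Fin (n + 1), (-1 : ℤ) ^ (x.1 + x.2 : ℕ) • T x := by
    rw [boundary_apply, Fintype.sum_prod_type_right]
    refine Finset.sum_congr rfl fun j _ => ?_
    rw [boundary_apply, map_sum, map_sum, ← Finset.sum_sub_distrib, Finset.smul_sum]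
    refine Finset.sum_congr rfl fun i _ => ?_
    rw [map_zsmul, map_zsmul, map_sub, map_sub, ← smul_sub, smul_smul, ← pow_add,
      add_comm (j : ℕ)]
  have hT : ∀ x, T (facePairEquiv n x) = T x := by
    intro x
    change pullback (faceMap _ (x.2.predAbove x.1) 1) (pullback (faceMap _ (x.1.succAbove x.2) 1) V)
      - pullback (faceMap _ (x.2.predAbove x.1) 1) (pullback (faceMap _ (x.1.succAbove x.2) 0) V) -
      (pullback (faceMap _ (x.2.predAbove x.1) 0) (pullback (faceMap _ (x.1.succAbove x.2) 1) V) -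
      pullback (faceMap _ (x.2.predAbove x.1) 0) (pullback (faceMap _ (x.1.succAbove x.2) 0) V)) = _
    rw [← pullback_faceMap_comm hu _ _ _ _ hV, ← pullback_faceMap_comm hu _ _ _ _ hV,
      ← pullback_faceMap_comm hu _ _ _ _ hV, ← pullback_faceMap_comm hu _ _ _ _ hV]
    exact sub_sub_sub_comm _ _ _ _
  have hneg : (∑ x : Fin (n + 2) × Fin (n + 1), (-1 : ℤ) ^ (x.1 + x.2 : ℕ) • T x) =
      -∑ x : Fin (n + 2) × Fin (n + 1), (-1 : ℤ) ^ (x.1 + x.2 : ℕ) • T x := by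
    rw [← Finset.sum_neg_distrib]
    refine (Equiv.sum_comp (facePairEquiv n) _).symm.trans ?_
    refine Finset.sum_congr rfl fun x _ => ?_
    rw [hT]
    change (-1 : ℤ) ^ (x.1.succAbove x.2 + x.2.predAbove x.1 : ℕ) • T x = _
    rw [Fin.neg_one_pow_succAbove_add_predAbove, neg_smul]
  rw [hsum]
  exact self_eq_neg.1 hneg

lemma formsComplex (hu : Irreducible u) :
    FormsComplex (MvPolynomial (Fin d) R) (MvPolynomial.C u) r where
  boundary_mem _ _ hV := boundary_mem hu hV
  boundary_boundary n _ hV := boundary_boundary hu n hV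
  degenerate_le n := degenerateCycles_le hu n
  boundary_degenerate_mem n _ hV := boundary_degenerate_mem hu n hV

end complex

/-! ### Cycles in good position -/

/-! ### Codimension on faces; generic points of constructible sets. -/

section face

variable {S : Type v} [CommRing S] {n : ℕ}

lemma X_notMem_of_mem_faceLocus {F : Face n} {y : PrimeSpectrum (CubeRing S n)}
    (hy : y ∈ faceLocus S F) {i : Fin n} (hF : F i = some 1) : MvPolynomial.X i ∉ y.asIdeal := by
  intro h
  refine y.2.ne_top ?_
  have h1 := sub_mem h (mem_faceLocus.1 hy i 1 hF)
  rw [sub_sub_cancel] at h1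
  rw [Ideal.eq_top_iff_one]
  simpa using h1

lemma exists_comap_faceMap_eq {i : Fin (n + 1)} {ε : Fin 2} {y : PrimeSpectrum (CubeRing S (n + 1))}
    (hy : MvPolynomial.X i - MvPolynomial.C ((ε : ℕ) : S) ∈ y.asIdeal) :
    ∃ Q, PrimeSpectrum.comap (faceMap S i ε) Q = y := by
  rw [← Ideal.span_singleton_le_iff_mem, ← ker_faceMap] at hy
  have h := range_comap_of_surjective _ (faceMap S i ε) (faceMap_surjective i ε)
  exact h.ge hy

/-- Applied to components of an intersection that lie entirely in a hyperplane `zᵢ = ε`: their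
coheight in W × G is at least the codimension computed on the hyperplane, as the latter is a closed
subspace. -/
lemma codimIn_le_coheight_of_face (W : Set (PrimeSpectrum S)) {i : Fin (n + 1)} {ε : Fin 2}
    {G : Face (n + 1)} (hG : G i = none ∨ G i = some ε) (C : IrreducibleCloseds (prodFace W G))
    (hC : ∀ y ∈ (C : Set (prodFace W G)),
      MvPolynomial.X i - MvPolynomial.C ((ε : ℕ) : S) ∈ (y : PrimeSpectrum _).asIdeal)
    {Z : Set (PrimeSpectrum (CubeRing S n))}
    (hZ : ∀ Q : PrimeSpectrum (CubeRing S n), ∀ y ∈ (C : Set (prodFace W G)),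
      (y : PrimeSpectrum _) = PrimeSpectrum.comap (faceMap S i ε) Q → Q ∈ Z) :
    codimIn (prodFace W fun j => G (i.succAbove j)) Z ≤ Order.coheight C := by
  have hf := PrimeSpectrum.isClosedEmbedding_comap_of_surjective _ (faceMap S i ε)
    (faceMap_surjective i ε)
  rw [← preimage_prodFace W hG]
  refine codim_le_coheight_of_isClosedEmbedding (hf.restrictPreimage (prodFace W G)) C ?_ ?_
  · intro y hy
    obtain ⟨Q, hQ⟩ := exists_comap_faceMap_eq (hC y hy)
    exact ⟨⟨Q, by rw [Set.mem_preimage, hQ]; exact y.2⟩, Subtype.ext hQ⟩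
  · intro Q hQ
    exact hZ Q _ hQ rfl

/-- The face inclusion identifies W × F in the small cube with a product of W and a face of the
large one, and it maps V(q) into V(p). -/
lemma codimIn_insert_le (W : Set (PrimeSpectrum S)) {i : Fin (n + 1)} {ε : Fin 2} (F : Face n)
    {p : PrimeSpectrum (CubeRing S (n + 1))} {q : PrimeSpectrum (CubeRing S n)}
    (hpq : p ≤ PrimeSpectrum.comap (faceMap S i ε) q) :
    codimIn (prodFace W (F.insert i ε)) (primeSupport p) ≤
      codimIn (prodFace W F) (primeSupport q) := by
  have hG : (F.insert i ε) i = none ∨ (F.insert i ε) i = some ε := Or.inr (by simp [Face.insert])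
  have hf := PrimeSpectrum.isClosedEmbedding_comap_of_surjective _ (faceMap S i ε)
    (faceMap_surjective i ε)
  have hF : prodFace W F =
      PrimeSpectrum.comap (faceMap S i ε) ⁻¹' (prodFace W (F.insert i ε)) := by
    rw [preimage_prodFace W hG]
    simp [Face.insert]
  rw [hF]
  have hι := hf.restrictPreimage (prodFace W (F.insert i ε))
  have hsurj : Function.Surjective ((prodFace W (F.insert i ε)).restrictPreimage
      (PrimeSpectrum.comap (faceMap S i ε))) := by
    intro y
    obtain ⟨Q, hQ⟩ := exists_comap_faceMap_eq (mem_faceLocus.1 y.2.2 i ε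
      (by simp [Face.insert]))
    exact ⟨⟨Q, by rw [Set.mem_preimage, hQ]; exact y.2⟩, Subtype.ext hQ⟩
  let Φ := hι.isEmbedding.toHomeomorphOfSurjective hsurj
  refine le_iInf₂ fun C hC => ?_
  refine codim_le_coheight_of_isClosedEmbedding Φ.symm.isClosedEmbedding C
    (fun x _ => ⟨Φ x, Φ.symm_apply_apply x⟩) ?_
  intro y hy
  obtain ⟨x, rfl⟩ := Φ.surjective y
  rw [Set.mem_preimage, Φ.symm_apply_apply] at hy
  exact mem_primeSupport.2 (hpq.trans (Ideal.comap_mono (mem_primeSupport.1 (hC hy))))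

/-- The generic point of an irreducible constructible set `W`, and a principal open subset of the
closure of `W` that is contained in `W`. -/
lemma exists_generic_of_isConstructible {W : Set (PrimeSpectrum S)} (hW : IsConstructible W)
    (hirr : IsIrreducible W) : ∃ (ω : PrimeSpectrum S) (g : S), (∀ s ∈ W, ω ≤ s) ∧
      g ∉ ω.asIdeal ∧ ∀ s : PrimeSpectrum S, ω ≤ s → g ∉ s.asIdeal → s ∈ W := by
  have hgen : closure {hirr.genericPoint} = closure W := hirr.isGenericPoint_genericPoint_closure
  have hle : ∀ s, hirr.genericPoint ≤ s ↔ s ∈ closure W := fun s => by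
    rw [PrimeSpectrum.le_iff_mem_closure, hgen]
  obtain ⟨U, hU, hωU, hUW⟩ := exists_open_inter_closure_subset hW hirr.genericPoint (by
    rw [hgen, Set.inter_eq_left.2 subset_closure, ← hle])
  obtain ⟨_, ⟨g, rfl⟩, hωg, hgU⟩ :=
    PrimeSpectrum.isTopologicalBasis_basic_opens.exists_subset_of_mem_open hωU hU
  exact ⟨hirr.genericPoint, g, fun s hs => (hle s).2 (subset_closure hs), hωg,
    fun s hs hg => hUW ⟨hgU hg, by rw [hgen, ← hle]; exact hs⟩⟩

lemma le_codimIn_add {Y : Set (PrimeSpectrum S)} {Z : Set (PrimeSpectrum S)} {r e : ℕ∞}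
    (h : ∀ C : IrreducibleCloseds Y, (∀ y ∈ (C : Set Y), (y : PrimeSpectrum S) ∈ Z) →
      r ≤ Order.coheight C + e) : r ≤ codimIn Y Z + e :=
  tsub_le_iff_right.1 (le_iInf₂ fun C hC => tsub_le_iff_right.2 (h C hC))

/-- The condition on the components of a cycle in good position. -/
def GoodPosition (r : ℕ) (𝒲 : Set (Set (PrimeSpectrum S))) (e : 𝒲 → ℕ)
    (p : PrimeSpectrum (CubeRing S n)) : Prop :=
  ∀ (W : 𝒲) (F : Face n), (r : ℕ∞) ≤
    codimIn (prodFace (W : Set (PrimeSpectrum S)) F) (primeSupport p) + (e W : ℕ∞)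

lemma GoodPosition.of_le_comap_faceMap {r : ℕ} {𝒲 : Set (Set (PrimeSpectrum S))} {e : 𝒲 → ℕ}
    {p : PrimeSpectrum (CubeRing S (n + 1))} (hp : GoodPosition r 𝒲 e p) {i : Fin (n + 1)}
    {ε : Fin 2} {q : PrimeSpectrum (CubeRing S n)}
    (hpq : p ≤ PrimeSpectrum.comap (faceMap S i ε) q) : GoodPosition r 𝒲 e q := fun W F =>
  (hp W (F.insert i ε)).trans (by gcongr; exact codimIn_insert_le _ _ hpq)

end face

section goodPosition

variable {R : Type v} [CommRing R] [IsDomain R] [IsDiscreteValuationRing R] {u : R} {d n r : ℕ}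
  {𝒲 : Set (Set (PrimeSpectrum (MvPolynomial (Fin d) R)))} {e : 𝒲 → ℕ}

lemma mem_cyclesInGoodPosition_iff {V : Cycle (CubeRing (MvPolynomial (Fin d) R) n)} :
    V ∈ cyclesInGoodPosition (MvPolynomial.C u) r 𝒲 e n ↔
      ∀ p ∈ V.support, Admissible u r p ∧ GoodPosition r 𝒲 e p :=
  forall₂_and.symm

lemma pullback_faceMap_mem_cyclesInGoodPosition (hu : Irreducible u) (i : Fin (n + 1)) (ε : Fin 2)
    {V : Cycle (CubeRing (MvPolynomial (Fin d) R) (n + 1))}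
    (hV : V ∈ cyclesInGoodPosition (MvPolynomial.C u) r 𝒲 e (n + 1)) :
    pullback (faceMap _ i ε) V ∈ cyclesInGoodPosition (MvPolynomial.C u) r 𝒲 e n := by
  refine map_mem_of_forall_single _ _ V fun p hp => ?_
  obtain ⟨h1, h2⟩ := mem_cyclesInGoodPosition_iff.1 hV p hp
  rw [pullback_single, one_smul, mem_cyclesInGoodPosition_iff]
  intro q hq
  obtain ⟨h3, h4⟩ := h1.face hu (mem_minPrimes_of_mem_support hq)
  exact ⟨h3, h2.of_le_comap_faceMap h4⟩

lemma formsSubcomplex (hu : Irreducible u) :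
    FormsSubcomplex (MvPolynomial.C u : MvPolynomial (Fin d) R) r 𝒲 e := by
  intro n V hV
  rw [boundary_apply]
  exact sum_mem fun i _ => zsmul_mem (sub_mem
    (pullback_faceMap_mem_cyclesInGoodPosition hu i 1 hV)
    (pullback_faceMap_mem_cyclesInGoodPosition hu i 0 hV)) _

/-- A finite domain is a field, which a discrete valuation ring is not. Hence there is room for a
generic translation by multiples of `u`. -/
lemma infinite_setOf_dvd (hu : Irreducible u) : {a : R | u ∣ a}.Infinite := by
  have : Infinite R := by
    by_contra h
    rw [not_infinite_iff_finite] at h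
    exact IsDiscreteValuationRing.not_isField R (Finite.isField_of_domain R)
  refine (Set.infinite_range_of_injective (mul_right_injective₀ hu.ne_zero)).mono ?_
  rintro _ ⟨a, rfl⟩
  exact dvd_mul_right u a

/-- For a general `v`, the inverse image of finitely many prime cycles under
`(x, z) ↦ (x + z₀ v, …)` is in good position away from `z₀ = 0`. -/
lemma exists_shearPrime_proper (hu : Irreducible u) (h𝒲 : 𝒲.Finite)
    (h𝒲' : ∀ W ∈ 𝒲, Topology.IsConstructible W ∧ IsIrreducible W ∧
      W ⊆ PrimeSpectrum.basicOpen (MvPolynomial.C u : MvPolynomial (Fin d) R))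
    {ι : Type*} [Finite ι] (n : ι → ℕ)
    (p : ∀ i, PrimeSpectrum (CubeRing (MvPolynomial (Fin d) R) (n i)))
    (hp : ∀ i, Admissible u r (p i)) :
    ∃ v : Fin d → R, (∀ j, u ∣ v j) ∧ ∀ i, ∀ W ∈ 𝒲, ∀ (F : Face (n i + 1))
      (C : IrreducibleCloseds (prodFace W F)), (∀ y ∈ (C : Set (prodFace W F)),
        shearPrime v 0 (p i) ≤ y) →
      (∃ y ∈ (C : Set (prodFace W F)), MvPolynomial.X 0 ∉
        (y : PrimeSpectrum (CubeRing (MvPolynomial (Fin d) R) (n i + 1))).asIdeal) →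
      (r : ℕ∞) ≤ Order.coheight C := by
  have := h𝒲.to_subtype
  choose ω g hω hg hgW using fun W : 𝒲 =>
    exists_generic_of_isConstructible (h𝒲' W W.2).1 (h𝒲' W W.2).2.1
  have hω0 : ∀ W, (ω W).asIdeal.comap (algebraMap R (MvPolynomial (Fin d) R)) = ⊥ := fun W =>
    comap_algebraMap_eq_bot hu fun h => by
      obtain ⟨s, hs⟩ := (h𝒲' W W.2).2.1.1
      exact (h𝒲' W W.2).2.2 hs (hω W s hs h)
  -- One vector serves all pairs of a prime cycle and a set W; finiteness of both index sets is
  -- essential.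
  obtain ⟨v, hv, h⟩ := exists_generic_translation (infinite_setOf_dvd hu)
    (fun x : ι × 𝒲 => n x.1) (fun x => p x.1) (fun x => ω x.2)
    (fun x Q hQ => (hp x.1).comap_eq_bot hu hQ) fun x => (hp x.1).2.1
  refine ⟨v, hv, fun i W hW F C hC hC0 => ?_⟩
  obtain ⟨c, hc, hcC⟩ := exists_generic C
  have hPc : shearPrime v 0 (p i) ≤ c :=
    mem_primeSupport.1 (mem_of_isClosed_of_closure_eq hc (isClosed_primeSupport _)
      fun y hy => mem_primeSupport.2 (hC y hy))
  have hcF : c ∈ faceLocus _ F := mem_of_isClosed_of_closure_eq hc (isClosed_faceLocus F)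
    fun y _ => y.2.2
  have hcW : PrimeSpectrum.comap (MvPolynomial.C) c ∈ W :=
    mem_of_isConstructible_of_closure_eq hc (PrimeSpectrum.continuous_comap _) (h𝒲' W hW).1
      fun y _ => y.2.1
  have hc0 := ((hp i).shear hu hv 0).comap_eq_bot hu hPc
  have hωc := hω ⟨W, hW⟩ _ hcW
  obtain ⟨y, hy, hyX⟩ := hC0
  have h1 := h ⟨i, ⟨W, hW⟩⟩ F c hc0 hωc hcF (fun h => hyX ((hcC y).1 hy h))
    (shearPrime_le_iff.1 hPc)
  -- With `pdim p = d + n - r`, the bound `h1` says that `c` has codimension at least `r` in V(ω) ×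
  -- F inside the cube of dimension `n + 1`.
  have h2 := (hp i).pdim_add hu
  refine natCast_le_coheight_prodFace (hω0 ⟨W, hW⟩) (hg ⟨W, hW⟩) (hgW ⟨W, hW⟩) C hcC hc0 ⟨hcW, hcF⟩
    hωc r ?_
  dsimp only at h1
  omega

/-- A moving vector `v` for two cycles `V` and `V'`. -/
lemma exists_moving_vector (hu : Irreducible u) (h𝒲 : 𝒲.Finite)
    (h𝒲' : ∀ W ∈ 𝒲, Topology.IsConstructible W ∧ IsIrreducible W ∧
      W ⊆ PrimeSpectrum.basicOpen (MvPolynomial.C u : MvPolynomial (Fin d) R)) (e : 𝒲 → ℕ)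
    {m : ℕ} {V : Cycle (CubeRing (MvPolynomial (Fin d) R) n)}
    {g : Cycle (CubeRing (MvPolynomial (Fin d) R) m)}
    (hV : V ∈ cyclesWithModulus (MvPolynomial.C u) r n)
    (hg : g ∈ cyclesInGoodPosition (MvPolynomial.C u) r 𝒲 e m) :
    ∃ v : Fin d → R, (∀ j, u ∣ v j) ∧
      pullback (faceMap _ 0 1) (pullback (shearMap v 0) V) ∈
        cyclesInGoodPosition (MvPolynomial.C u) r 𝒲 e n ∧
      pullback (shearMap v 0) g ∈ cyclesInGoodPosition (MvPolynomial.C u) r 𝒲 e (m + 1) := by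
  -- A single vector is generic for the components of both cycles at once, though they live on cubes
  -- of different dimension.
  obtain ⟨v, hv, h⟩ := exists_shearPrime_proper (ι := V.support ⊕ g.support) hu h𝒲 h𝒲'
    (Sum.elim (fun _ => n) (fun _ => m))
    (fun x => match x with
      | Sum.inl p => (p : PrimeSpectrum (CubeRing (MvPolynomial (Fin d) R) n))
      | Sum.inr p => (p : PrimeSpectrum (CubeRing (MvPolynomial (Fin d) R) m)))
    (fun x => match x with
      | Sum.inl p => mem_cyclesWithModulus_iff.1 hV p p.2
      | Sum.inr p => (mem_cyclesInGoodPosition_iff.1 hg p p.2).1)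
  refine ⟨v, hv, ?_, ?_⟩
  · refine map_mem_of_forall_single ((pullback (faceMap _ 0 1)).comp (pullback (shearMap v 0))) _ V
      fun p hp => ?_
    rw [AddMonoidHom.comp_apply, pullback_shearMap_single, pullback_single, one_smul,
      mem_cyclesInGoodPosition_iff]
    intro q hq
    obtain ⟨h1, h2⟩ := ((mem_cyclesWithModulus_iff.1 hV p hp).shear hu hv 0).face hu
      (mem_minPrimes_of_mem_support hq)
    refine ⟨h1, fun W F => ?_⟩
    -- On the face `z₀ = 1` the coordinate `z₀` vanishes nowhere, so the translate meets W × F in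
    -- codimension at least `r`, without using the allowance `e`.
    refine le_trans (le_trans ?_ (codimIn_insert_le _ F h2)) le_self_add
    refine le_iInf₂ fun C hC => h (Sum.inl ⟨p, hp⟩) W W.2 _ C (fun y hy => ?_) ?_
    · exact mem_primeSupport.1 (hC hy)
    · obtain ⟨y, hy⟩ := C.isIrreducible.1
      exact ⟨y, hy, X_notMem_of_mem_faceLocus y.2.2 rfl⟩
  · refine map_mem_of_forall_single _ _ g fun p hp => ?_
    obtain ⟨h1, h2⟩ := mem_cyclesInGoodPosition_iff.1 hg p hp
    rw [pullback_shearMap_single, mem_cyclesInGoodPosition_iff]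
    intro q hq
    rw [Finset.mem_singleton.1 (Finsupp.support_single_subset hq)]
    refine ⟨h1.shear hu hv 0, fun W F => le_codimIn_add fun C hC => ?_⟩
    -- A component not contained in `z₀ = 0` is controlled by the choice of `v`. On `z₀ = 0` the
    -- shear is the identity, so there the bound comes from the good position of `g`, with its
    -- allowance `e`.
    by_cases hX : ∃ y ∈ (C : Set (prodFace (W : Set (PrimeSpectrum (MvPolynomial (Fin d) R))) F)),
        MvPolynomial.X 0 ∉
          (y : PrimeSpectrum (CubeRing (MvPolynomial (Fin d) R) (m + 1))).asIdeal
    · exact (h (Sum.inr ⟨p, hp⟩) W W.2 F C (fun y hy => mem_primeSupport.1 (hC y hy)) hX).trans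
        le_self_add
    · push Not at hX
      have hF : F 0 = none ∨ F 0 = some 0 := by
        obtain ⟨y, hy⟩ := C.isIrreducible.1
        rcases hF : F 0 with _ | ε
        · exact Or.inl rfl
        · rcases Fin.exists_fin_two.1 ⟨ε, rfl⟩ with rfl | rfl
          · exact Or.inr rfl
          · exact absurd (hX y hy) (X_notMem_of_mem_faceLocus y.2.2 hF)
      refine (h2 W fun j => F (Fin.succAbove 0 j)).trans ?_
      gcongr
      refine codimIn_le_coheight_of_face _ hF C (fun y hy => by simpa using hX y hy)
        fun Q y hy hyQ => ?_
      have h3 := shearPrime_le_iff.1 (mem_primeSupport.1 (hC y hy))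
      rw [hyQ, ← PrimeSpectrum.comap_comp_apply, faceMap_zero_comp_shearMap] at h3
      exact mem_primeSupport.2 h3

end goodPosition

/-! ### The homotopy -/

section homotopy

variable {R : Type v} [CommRing R] [IsDomain R] [IsDiscreteValuationRing R] {u : R} {d n r : ℕ}
  {𝒲 : Set (Set (PrimeSpectrum (MvPolynomial (Fin d) R)))} {e : 𝒲 → ℕ}

lemma pullback_faceMap_zero_shearMap (v : Fin d → R)
    (V : Cycle (CubeRing (MvPolynomial (Fin d) R) n)) :
    pullback (faceMap _ 0 0) (pullback (shearMap v 0) V) = V := by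
  rw [pullback_pullback_of_isPolynomialExtension (isPolynomialExtension_shearMap v 0),
    faceMap_zero_comp_shearMap, pullback_id]

lemma boundary_pullback_shearMap_zero (v : Fin d → R)
    (V : Cycle (CubeRing (MvPolynomial (Fin d) R) 0)) :
    boundary _ 0 (pullback (shearMap v 0) V) =
      pullback (faceMap _ 0 1) (pullback (shearMap v 0) V) - V := by
  rw [boundary_apply, Fin.sum_univ_succ, pullback_faceMap_zero_shearMap]
  simp

/-- The homotopy formula: the faces `z₀ = 1` and `z₀ = 0` give the translate and the cycle itself;
all other faces commute with the shear, with their index raised by one and hence their sign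
reversed. -/
lemma boundary_pullback_shearMap_succ (v : Fin d → R)
    (V : Cycle (CubeRing (MvPolynomial (Fin d) R) (n + 1))) :
    boundary _ (n + 1) (pullback (shearMap v 0) V) =
      pullback (faceMap _ 0 1) (pullback (shearMap v 0) V) - V -
        pullback (shearMap v 0) (boundary _ n V) := by
  have h : ∀ (j : Fin (n + 1)) (ε : Fin 2),
      pullback (faceMap _ j.succ ε) (pullback (shearMap v 0) V) =
        pullback (shearMap v 0) (pullback (faceMap _ j ε) V) := fun j ε => by
    have h1 := pullback_faceMap_shearMap_succAbove v 0 j ε V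
    rwa [Fin.succAbove_zero, Fin.predAbove_right_zero] at h1
  rw [boundary_apply, Fin.sum_univ_succ, pullback_faceMap_zero_shearMap, boundary_apply, map_sum,
    Fin.val_zero, pow_zero, one_smul, sub_eq_add_neg _ (∑ i, _), ← Finset.sum_neg_distrib]
  congr 1
  refine Finset.sum_congr rfl fun j _ => ?_
  rw [h, h, map_zsmul, map_sub, Fin.val_succ, pow_succ, mul_neg_one, neg_smul]

lemma shearMap_comp_degeneracyMap (v : Fin d → R) (i : Fin (n + 1)) :
    (shearMap v 0).comp (degeneracyMap (MvPolynomial (Fin d) R) i) =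
      (degeneracyMap _ i.succ).comp (shearMap v 0) := by
  refine cubeRing_ringHom_ext (fun a => ?_) (fun j => ?_) fun l => ?_
  · simp
  · rw [RingHom.comp_apply, RingHom.comp_apply, degeneracyMap_C, shearMap_C_X, shearMap_C_X]
    simp
  · rw [RingHom.comp_apply, RingHom.comp_apply, degeneracyMap_X, shearMap_X, shearMap_X,
      degeneracyMap_X]
    simp

lemma pullback_shearMap_degeneracyMap (v : Fin d → R) (i : Fin (n + 1))
    (V : Cycle (CubeRing (MvPolynomial (Fin d) R) n)) :
    pullback (shearMap v 0) (pullback (degeneracyMap _ i) V) =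
      pullback (degeneracyMap _ i.succ) (pullback (shearMap v 0) V) := by
  rw [pullback_pullback_of_isPolynomialExtension (isPolynomialExtension_degeneracyMap i),
    pullback_pullback_of_isPolynomialExtension (isPolynomialExtension_shearMap v 0)]
  rw [shearMap_comp_degeneracyMap]

/-- The homotopy adds its coordinate in front, so a coordinate on which the cycle does not depend
merely moves up by one place. -/
lemma pullback_shearMap_mem_degenerateCycles (hu : Irreducible u) {v : Fin d → R}
    (hv : ∀ j, u ∣ v j) {V : Cycle (CubeRing (MvPolynomial (Fin d) R) n)}
    (hV : V ∈ degenerateCycles (S := MvPolynomial (Fin d) R) (MvPolynomial.C u) r n) :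
    pullback (shearMap v 0) V ∈
      degenerateCycles (S := MvPolynomial (Fin d) R) (MvPolynomial.C u) r (n + 1) := by
  cases n with
  | zero =>
    obtain rfl : V = 0 := hV
    rw [map_zero]
    exact zero_mem _
  | succ n =>
    refine map_mem_of_mem_degenerateCycles _ (pullback (shearMap v 0)) (fun i W hW => ?_) hV
    rw [pullback_shearMap_degeneracyMap]
    exact pullback_degeneracyMap_mem_degenerateCycles _ (pullback_shearMap_mem hu hv 0 hW)

/-- A cycle whose boundary is in good position up to degenerate cycles can be moved into good
position, up to boundaries and degenerate cycles. -/
lemma exists_sub_boundary_mem (hu : Irreducible u) (h𝒲 : 𝒲.Finite)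
    (h𝒲' : ∀ W ∈ 𝒲, Topology.IsConstructible W ∧ IsIrreducible W ∧
      W ⊆ PrimeSpectrum.basicOpen (MvPolynomial.C u : MvPolynomial (Fin d) R)) (e : 𝒲 → ℕ)
    {V : Cycle (CubeRing (MvPolynomial (Fin d) R) n)}
    (hV : V ∈ cyclesWithModulus (MvPolynomial.C u) r n)
    (hd : ∀ m, ∀ h : n = m + 1, ∃ g ∈ cyclesInGoodPosition (MvPolynomial.C u) r 𝒲 e m,
      boundary _ m (h ▸ V) - g ∈
        degenerateCycles (S := MvPolynomial (Fin d) R) (MvPolynomial.C u) r m) :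
    ∃ Y ∈ cyclesWithModulus (MvPolynomial.C u) r (n + 1),
      ∃ g ∈ cyclesInGoodPosition (MvPolynomial.C u) r 𝒲 e n, V - boundary _ n Y - g ∈
        degenerateCycles (S := MvPolynomial (Fin d) R) (MvPolynomial.C u) r n := by
  cases n with
  | zero =>
    obtain ⟨v, hv, h1, -⟩ := exists_moving_vector (m := 0) (g := 0) hu h𝒲 h𝒲' e hV (zero_mem _)
    -- In degree zero there is no boundary to correct: V is its translate minus the boundary of the
    -- homotopy.
    refine ⟨-pullback (shearMap v 0) V, neg_mem (pullback_shearMap_mem hu hv 0 hV), _, h1, ?_⟩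
    rw [map_neg, boundary_pullback_shearMap_zero]
    rw [show V - -(pullback (faceMap _ 0 1) (pullback (shearMap v 0) V) - V) -
      pullback (faceMap _ 0 1) (pullback (shearMap v 0) V) = 0 by abel]
    exact zero_mem _
  | succ n =>
    obtain ⟨g, hg, hδ⟩ := hd n rfl
    obtain ⟨v, hv, h1, h2⟩ := exists_moving_vector hu h𝒲 h𝒲' e hV hg
    -- With H the shear and τ the translate, V = τV - ∂HV - H∂V and H∂V = Hg + Hδ for a degenerate
    -- δ. The part in good position is τV - Hg, and the remainder is -Hδ.
    refine ⟨-pullback (shearMap v 0) V, neg_mem (pullback_shearMap_mem hu hv 0 hV), _,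
      sub_mem h1 h2, ?_⟩
    rw [map_neg, boundary_pullback_shearMap_succ]
    convert neg_mem (pullback_shearMap_mem_degenerateCycles hu hv hδ) using 1
    rw [map_sub]
    abel

end homotopy

/-! ### A criterion for quasi-isomorphisms -/

section quasiIso

variable {K L : ChainComplex AddCommGrpCat.{v} ℕ} (φ : K ⟶ L)

/-- Elementwise lifts need not be additive; passing to the fibre product, which surjects onto `A`,
turns them into a homomorphism. -/
lemma exists_epi_of_surjOn {A B C : AddCommGrpCat.{v}} (f : A ⟶ C) (g : B ⟶ C)
    (h : ∀ a, ∃ b, f a = g b) :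
    ∃ (A' : AddCommGrpCat.{v}) (π : A' ⟶ A) (_ : Epi π) (x : A' ⟶ B), π ≫ f = x ≫ g := by
  let H : AddSubgroup (A × B) := (f.hom.comp (AddMonoidHom.fst A B) -
    g.hom.comp (AddMonoidHom.snd A B)).ker
  refine ⟨AddCommGrpCat.of H, AddCommGrpCat.ofHom ((AddMonoidHom.fst A B).comp H.subtype), ?_,
    AddCommGrpCat.ofHom ((AddMonoidHom.snd A B).comp H.subtype), ?_⟩
  · rw [AddCommGrpCat.epi_iff_surjective]
    intro a
    obtain ⟨b, hb⟩ := h a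
    exact ⟨⟨(a, b), sub_eq_zero.2 hb⟩, rfl⟩
  · ext x
    exact sub_eq_zero.1 x.2

/-- A monomorphism of complexes is a quasi-isomorphism if each chain whose boundary comes from the
source is, up to a boundary, in the source. -/
lemma quasiIso_of_injective (hinj : ∀ j, Function.Injective (φ.f j))
    (h : ∀ (j : ℕ) (y : L.X j), (∀ k, ∃ x, φ.f k x = L.d j k y) →
      ∃ (x : K.X j) (z : L.X (j + 1)), y = φ.f j x + L.d (j + 1) j z) : QuasiIso φ := by
  have hcomm : ∀ (i j : ℕ) (x : K.X i), L.d i j (φ.f i x) = φ.f j (K.d i j x) := fun i j x => by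
    rw [← ConcreteCategory.comp_apply, ← ConcreteCategory.comp_apply, φ.comm]
  have hdd : ∀ (i j k : ℕ) (x : L.X i), L.d j k (L.d i j x) = 0 := fun i j k x => by
    rw [← ConcreteCategory.comp_apply, L.d_comp_d]
    rfl
  have hall : ∀ {j : ℕ} {y : L.X j},
      L.d j ((ComplexShape.down ℕ).next j) y = 0 → ∀ k, L.d j k y = 0 := fun {j y} hy k => by
    by_cases hk : (ComplexShape.down ℕ).Rel j k
    · rwa [(ComplexShape.down ℕ).next_eq' hk] at hy
    · rw [L.shape j k hk]
      rfl
  refine (quasiIso_iff φ).2 fun j => ?_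
  rw [quasiIsoAt_iff_isIso_homologyMap]
  -- If `x₂` becomes the boundary of `y₁`, the hypothesis in degree `j + 1` writes `y₁` as an
  -- element of the source plus a boundary, and that element has boundary `x₂` by injectivity.
  have hmono : Mono (HomologicalComplex.homologyMap φ j) := by
    rw [HomologicalComplex.mono_homologyMap_iff_up_to_refinements φ (j + 1) j _
      ((ComplexShape.down ℕ).prev_eq' rfl) rfl]
    intro A x₂ hx₂ y₁ hy₁
    refine exists_epi_of_surjOn x₂ (K.d (j + 1) j) fun a => ?_
    have ha : φ.f j (x₂ a) = L.d (j + 1) j (y₁ a) := by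
      rw [← ConcreteCategory.comp_apply, hy₁, ConcreteCategory.comp_apply]
    obtain ⟨x, z, hxz⟩ := h (j + 1) (y₁ a) fun k => by
      by_cases hk : (ComplexShape.down ℕ).Rel (j + 1) k
      · obtain rfl : k = j := by simpa using hk
        exact ⟨x₂ a, ha⟩
      · refine ⟨0, ?_⟩
        rw [L.shape _ k hk, map_zero]
        rfl
    refine ⟨x, hinj j ?_⟩
    rw [ha, hxz, map_add, hdd, add_zero, hcomm]
  -- A cycle has zero boundary, which comes from the source, so the hypothesis represents its class
  -- by an element of the source; injectivity makes that element a cycle.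
  have hepi : Epi (HomologicalComplex.homologyMap φ j) := by
    rw [HomologicalComplex.epi_homologyMap_iff_up_to_refinements φ (j + 1) j _
      ((ComplexShape.down ℕ).prev_eq' rfl) rfl]
    intro A y₂ hy₂
    have hy : ∀ a k, L.d j k (y₂ a) = 0 := fun a => hall (by
      rw [← ConcreteCategory.comp_apply, hy₂]
      rfl)
    obtain ⟨A', π, hπ, x, hx⟩ := exists_epi_of_surjOn (B := AddCommGrpCat.of (K.X j × L.X (j + 1)))
      y₂ (AddCommGrpCat.ofHom ((φ.f j).hom.coprod (L.d (j + 1) j).hom)) fun a => by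
        obtain ⟨x, z, hxz⟩ := h j (y₂ a) fun k => ⟨0, by rw [hy, map_zero]⟩
        exact ⟨(x, z), hxz⟩
    have hx' : ∀ a, y₂ (π a) = φ.f j (x a).1 + L.d (j + 1) j (x a).2 := fun a =>
      ConcreteCategory.congr_hom hx a
    refine ⟨A', π, hπ, AddCommGrpCat.ofHom ((AddMonoidHom.fst _ _).comp x.hom), ?_,
      AddCommGrpCat.ofHom ((AddMonoidHom.snd _ _).comp x.hom), ?_⟩
    · ext a
      refine hinj _ ?_
      change φ.f _ (K.d j _ (x a).1) = φ.f _ 0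
      rw [← hcomm, map_zero, eq_sub_of_add_eq (hx' a).symm, map_sub, hdd, hy, sub_zero]
    · ext a
      exact hx' a
  exact isIso_of_mono_of_epi _

end quasiIso

/-! ### The quasi-isomorphism. -/

section main

variable {R : Type v} [CommRing R] [IsDomain R] [IsDiscreteValuationRing R] {u : R} {d r : ℕ}
  {𝒲 : Set (Set (PrimeSpectrum (MvPolynomial (Fin d) R)))}

lemma quasiIso_goodPositionInclusion (hu : Irreducible u) (h𝒲 : 𝒲.Finite)
    (h𝒲' : ∀ W ∈ 𝒲, Topology.IsConstructible W ∧ IsIrreducible W ∧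
      W ⊆ PrimeSpectrum.basicOpen (MvPolynomial.C u : MvPolynomial (Fin d) R)) (e : 𝒲 → ℕ)
    (h : FormsComplex (MvPolynomial (Fin d) R) (MvPolynomial.C u) r)
    (h' : FormsSubcomplex (MvPolynomial.C u) r 𝒲 e) : QuasiIso (goodPositionInclusion h h') := by
  have hd : ∀ (n : ℕ) (V : cyclesWithModulus (MvPolynomial.C u : MvPolynomial (Fin d) R) r (n + 1)),
      (cycleComplex h).d (n + 1) n (QuotientAddGroup.mk V) =
        QuotientAddGroup.mk ⟨boundary _ n V, h.boundary_mem n V V.2⟩ := by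
    intro n V
    simp only [cycleComplex, ChainComplex.of_d]
    rfl
  have hf : ∀ (n : ℕ) (V : cyclesInGoodPosition (MvPolynomial.C u) r 𝒲 e n),
      (goodPositionInclusion h h').f n (QuotientAddGroup.mk V) =
        QuotientAddGroup.mk ⟨V, V.2.1⟩ := fun n V => rfl
  refine quasiIso_of_injective _ (fun n => ?_) fun n y hy => ?_
  -- Both quotients are by cycles in the same group of degenerate cycles, so nothing new becomes
  -- zero in the larger complex.
  · refine (injective_iff_map_eq_zero ((goodPositionInclusion h h').f n).hom).2 fun x hx => ?_
    obtain ⟨V, rfl⟩ := QuotientAddGroup.mk_surjective x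
    exact (QuotientAddGroup.eq_zero_iff _).2 ((QuotientAddGroup.eq_zero_iff
      (⟨V, V.2.1⟩ : cyclesWithModulus (MvPolynomial.C u : MvPolynomial (Fin d) R) r n)).1 hx)
  · obtain ⟨V, rfl⟩ := QuotientAddGroup.mk_surjective y
    -- A class whose boundary comes from the subcomplex means a cycle whose boundary is in good
    -- position up to degenerate cycles, which is the input of the moving argument.
    obtain ⟨Y, hY, g, hg, hδ⟩ := exists_sub_boundary_mem hu h𝒲 h𝒲' e V.2 fun m hm => by
      subst hm
      obtain ⟨x, hx⟩ := hy m
      obtain ⟨g, rfl⟩ := QuotientAddGroup.mk_surjective x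
      rw [hd, hf] at hx
      refine ⟨g, g.2, ?_⟩
      have h1 := QuotientAddGroup.eq.1 hx
      rw [AddSubgroup.mem_addSubgroupOf] at h1
      rwa [sub_eq_neg_add]
    refine ⟨QuotientAddGroup.mk ⟨g, hg⟩, QuotientAddGroup.mk ⟨Y, hY⟩, ?_⟩
    rw [hd, hf]
    refine QuotientAddGroup.eq.2 ?_
    rw [AddSubgroup.mem_addSubgroupOf]
    convert neg_mem hδ using 1
    change -(V : Cycle _) + (g + boundary _ n Y) = _
    abel

end main

end ModulusCycles

end

theorem mainTheorem7 {k : Type*} [Field k] {R : Type*} [CommRing R] [IsDomain R]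
    [IsDiscreteValuationRing R] [Algebra k R] (u : R) (hu : Irreducible u) (d r : ℕ)
    (𝒲 : Set (Set (PrimeSpectrum (MvPolynomial (Fin d) R)))) (h𝒲 : 𝒲.Finite)
    (h𝒲_generic : ∀ W ∈ 𝒲, Topology.IsConstructible W ∧ IsIrreducible W ∧
      W ⊆ PrimeSpectrum.basicOpen (MvPolynomial.C u : MvPolynomial (Fin d) R))
    (e : 𝒲 → ℕ) :
    ∃ (h : ModulusCycles.FormsComplex (MvPolynomial (Fin d) R) (MvPolynomial.C u) r)
      (h' : ModulusCycles.FormsSubcomplex (MvPolynomial.C u) r 𝒲 e),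
      QuasiIso (ModulusCycles.goodPositionInclusion h h') := by
  exact ⟨ModulusCycles.formsComplex hu, ModulusCycles.formsSubcomplex hu,
    ModulusCycles.quasiIso_goodPositionInclusion hu h𝒲 h𝒲_generic e _ _⟩
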